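/- Let $\Omega=(0,1)$, let $b,c,f\in C^2([0,1])$, and let $\lambda,\beta,\gamma>0$ be constants with $b\ge\lambda$ and $c\ge\beta$ on $[0,1]$. Let $p\in(0,1)$ and $\tau\ge \frac52$. For $\varepsilon_1,\varepsilon_2>0$ let $u\in H^1_0(\Omega)$ be the (weak) solution of $$-\varepsilon_1u''+\varepsilon_2 b u'+cu=f\ \text{ in }\Omega,\qquad u(0)=u(1)=0,$$ that is, $\varepsilon_1(u',v')+\varepsilon_2(bu',v)+(cu,v)=(f,v)$ for all $v\in H^1_0(\Omega)$, with $(\cdot,\cdot)$ the scalar product of $L^2(\Omega)$ and $u$ taken continuous on $[0,1]$. The energy norm is $\|v\|_E=(\varepsilon_1\|v'\|_{L^2(\Omega)}^2+\|v\|_{L^2(\Omega)}^2)^{1/2}$ for $v\in H^1(\Omega)$. Let $g_0(x)<0<g_1(x)$ be the roots of $-\varepsilon_1g^2+\varepsilon_2b(x)g+c(x)=0$ and put $$\mu_0=-\max_{[0,1]}g_0,\qquad \mu_1=\min_{[0,1]}g_1,\qquad \sigma_j=\frac{\tau}{p\mu_j}\ln\mu_j\quad(j=0,1).$$ For $N\in\mathbb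 N$ divisible by $4$ let $t_i=i/N$, and define the Bakhvalov-type mesh $$x_i=\begin{cases}\frac{\tau}{p\mu_0}\varphi_0(t_i), & 0\le i\le \frac N4,\\ \sigma_0+2(t_i-\frac14)(1-\sigma_0-\sigma_1), & \frac N4\le i\le\frac{3N}4,\\ 1-\frac{\tau}{p\mu_1}\varphi_1(t_i), & \frac{3N}4\le i\le N,\end{cases}$$ where $\varphi_0(t)=-\ln(1-4(1-\mu_0^{-1})t)$ and $\varphi_1(t)=-\ln(1-4(1-\mu_1^{-1})(1-t))$. Let $u^I$ be the continuous function on $[0,1]$ that is linear on every $[x_i,x_{i+1}]$ and satisfies $u^I(x_i)=u(x_i)$ for $0\le i\le N$. Theorem. There is a constant $C>0$, depending only on $b,c,f,\lambda,\beta,\gamma,p,\tau$ (and not on $\varepsilon_1,\varepsilon_2,N$), such that for all $\varepsilon_1,\varepsilon_2>0$ with $c-\frac12\varepsilon_2b'\ge\gamma$ on $[0,1]$ and all $N\ge16$ divisible by $4$ with $\sigma_0,\sigma_1\le\frac14$ and $\mu_0^{-1}\le N^{-1}$, one has $u-u^I\in H^1(\Omega)$ and $$\|u-u^I\|_E\le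 C(\varepsilon_2+\varepsilon_1^{1/2})^{1/2}N^{-1}+CN^{-2}.$$ -/

import Mathlib

open Set MeasureTheory

noncomputable section

namespace TwoParam

/-! ### The Sobolev spaces `H¹(0,1)` and `H¹₀(0,1)` -/

/-- Lebesgue measure on `Ω = (0,1)`. -/
def vol : Measure ℝ := volume.restrict (Ioo (0 : ℝ) 1)

/-- `w` is a weak derivative of `v` on `(0,1)`. -/
def HasWeakDeriv (v w : ℝ → ℝ) : Prop :=
  LocallyIntegrableOn v (Ioo 0 1) ∧ LocallyIntegrableOn w (Ioo 0 1) ∧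
    ∀ φ : ℝ → ℝ, ContDiff ℝ (⊤ : ℕ∞) φ → HasCompactSupport φ → tsupport φ ⊆ Ioo 0 1 →
      ∫ x, v x * deriv φ x ∂vol = -∫ x, w x * φ x ∂vol

open Classical in
/-- The weak derivative of `v` on `(0,1)` (unique almost everywhere, see `weakDeriv_ae_eq`);
the zero function if there is none. -/
def weakDeriv (v : ℝ → ℝ) : ℝ → ℝ :=
  if h : ∃ w, HasWeakDeriv v w then h.choose else 0

theorem HasWeakDeriv.ae_unique {v w₁ w₂ : ℝ → ℝ} (h₁ : HasWeakDeriv v w₁)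
    (h₂ : HasWeakDeriv v w₂) : w₁ =ᵐ[vol] w₂ := by
  have hU : IsOpen (Ioo (0 : ℝ) 1) := isOpen_Ioo
  have key := hU.ae_eq_zero_of_integral_contDiff_smul_eq_zero (μ := volume)
    (h₁.2.1.sub h₂.2.1) (by
      intro g hg hc hs
      have e₁ := h₁.2.2 g hg hc hs
      have e₂ := h₂.2.2 g hg hc hs
      have hz : ∀ x, x ∉ Ioo (0 : ℝ) 1 → g x • (w₁ - w₂) x = 0 := by
        intro x hx
        rw [image_eq_zero_of_notMem_tsupport (fun h => hx (hs h)), zero_smul]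
      have hint : ∀ w : ℝ → ℝ, LocallyIntegrableOn w (Ioo 0 1) →
          Integrable (fun x => w x * g x) vol := by
        intro w hw
        have hi : IntegrableOn w (tsupport g) := hw.integrableOn_compact_subset hs hc
        have : IntegrableOn (fun x => w x * g x) (tsupport g) :=
          hi.mul_continuousOn hg.continuous.continuousOn hc
        have h3 : Integrable (fun x => w x * g x) volume := by
          rw [integrableOn_iff_integrable_of_support_subset] at this
          · exact this
          · intro x hx
            by_contra hn
            apply hx
            simp [image_eq_zero_of_notMem_tsupport hn]
        exact h3.restrict
      rw [← setIntegral_eq_integral_of_forall_compl_eq_zero hz]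
      have : ∫ x in Ioo (0 : ℝ) 1, g x • (w₁ - w₂) x
          = (∫ x, w₁ x * g x ∂vol) - ∫ x, w₂ x * g x ∂vol := by
        rw [← integral_sub (hint _ h₁.2.1) (hint _ h₂.2.1)]
        refine integral_congr_ae (Filter.Eventually.of_forall fun x => ?_)
        simp only [Pi.sub_apply, smul_eq_mul]
        ring
      rw [this]
      linarith)
  unfold vol
  rw [Filter.EventuallyEq, ae_restrict_iff' measurableSet_Ioo]
  filter_upwards [key] with x hx hxm
  have := hx hxm
  simp only [Pi.sub_apply] at this
  linarith

theorem weakDeriv_ae_eq {v w : ℝ → ℝ} (h : HasWeakDeriv v w) : weakDeriv v =ᵐ[vol] w := by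
  have hex : ∃ w, HasWeakDeriv v w := ⟨w, h⟩
  unfold weakDeriv
  rw [dif_pos hex]
  exact hex.choose_spec.ae_unique h

/-- `v ∈ H¹(0,1)`. -/
def MemH1 (v : ℝ → ℝ) : Prop :=
  MemLp v 2 vol ∧ ∃ w, MemLp w 2 vol ∧ HasWeakDeriv v w

/-- `v ∈ H¹₀(0,1)`, where `v` stands for its representative that is continuous on `[0,1]`. -/
def MemH10 (v : ℝ → ℝ) : Prop :=
  MemH1 v ∧ ContinuousOn v (Icc 0 1) ∧ v 0 = 0 ∧ v 1 = 0

/-- The energy norm `‖v‖_E = (ε₁ |v|₁² + ‖v‖²)^{1/2}` of `v ∈ H¹(0,1)`. -/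
def energyNorm (ε₁ : ℝ) (v : ℝ → ℝ) : ℝ :=
  √(ε₁ * ∫ x, weakDeriv v x ^ 2 ∂vol + ∫ x, v x ^ 2 ∂vol)

/-! ### The boundary value problem -/

/-- The bilinear form `a(u,v) = ε₁ (u',v') + ε₂ (b u',v) + (c u,v)`. -/
def bilin (ε₁ ε₂ : ℝ) (b c u v : ℝ → ℝ) : ℝ :=
  ε₁ * (∫ x, weakDeriv u x * weakDeriv v x ∂vol)
    + ε₂ * (∫ x, b x * weakDeriv u x * v x ∂vol) + ∫ x, c x * u x * v x ∂vol

/-- `u ∈ H¹₀(0,1)` is the solution of `-ε₁ u'' + ε₂ b u' + c u = f` in `(0,1)`,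
`u(0) = u(1) = 0`, in the weak sense. -/
def IsSolution (ε₁ ε₂ : ℝ) (b c f u : ℝ → ℝ) : Prop :=
  MemH10 u ∧ ∀ v, MemH10 v → bilin ε₁ ε₂ b c u v = ∫ x, f x * v x ∂vol

/-! ### The layer parameters -/

/-- The negative root of `-ε₁ g² + ε₂ b(x) g + c(x) = 0`. -/
def g₀ (ε₁ ε₂ : ℝ) (b c : ℝ → ℝ) (x : ℝ) : ℝ :=
  (ε₂ * b x - √((ε₂ * b x) ^ 2 + 4 * ε₁ * c x)) / (2 * ε₁)

/-- The positive root of `-ε₁ g² + ε₂ b(x) g + c(x) = 0`. -/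
def g₁ (ε₁ ε₂ : ℝ) (b c : ℝ → ℝ) (x : ℝ) : ℝ :=
  (ε₂ * b x + √((ε₂ * b x) ^ 2 + 4 * ε₁ * c x)) / (2 * ε₁)

/-- `μ₀ = - max_{[0,1]} g₀`. -/
def mu₀ (ε₁ ε₂ : ℝ) (b c : ℝ → ℝ) : ℝ := -sSup (g₀ ε₁ ε₂ b c '' Icc 0 1)

/-- `μ₁ = min_{[0,1]} g₁`. -/
def mu₁ (ε₁ ε₂ : ℝ) (b c : ℝ → ℝ) : ℝ := sInf (g₁ ε₁ ε₂ b c '' Icc 0 1)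

/-! ### The Bakhvalov-type mesh and Lagrange interpolation -/

/-- `σ = τ / (p μ) · ln μ`. -/
def sigma (τ p μ : ℝ) : ℝ := τ / (p * μ) * Real.log μ

/-- `φ₀(t) = -ln (1 - 4 (1 - μ₀⁻¹) t)`. -/
def phi₀ (μ₀ t : ℝ) : ℝ := -Real.log (1 - 4 * (1 - μ₀⁻¹) * t)

/-- `φ₁(t) = -ln (1 - 4 (1 - μ₁⁻¹) (1 - t))`. -/
def phi₁ (μ₁ t : ℝ) : ℝ := -Real.log (1 - 4 * (1 - μ₁⁻¹) * (1 - t))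

/-- The mesh points `x_i`, `0 ≤ i ≤ N` (`N` divisible by 4). The first case is `i ≤ N/4`, the
second one `N/4 < i ≤ 3N/4`, the third one `3N/4 < i`. -/
def meshPt (τ p μ₀ μ₁ : ℝ) (N i : ℕ) : ℝ :=
  if 4 * i ≤ N then τ / (p * μ₀) * phi₀ μ₀ (i / N)
  else if 4 * i ≤ 3 * N then
    sigma τ p μ₀ + 2 * ((i : ℝ) / N - 1 / 4) * (1 - sigma τ p μ₀ - sigma τ p μ₁)
  else 1 - τ / (p * μ₁) * phi₁ μ₁ (i / N)

/-- The hat function `θ_i` of the mesh `X 0 < X 1 < ⋯ < X N`: it is linear on each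
`[X j, X (j+1)]` and `θ_i (X j) = δ_{ij}`. -/
def hat (X : ℕ → ℝ) (N i : ℕ) (x : ℝ) : ℝ :=
  if 0 < i ∧ X (i - 1) ≤ x ∧ x ≤ X i then (x - X (i - 1)) / (X i - X (i - 1))
  else if i < N ∧ X i ≤ x ∧ x ≤ X (i + 1) then (X (i + 1) - x) / (X (i + 1) - X i)
  else 0

/-- The Lagrange interpolant `v^I = ∑_{i=0}^N v(x_i) θ_i`. -/
def lagrange (X : ℕ → ℝ) (N : ℕ) (v : ℝ → ℝ) (x : ℝ) : ℝ :=
  ∑ i ∈ Finset.range (N + 1), v (X i) * hat X N i x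

end TwoParam

end

noncomputable section

namespace TwoParam

/-! ### Weak derivatives on `(0,1)` -/

/-! Everything rests on the pointwise bound `|u''| ≤ K (1 + μ₀² e^{-pμ₀x} + μ₁² e^{-pμ₁(1-x)})`,
with `K` independent of `ε₁, ε₂`. By `IsSolution.regular` the weak solution is classical, and with
C² data the equation may be differentiated twice. Then `u`, `u'` and `u''` solve equations `-ε₁ψ'' +
ε₂bψ' + (c + kε₂b')ψ = g` with `k = 0, 1, 2`, and a minimum principle with exponential barriers
bounds each of them in turn (`exists_first_deriv_bound`, `exists_second_deriv_bound`). The barriers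
work because `μ₀` and `μ₁` are extremal characteristic roots (`layerRates`): slowing the rates down
by the factor `p < 1` leaves a fraction of `c` to spare, which absorbs `kε₂b'` as soon as `4ε₂M ≤
(1-p)β`.

Distributing `u''` over the three terms of its bound and integrating each layer part twice from its
far end splits `u` into a smooth part with bounded second derivative and two exponential layers
(`exists_decomposition`). All mesh widths are `O(1/N)`, which settles the smooth part. For a layer
of rate `μ`, each mesh interval `[a, b]` either satisfies `(b-a) μ e^{-pμa/2} = O(1/N)`, or lies
where `e^{-pμx} = O(N⁻²)` (`MeshParams.adapted`). This gives a pointwise error `O(N⁻²)`. In the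
squared derivative error the exponential stays under the integral, so summation yields `N⁻² μ² ∫
e^{-pμx} = O(N⁻² μ)` (`IsMesh.error_bounds`), and `ε₁ μ₁ ≤ M (ε₂ + √ε₁)` turns this into the
asserted energy bound.

If `4ε₂M > (1-p)β`, then `μ₀` is bounded, hence so is `N ≤ μ₀`. A bound for the error that is merely
uniform (`energyNorm_err_le`) can then be absorbed into `C N⁻²`. -/

theorem integral_vol (g : ℝ → ℝ) : ∫ x, g x ∂vol = ∫ x in (0 : ℝ)..1, g x := by
  rw [intervalIntegral.integral_of_le zero_le_one, integral_Ioc_eq_integral_Ioo]; rfl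

theorem integrable_vol_iff {g : ℝ → ℝ} :
    Integrable g vol ↔ IntervalIntegrable g volume 0 1 := by
  rw [intervalIntegrable_iff_integrableOn_Ioo_of_le zero_le_one]; rfl

instance : IsFiniteMeasure vol := by unfold vol; infer_instance

theorem ae_vol_iff {P : ℝ → Prop} : (∀ᵐ x ∂vol, P x) ↔ ∀ᵐ x, x ∈ Ioo (0 : ℝ) 1 → P x := by
  unfold vol; rw [ae_restrict_iff' measurableSet_Ioo]

theorem locallyIntegrableOn_of_integrable {g : ℝ → ℝ} (hg : Integrable g vol) :
    LocallyIntegrableOn g (Ioo 0 1) := IntegrableOn.locallyIntegrableOn hg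

theorem test_zero {φ : ℝ → ℝ} (hs : tsupport φ ⊆ Ioo 0 1) {x : ℝ} (hx : x ∉ Ioo (0 : ℝ) 1) :
    φ x = 0 := image_eq_zero_of_notMem_tsupport (fun h => hx (hs h))

/-- A primitive of an integrable function has this function as its weak derivative. -/
theorem hasWeakDeriv_primitive {v h : ℝ → ℝ} {k : ℝ} (hh : Integrable h vol)
    (hv : ∀ x ∈ Ioo (0 : ℝ) 1, v x = k + ∫ t in (0 : ℝ)..x, h t) : HasWeakDeriv v h := by
  have hi : IntervalIntegrable h volume 0 1 := integrable_vol_iff.1 hh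
  set V : ℝ → ℝ := fun x => ∫ t in (0 : ℝ)..x, h t with hV
  have hac : AbsolutelyContinuousOnInterval V 0 1 :=
    hi.absolutelyContinuousOnInterval_intervalIntegral (by simp)
  have hac' : AbsolutelyContinuousOnInterval (fun x => k + V x) 0 1 := by
    have hk : AbsolutelyContinuousOnInterval (fun _ : ℝ => k) 0 1 :=
      contDiffOn_const.absolutelyContinuousOnInterval
    exact hk.add hac
  have hcont := hac'.continuousOn
  rw [uIcc_of_le zero_le_one] at hcont
  have hvc : ContinuousOn v (Ioo 0 1) :=
    (hcont.mono Ioo_subset_Icc_self).congr hv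
  refine ⟨hvc.locallyIntegrableOn measurableSet_Ioo,
    locallyIntegrableOn_of_integrable hh, ?_⟩
  intro φ hφ hφc hφs
  have hφac : AbsolutelyContinuousOnInterval φ 0 1 :=
    (hφ.of_le (by simp)).contDiffOn.absolutelyContinuousOnInterval
  have e := hac'.integral_mul_deriv_eq_deriv_mul hφac
  rw [test_zero hφs (x := 0) (by simp), test_zero hφs (x := 1) (by simp)] at e
  have e1 : ∫ x, v x * deriv φ x ∂vol = ∫ x in (0 : ℝ)..1, (k + V x) * deriv φ x := by
    rw [← integral_vol]
    refine integral_congr_ae (ae_vol_iff.2 (Filter.Eventually.of_forall fun x hx => ?_))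
    simp only [hv x hx, hV]
  have e2 : ∫ x in (0 : ℝ)..1, deriv (fun x => k + V x) x * φ x = ∫ x, h x * φ x ∂vol := by
    rw [integral_vol]
    refine intervalIntegral.integral_congr_ae ?_
    filter_upwards [hi.ae_hasDerivAt_integral] with x hx hxm
    have := (hx (uIoc_subset_uIcc hxm) 0 (by simp)).const_add k
    rw [this.deriv]
  rw [e1, e, e2]; ring

theorem HasWeakDeriv.congr {v w v' w' : ℝ → ℝ} (h : HasWeakDeriv v w) (hv : v =ᵐ[vol] v')
    (hw : w =ᵐ[vol] w') : HasWeakDeriv v' w' := by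
  have aux : ∀ {g g' : ℝ → ℝ}, g =ᵐ[vol] g' → LocallyIntegrableOn g (Ioo 0 1) →
      LocallyIntegrableOn g' (Ioo 0 1) := by
    intro g g' hgg hg
    rw [locallyIntegrableOn_iff (isOpen_Ioo.isLocallyClosed)] at hg ⊢
    intro K hK hKc
    refine (hg K hK hKc).congr_fun_ae ?_
    exact ae_restrict_of_ae_restrict_of_subset hK hgg
  refine ⟨aux hv h.1, aux hw h.2.1, fun φ h1 h2 h3 => ?_⟩
  have e1 : ∫ x, v x * deriv φ x ∂vol = ∫ x, v' x * deriv φ x ∂vol :=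
    integral_congr_ae (hv.mono fun x hx => by simp only [hx])
  have e2 : ∫ x, w x * φ x ∂vol = ∫ x, w' x * φ x ∂vol :=
    integral_congr_ae (hw.mono fun x hx => by simp only [hx])
  rw [← e1, ← e2]
  exact h.2.2 φ h1 h2 h3

theorem integrable_mul_test {w g : ℝ → ℝ} (hw : LocallyIntegrableOn w (Ioo 0 1))
    (hg : Continuous g) (hc : HasCompactSupport g) (hs : tsupport g ⊆ Ioo 0 1) :
    Integrable (fun x => w x * g x) vol := by
  have hi : IntegrableOn w (tsupport g) := hw.integrableOn_compact_subset hs hc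
  have : IntegrableOn (fun x => w x * g x) (tsupport g) :=
    hi.mul_continuousOn hg.continuousOn hc
  have h3 : Integrable (fun x => w x * g x) volume := by
    rw [integrableOn_iff_integrable_of_support_subset] at this
    · exact this
    · intro x hx
      by_contra hn
      apply hx
      simp [image_eq_zero_of_notMem_tsupport hn]
  exact h3.restrict

theorem tsupport_deriv_subset_tsupport {φ : ℝ → ℝ} : tsupport (deriv φ) ⊆ tsupport φ :=
  closure_minimal (support_deriv_subset) (isClosed_tsupport φ)

theorem HasWeakDeriv.sub {v w v' w' : ℝ → ℝ} (h : HasWeakDeriv v w) (h' : HasWeakDeriv v' w') :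
    HasWeakDeriv (v - v') (w - w') := by
  refine ⟨h.1.sub h'.1, h.2.1.sub h'.2.1, fun φ h1 h2 h3 => ?_⟩
  have hd : Continuous (deriv φ) := h1.continuous_deriv (by simp)
  have hs := tsupport_deriv_subset_tsupport.trans h3
  have e := h.2.2 φ h1 h2 h3
  have e' := h'.2.2 φ h1 h2 h3
  simp only [Pi.sub_apply, sub_mul]
  rw [integral_sub (integrable_mul_test h.1 hd h2.deriv hs)
    (integrable_mul_test h'.1 hd h2.deriv hs),
    integral_sub (integrable_mul_test h.2.1 h1.continuous h2 h3)
    (integrable_mul_test h'.2.1 h1.continuous h2 h3), e, e']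
  ring

/-- The lemma of du Bois-Reymond. -/
theorem HasWeakDeriv.ae_const {v : ℝ → ℝ} (h : HasWeakDeriv v 0) :
    ∃ k : ℝ, ∀ᵐ x ∂vol, v x = k := by
  -- A fixed bump of mass one. Subtracting a multiple of it gives any test function mean zero, and
  -- the constant sought is the integral of `v` against it.
  obtain ⟨ψ₀, hψs, hψ, hψc, hψi⟩ : ∃ ψ : ℝ → ℝ, tsupport ψ ⊆ Ioo 0 1 ∧
      ContDiff ℝ (⊤ : ℕ∞) ψ ∧ HasCompactSupport ψ ∧ ∫ x in (0 : ℝ)..1, ψ x = 1 := by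
    let B : ContDiffBump (1 / 2 : ℝ) := ⟨1 / 8, 1 / 4, by norm_num, by norm_num⟩
    have hs : tsupport (B.normed volume) ⊆ Ioo 0 1 := by
      rw [B.tsupport_normed_eq, Real.closedBall_eq_Icc]
      intro x hx
      have := hx.1; have := hx.2
      simp only [B] at *
      constructor <;> linarith
    refine ⟨B.normed volume, hs, B.contDiff_normed, B.hasCompactSupport_normed, ?_⟩
    rw [← integral_vol, vol, setIntegral_eq_integral_of_forall_compl_eq_zero
      (fun x hx => test_zero hs hx)]
    exact B.integral_normed
  refine ⟨∫ x, v x * ψ₀ x ∂vol, ?_⟩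
  set k := ∫ x, v x * ψ₀ x ∂vol with hk
  have key := isOpen_Ioo.ae_eq_zero_of_integral_contDiff_smul_eq_zero (μ := volume)
    (U := Ioo (0 : ℝ) 1) (f := fun x => v x - k)
    (h.1.sub ((locallyIntegrable_const k).locallyIntegrableOn _)) (by
      intro g hg hgc hgs
      set m := ∫ x in (0 : ℝ)..1, g x with hm
      set ρ : ℝ → ℝ := fun x => g x - m * ψ₀ x with hρ
      have hρc : ContDiff ℝ (⊤ : ℕ∞) ρ := hg.sub (contDiff_const.mul hψ)
      have hρ0 : ∫ x in (0 : ℝ)..1, ρ x = 0 := by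
        have hi : IntervalIntegrable (fun x => m * ψ₀ x) volume 0 1 :=
          (continuous_const.mul hψ.continuous).intervalIntegrable _ _
        simp only [hρ]
        rw [intervalIntegral.integral_sub (hg.continuous.intervalIntegrable _ _) hi,
          intervalIntegral.integral_const_mul, hψi]
        simp [hm]
      obtain ⟨a, b, ha, hb, hab, hz⟩ : ∃ a b : ℝ, 0 < a ∧ b < 1 ∧ a ≤ b ∧
          ∀ x, x ∉ Icc a b → ρ x = 0 := by
        -- The point `1/2` only makes the set nonempty, so that it has a least and a greatest
        -- element.
        have hK : IsCompact (tsupport g ∪ tsupport ψ₀ ∪ {1/2}) :=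
          (IsCompact.union hgc hψc).union isCompact_singleton
        have hne : (tsupport g ∪ tsupport ψ₀ ∪ {1/2}).Nonempty := ⟨1/2, by simp⟩
        have hsub : tsupport g ∪ tsupport ψ₀ ∪ {1/2} ⊆ Ioo (0 : ℝ) 1 := by
          refine union_subset (union_subset hgs hψs) ?_
          rw [singleton_subset_iff]; norm_num
        obtain ⟨a, ham, ha⟩ := hK.exists_isLeast hne
        obtain ⟨b, hbm, hb⟩ := hK.exists_isGreatest hne
        refine ⟨a, b, (hsub ham).1, (hsub hbm).2, ha hbm, fun x hx => ?_⟩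
        have hx1 : x ∉ tsupport g := fun h => hx ⟨ha (by simp [h]), hb (by simp [h])⟩
        have hx2 : x ∉ tsupport ψ₀ := fun h => hx ⟨ha (by simp [h]), hb (by simp [h])⟩
        simp [hρ, image_eq_zero_of_notMem_tsupport hx1, image_eq_zero_of_notMem_tsupport hx2]
      -- Because `ρ` has mean zero, its primitive vanishes on both sides of `[a, b]` and is itself
      -- an admissible test function.
      set φ : ℝ → ℝ := fun x => ∫ t in (0 : ℝ)..x, ρ t with hφ
      have hφd : ∀ x, HasDerivAt φ (ρ x) x := fun x =>
        intervalIntegral.integral_hasDerivAt_right (hρc.continuous.intervalIntegrable _ _)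
          (hρc.continuous.stronglyMeasurableAtFilter _ _) hρc.continuous.continuousAt
      have hφderiv : deriv φ = ρ := funext fun x => (hφd x).deriv
      have hφc : ContDiff ℝ (⊤ : ℕ∞) φ := by
        rw [contDiff_infty_iff_deriv, hφderiv]
        exact ⟨fun x => (hφd x).differentiableAt, hρc⟩
      have hφz : ∀ x, x ∉ Icc a b → φ x = 0 := by
        intro x hx
        rcases lt_or_ge x a with h1 | h1
        · refine intervalIntegral.integral_zero_ae (Filter.Eventually.of_forall fun t ht => ?_)
          apply hz
          intro htt
          have := ht.2
          have : max 0 x < a := max_lt ha h1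
          linarith [htt.1, ht.2]
        · have h2 : b < x := by
            by_contra hh; exact hx ⟨h1, not_lt.1 hh⟩
          have : φ x = φ x - ∫ t in (0 : ℝ)..1, ρ t := by rw [hρ0, sub_zero]
          rw [this, hφ]
          simp only
          rw [intervalIntegral.integral_interval_sub_left
            (hρc.continuous.intervalIntegrable _ _) (hρc.continuous.intervalIntegrable _ _)]
          refine intervalIntegral.integral_zero_ae (Filter.Eventually.of_forall fun t ht => ?_)
          apply hz
          intro htt
          have : b < min 1 x := lt_min hb h2
          linarith [htt.2, ht.1]
      have hφs : tsupport φ ⊆ Icc a b := by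
        refine closure_minimal (fun x hx => ?_) isClosed_Icc
        by_contra hn; exact hx (hφz x hn)
      have hφcs : HasCompactSupport φ := isCompact_Icc.of_isClosed_subset (isClosed_tsupport _) hφs
      have hfin := h.2.2 φ hφc hφcs (hφs.trans (Icc_subset_Ioo ha hb))
      rw [hφderiv] at hfin
      simp only [Pi.zero_apply, zero_mul, integral_zero, neg_zero] at hfin
      have i1 := integrable_mul_test h.1 hg.continuous hgc hgs
      have i2 := integrable_mul_test h.1 hψ.continuous hψc hψs
      have e1 : ∫ x, v x * ρ x ∂vol = (∫ x, v x * g x ∂vol) - m * k := by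
        rw [hk, ← integral_const_mul, ← integral_sub i1 (i2.const_mul m)]
        refine integral_congr_ae (Filter.Eventually.of_forall fun x => ?_)
        simp only [hρ]; ring
      have hz' : ∀ x, x ∉ Ioo (0 : ℝ) 1 → g x • (v x - k) = 0 := fun x hx => by
        rw [test_zero hgs hx, zero_smul]
      rw [← setIntegral_eq_integral_of_forall_compl_eq_zero hz']
      change ∫ x, g x • (v x - k) ∂vol = 0
      have : ∫ x, g x • (v x - k) ∂vol = (∫ x, v x * g x ∂vol) - m * k := by
        rw [hm, ← integral_vol, mul_comm, ← integral_const_mul,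
          ← integral_sub i1 ((integrable_vol_iff.2
            (hg.continuous.intervalIntegrable _ _)).const_mul k)]
        refine integral_congr_ae (Filter.Eventually.of_forall fun x => ?_)
        simp only [smul_eq_mul]; ring
      rw [this, ← e1, hfin])
  rw [ae_vol_iff]
  filter_upwards [key] with x hx hxm
  linarith [hx hxm]

/-- A function with an integrable weak derivative is almost everywhere a primitive of it. -/
theorem HasWeakDeriv.ae_eq_primitive {v h : ℝ → ℝ} (hv : HasWeakDeriv v h)
    (hh : Integrable h vol) : ∃ k : ℝ, ∀ᵐ x ∂vol, v x = k + ∫ t in (0 : ℝ)..x, h t := by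
  have h1 : HasWeakDeriv (fun x => ∫ t in (0 : ℝ)..x, h t) h :=
    hasWeakDeriv_primitive (k := 0) hh (by simp)
  have h2 := hv.sub h1
  rw [sub_self] at h2
  obtain ⟨k, hk⟩ := h2.ae_const
  refine ⟨k, hk.mono fun x hx => ?_⟩
  simp only [Pi.sub_apply] at hx
  linarith

end TwoParam

namespace TwoParam

/-! ### Regularity of the weak solution -/

theorem hasDerivWithinAt_primitive {g : ℝ → ℝ} (hg : ContinuousOn g (Icc 0 1)) {x : ℝ}
    (hx : x ∈ Icc (0 : ℝ) 1) :
    HasDerivWithinAt (fun x => ∫ t in (0 : ℝ)..x, g t) (g x) (Icc 0 1) x := by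
  -- Extending by the endpoint values makes the integrand continuous on the whole line, so the
  -- two-sided fundamental theorem also applies at the endpoints.
  set G : ℝ → ℝ := IccExtend zero_le_one ((Icc (0 : ℝ) 1).domRestrict g) with hG
  have hGc : Continuous G := (continuousOn_iff_continuous_domRestrict.1 hg).Icc_extend'
  have hGg : ∀ y ∈ Icc (0 : ℝ) 1, G y = g y := fun y hy => by
    rw [hG, IccExtend_of_mem _ _ hy]; rfl
  have hd : HasDerivAt (fun x => ∫ t in (0 : ℝ)..x, G t) (G x) x :=
    intervalIntegral.integral_hasDerivAt_right (hGc.intervalIntegrable _ _)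
      (hGc.stronglyMeasurableAtFilter _ _) hGc.continuousAt
  rw [← hGg x hx]
  refine hd.hasDerivWithinAt.congr_of_mem (fun y hy => ?_) hx
  refine intervalIntegral.integral_congr fun t ht => ?_
  rw [uIcc_of_le hy.1] at ht
  exact (hGg t ⟨ht.1, ht.2.trans hy.2⟩).symm

theorem integrable_of_continuousOn {g : ℝ → ℝ} (hg : ContinuousOn g (Icc 0 1)) :
    Integrable g vol :=
  (hg.integrableOn_compact isCompact_Icc).mono_set Ioo_subset_Icc_self

theorem memLp_two_of_continuousOn {g : ℝ → ℝ} (hg : ContinuousOn g (Icc 0 1)) :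
    MemLp g 2 vol := by
  rw [memLp_two_iff_integrable_sq (integrable_of_continuousOn hg).aestronglyMeasurable]
  exact integrable_of_continuousOn (hg.pow 2)

theorem integrable_continuousOn_mul {g w : ℝ → ℝ} (hw : Integrable w vol)
    (hg : ContinuousOn g (Icc 0 1)) : Integrable (fun x => g x * w x) vol := by
  rw [integrable_vol_iff] at hw ⊢
  exact hw.continuousOn_mul (by rwa [uIcc_of_le zero_le_one])

theorem hasWeakDeriv_test {φ : ℝ → ℝ} (hφ : ContDiff ℝ (⊤ : ℕ∞) φ) (h0 : φ 0 = 0) :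
    HasWeakDeriv φ (deriv φ) := by
  have hd : Continuous (deriv φ) := hφ.continuous_deriv (by simp)
  refine hasWeakDeriv_primitive (k := 0) (integrable_of_continuousOn hd.continuousOn)
    fun x _ => ?_
  rw [intervalIntegral.integral_deriv_eq_sub
    (fun y _ => (hφ.differentiable (by simp)).differentiableAt) (hd.intervalIntegrable _ _), h0]
  ring

theorem memH10_test {φ : ℝ → ℝ} (hφ : ContDiff ℝ (⊤ : ℕ∞) φ) (hs : tsupport φ ⊆ Ioo 0 1) :
    MemH10 φ := by
  have h0 := test_zero hs (x := 0) (by simp)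
  have h1 := test_zero hs (x := 1) (by simp)
  exact ⟨⟨memLp_two_of_continuousOn hφ.continuous.continuousOn, deriv φ,
    memLp_two_of_continuousOn (hφ.continuous_deriv (by simp)).continuousOn,
    hasWeakDeriv_test hφ h0⟩, hφ.continuous.continuousOn, h0, h1⟩

theorem eqOn_Icc_of_ae {g h : ℝ → ℝ} (hg : ContinuousOn g (Icc 0 1))
    (hh : ContinuousOn h (Icc 0 1)) (he : ∀ᵐ x ∂vol, g x = h x) : EqOn g h (Icc 0 1) := by
  have h1 : g =ᵐ[volume.restrict (Icc (0 : ℝ) 1)] h := by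
    rw [← restrict_Ioo_eq_restrict_Icc]; exact he
  exact Measure.eqOn_Icc_of_ae_eq volume zero_ne_one h1 hg hh

/-- The weak solution is a classical one. -/
theorem IsSolution.regular {ε₁ ε₂ : ℝ} {b c f u : ℝ → ℝ} (hε : 0 < ε₁)
    (hb : ContinuousOn b (Icc 0 1)) (hc : ContinuousOn c (Icc 0 1))
    (hf : ContinuousOn f (Icc 0 1)) (hu : IsSolution ε₁ ε₂ b c f u) :
    ∃ u₁ : ℝ → ℝ, ∀ x ∈ Icc (0 : ℝ) 1, HasDerivWithinAt u (u₁ x) (Icc 0 1) x ∧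
      HasDerivWithinAt u₁ ((ε₂ * b x * u₁ x + c x * u x - f x) / ε₁) (Icc 0 1) x := by
  obtain ⟨⟨⟨-, w', hw', hwd'⟩, huc, -, -⟩, hsol⟩ := hu
  set w := weakDeriv u with hw
  have hww : w =ᵐ[vol] w' := weakDeriv_ae_eq hwd'
  have hwd : HasWeakDeriv u w := hwd'.congr (Filter.EventuallyEq.refl _ _) hww.symm
  have hwi : Integrable w vol := (hw'.integrable (by norm_num)).congr hww.symm
  set h : ℝ → ℝ := fun x => f x - c x * u x - ε₂ * (b x * w x) with hh
  have hbw : Integrable (fun x => b x * w x) vol := integrable_continuousOn_mul hwi hb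
  have hcu : Integrable (fun x => c x * u x) vol := integrable_of_continuousOn (hc.mul huc)
  have hfi : Integrable f vol := integrable_of_continuousOn hf
  have hhi : Integrable h vol := (hfi.sub hcu).sub (hbw.const_mul ε₂)
  -- Tested against smooth functions, the weak equation says that the flux `ε₁ u'` has an integrable
  -- weak derivative. It is therefore almost everywhere a primitive, which gives `u'` a continuous
  -- representative.
  have hwk : HasWeakDeriv (fun x => ε₁ * w x) (fun x => - h x) := by
    refine ⟨locallyIntegrableOn_of_integrable (hwi.const_mul _),
      locallyIntegrableOn_of_integrable hhi.neg, fun φ h1 h2 h3 => ?_⟩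
    have hs := hsol φ (memH10_test h1 h3)
    have hdφ := weakDeriv_ae_eq (hasWeakDeriv_test h1 (test_zero h3 (x := 0) (by simp)))
    have ha : ∀ {g : ℝ → ℝ}, Integrable g vol → Integrable (fun x => g x * φ x) vol := fun hg =>
      integrable_mul_test (locallyIntegrableOn_of_integrable hg) h1.continuous h2 h3
    unfold bilin at hs
    have e1 : ∫ x, weakDeriv u x * weakDeriv φ x ∂vol = ∫ x, w x * deriv φ x ∂vol :=
      integral_congr_ae (hdφ.mono fun x hx => by simp only [hx, hw])
    have e2 : ∫ x, -h x * φ x ∂vol = ε₂ * (∫ x, b x * w x * φ x ∂vol)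
        + (∫ x, c x * u x * φ x ∂vol) - ∫ x, f x * φ x ∂vol := by
      have i2 : Integrable (fun x => ε₂ * (b x * w x * φ x)) vol := (ha hbw).const_mul ε₂
      have i3 : Integrable (fun x => ε₂ * (b x * w x * φ x) + c x * u x * φ x) vol :=
        i2.add (ha hcu)
      rw [← integral_const_mul, ← integral_add i2 (ha hcu), ← integral_sub i3 (ha hfi)]
      refine integral_congr_ae (Filter.Eventually.of_forall fun x => ?_)
      simp only [hh]; ring
    have e3 : ∫ x, ε₁ * w x * deriv φ x ∂vol = ε₁ * ∫ x, w x * deriv φ x ∂vol := by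
      rw [← integral_const_mul]; simp only [mul_assoc]
    rw [e1] at hs
    rw [e3, e2, ← hs]
    ring
  obtain ⟨k, hk⟩ := hwk.ae_eq_primitive hhi.neg
  set u₁ : ℝ → ℝ := fun x => (k + ∫ t in (0 : ℝ)..x, -h t) / ε₁ with hu₁
  have hwu : w =ᵐ[vol] u₁ := hk.mono fun x hx => by
    simp only [hu₁]; rw [← hx]; field_simp
  have hu₁c : ContinuousOn u₁ (Icc 0 1) := by
    have := (intervalIntegral.continuousOn_primitive_interval
      (f := fun t => -h t) (μ := volume) (a := 0) (b := 1)
      (((intervalIntegrable_iff' (by simp)).1 (integrable_vol_iff.1 hhi.neg))))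
    rw [uIcc_of_le zero_le_one] at this
    exact (continuousOn_const.add this).div_const _
  obtain ⟨k', hk'⟩ := (hwd.congr (Filter.EventuallyEq.refl _ _) hwu).ae_eq_primitive
    (integrable_of_continuousOn hu₁c)
  have huu : EqOn u (fun x => k' + ∫ t in (0 : ℝ)..x, u₁ t) (Icc 0 1) := by
    refine eqOn_Icc_of_ae huc (fun x hx => ?_) hk'
    exact ((hasDerivWithinAt_primitive hu₁c hx).const_add k').continuousWithinAt
  refine ⟨u₁, fun x hx => ⟨?_, ?_⟩⟩
  · exact ((hasDerivWithinAt_primitive hu₁c hx).const_add k').congr_of_mem huu hx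
  · set g : ℝ → ℝ := fun x => ε₂ * b x * u₁ x + c x * u x - f x with hg
    have hgc : ContinuousOn g (Icc 0 1) :=
      (((continuousOn_const.mul hb).mul hu₁c).add (hc.mul huc)).sub hf
    refine (((hasDerivWithinAt_primitive hgc hx).const_add k).div_const ε₁).congr_of_mem
      (fun y hy => ?_) hx
    simp only [hu₁]
    congr 2
    -- Bootstrap: under the integral `w` may be replaced by its continuous representative `u₁`. The
    -- integrand is then continuous, and `u₁` is differentiable everywhere on `[0,1]`.
    have : ∀ᵐ t, t ∈ Ioo (0 : ℝ) 1 → -h t = g t := by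
      filter_upwards [ae_vol_iff.1 hwu] with t ht htm
      simp only [hh, hg, ht htm]; ring
    refine intervalIntegral.integral_congr_ae ?_
    have h1 : ∀ᵐ t : ℝ, t ≠ 1 := by simp [ae_iff]
    filter_upwards [this, h1] with t ht ht1 htm
    rw [uIoc_of_le hy.1] at htm
    exact ht ⟨htm.1, lt_of_le_of_ne (htm.2.trans hy.2) ht1⟩

end TwoParam

namespace TwoParam

/-! ### Comparison principle -/

-- If `d < 0`, the second derivative test makes `x` a local maximum as well. Then `ψ` is constant
-- near `x` and `d = 0`.
open Filter Topology in
theorem second_deriv_nonneg_of_isLocalMin {ψ ψ₁ : ℝ → ℝ} {x d : ℝ} (hm : IsLocalMin ψ x)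
    (h : ∀ᶠ y in 𝓝 x, HasDerivAt ψ (ψ₁ y) y) (h₁ : HasDerivAt ψ₁ d x) : 0 ≤ d := by
  by_contra hd
  have e : deriv ψ =ᶠ[𝓝 x] ψ₁ := h.mono fun y hy => hy.deriv
  have e2 : deriv (deriv ψ) x = d := by rw [e.deriv_eq, h₁.deriv]
  have hmax : IsLocalMax ψ x := isLocalMax_of_deriv_deriv_neg (by rw [e2]; exact not_le.1 hd)
    hm.deriv_eq_zero h.self_of_nhds.continuousAt
  have hc : ψ =ᶠ[𝓝 x] fun _ => ψ x := by
    filter_upwards [hm, hmax] with y h1 h2 using le_antisymm h2 h1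
  have : deriv (deriv ψ) x = 0 := by
    rw [hc.deriv.deriv_eq]; simp
  rw [e2] at this
  exact hd this.ge

/-- `ψ₁` and `ψ₂` are the first two derivatives of `ψ` on `[0,1]`. -/
def HasDerivs (ψ ψ₁ ψ₂ : ℝ → ℝ) : Prop :=
  ∀ x ∈ Icc (0 : ℝ) 1, HasDerivWithinAt ψ (ψ₁ x) (Icc 0 1) x ∧
    HasDerivWithinAt ψ₁ (ψ₂ x) (Icc 0 1) x

theorem HasDerivs.continuousOn {ψ ψ₁ ψ₂ : ℝ → ℝ} (h : HasDerivs ψ ψ₁ ψ₂) :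
    ContinuousOn ψ (Icc 0 1) := fun x hx => (h x hx).1.continuousWithinAt

theorem HasDerivs.continuousOn' {ψ ψ₁ ψ₂ : ℝ → ℝ} (h : HasDerivs ψ ψ₁ ψ₂) :
    ContinuousOn ψ₁ (Icc 0 1) := fun x hx => (h x hx).2.continuousWithinAt

theorem HasDerivs.hasDerivAt {ψ ψ₁ ψ₂ : ℝ → ℝ} (h : HasDerivs ψ ψ₁ ψ₂) {x : ℝ}
    (hx : x ∈ Ioo (0 : ℝ) 1) : HasDerivAt ψ (ψ₁ x) x ∧ HasDerivAt ψ₁ (ψ₂ x) x :=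
  ⟨(h x (Ioo_subset_Icc_self hx)).1.hasDerivAt (Icc_mem_nhds hx.1 hx.2),
    (h x (Ioo_subset_Icc_self hx)).2.hasDerivAt (Icc_mem_nhds hx.1 hx.2)⟩

/-- At a negative interior minimum `ψ' = 0` and `ψ'' ≥ 0`, so the operator would be negative there.
-/
theorem nonneg_of_operator_nonneg {ε : ℝ} {B C ψ ψ₁ ψ₂ : ℝ → ℝ} (hε : 0 < ε)
    (hψ : HasDerivs ψ ψ₁ ψ₂) (hC : ∀ x ∈ Icc (0 : ℝ) 1, 0 < C x)
    (hL : ∀ x ∈ Icc (0 : ℝ) 1, 0 ≤ -ε * ψ₂ x + B x * ψ₁ x + C x * ψ x)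
    (h0 : 0 ≤ ψ 0) (h1 : 0 ≤ ψ 1) : ∀ x ∈ Icc (0 : ℝ) 1, 0 ≤ ψ x := by
  obtain ⟨y, hy, hmin⟩ := isCompact_Icc.exists_isMinOn (nonempty_Icc.2 zero_le_one)
    hψ.continuousOn
  intro x hx
  refine le_trans ?_ (hmin hx)
  by_contra hneg
  push Not at hneg
  have hyo : y ∈ Ioo (0 : ℝ) 1 := by
    refine ⟨lt_of_le_of_ne hy.1 ?_, lt_of_le_of_ne hy.2 ?_⟩ <;> rintro rfl <;> linarith
  have hloc : IsLocalMin ψ y := hmin.isLocalMin (Icc_mem_nhds hyo.1 hyo.2)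
  have h2 : 0 ≤ ψ₂ y := second_deriv_nonneg_of_isLocalMin hloc
    (Filter.eventually_of_mem (Ioo_mem_nhds hyo.1 hyo.2) fun z hz => (hψ.hasDerivAt hz).1)
    (hψ.hasDerivAt hyo).2
  have h3 : ψ₁ y = 0 := hloc.hasDerivAt_eq_zero (hψ.hasDerivAt hyo).1
  have := hL y hy
  rw [h3] at this
  nlinarith [mul_pos_of_neg_of_neg hneg (neg_lt_zero.2 (hC y hy)), mul_nonneg hε.le h2]

/-- The barrier function `A + P e^{-rx} + Q e^{-s(1-x)}`. -/
def barrier (A P Q r s x : ℝ) : ℝ := A + P * Real.exp (-r * x) + Q * Real.exp (-s * (1 - x))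

theorem hasDerivAt_exp_left (r x : ℝ) :
    HasDerivAt (fun x => Real.exp (-r * x)) (-r * Real.exp (-r * x)) x := by
  have := ((hasDerivAt_id x).const_mul (-r)).exp
  simpa [mul_comm] using this

theorem hasDerivAt_exp_right (s x : ℝ) :
    HasDerivAt (fun x => Real.exp (-s * (1 - x))) (s * Real.exp (-s * (1 - x))) x := by
  have := (((hasDerivAt_id x).const_sub 1).const_mul (-s)).exp
  simpa [mul_comm] using this

theorem hasDerivAt_barrier (A P Q r s x : ℝ) :
    HasDerivAt (barrier A P Q r s) (barrier 0 (-r * P) (s * Q) r s x) x := by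
  have := (((hasDerivAt_exp_left r x).const_mul P).const_add A).add
    ((hasDerivAt_exp_right s x).const_mul Q)
  convert! this using 1
  unfold barrier; ring

/-- The right-hand side of `hL` is the operator applied to the barrier, so the minimum principle
applies to the barrier plus and minus `ψ`. -/
theorem abs_le_barrier {ε A P Q r s : ℝ} {B C ψ ψ₁ ψ₂ : ℝ → ℝ} (hε : 0 < ε)
    (hψ : HasDerivs ψ ψ₁ ψ₂) (hC : ∀ x ∈ Icc (0 : ℝ) 1, 0 < C x)
    (hL : ∀ x ∈ Icc (0 : ℝ) 1, |-ε * ψ₂ x + B x * ψ₁ x + C x * ψ x| ≤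
      C x * A + P * Real.exp (-r * x) * (C x - ε * r ^ 2 - B x * r)
        + Q * Real.exp (-s * (1 - x)) * (C x - ε * s ^ 2 + B x * s))
    (h0 : |ψ 0| ≤ A + P + Q * Real.exp (-s)) (h1 : |ψ 1| ≤ A + P * Real.exp (-r) + Q) :
    ∀ x ∈ Icc (0 : ℝ) 1, |ψ x| ≤ barrier A P Q r s x := by
  have key : ∀ σ : ℝ, |σ| = 1 → ∀ x ∈ Icc (0 : ℝ) 1, 0 ≤ barrier A P Q r s x + σ * ψ x := by
    intro σ hσ
    have hm : ∀ z : ℝ, -|z| ≤ σ * z := fun z => by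
      have := neg_abs_le (σ * z)
      rwa [abs_mul, hσ, one_mul] at this
    refine nonneg_of_operator_nonneg (ψ₁ := fun x => barrier 0 (-r * P) (s * Q) r s x + σ * ψ₁ x)
      (ψ₂ := fun x => barrier 0 (-r * (-r * P)) (s * (s * Q)) r s x + σ * ψ₂ x)
      (B := B) hε (fun x hx => ⟨?_, ?_⟩) hC (fun x hx => ?_) ?_ ?_
    · exact (hasDerivAt_barrier _ _ _ _ _ _).hasDerivWithinAt.add ((hψ x hx).1.const_mul σ)
    · exact (hasDerivAt_barrier _ _ _ _ _ _).hasDerivWithinAt.add ((hψ x hx).2.const_mul σ)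
    · have a1 := hL x hx
      have a2 := hm (-ε * ψ₂ x + B x * ψ₁ x + C x * ψ x)
      unfold barrier
      nlinarith
    · have a2 := hm (ψ 0)
      simp only [barrier, mul_zero, Real.exp_zero, sub_zero, mul_one]
      linarith
    · have a2 := hm (ψ 1)
      simp only [barrier, mul_one, sub_self, mul_zero, Real.exp_zero]
      linarith
  intro x hx
  rw [abs_le]
  have h1 := key 1 (by simp) x hx
  have h2 := key (-1) (by simp) x hx
  constructor <;> linarith

-- A barrier that touches `|ψ - ψ 0|` at the endpoint dominates the difference quotients there. This
-- is how comparison yields boundary values of derivatives.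
open Filter Topology in
theorem abs_deriv_zero_le {ψ B : ℝ → ℝ} {d D : ℝ} (hψ : HasDerivWithinAt ψ d (Icc 0 1) 0)
    (hB : HasDerivAt B D 0) (hB0 : B 0 = 0)
    (h : ∀ x ∈ Icc (0 : ℝ) 1, |ψ x - ψ 0| ≤ B x) : |d| ≤ D := by
  have h1 := (hasDerivWithinAt_iff_tendsto_slope.1 hψ).abs
  have h2 := hasDerivWithinAt_iff_tendsto_slope.1 (hB.hasDerivWithinAt (s := Icc 0 1))
  have hn : (𝓝[Icc (0 : ℝ) 1 \ {0}] (0 : ℝ)).NeBot := by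
    rw [Icc_sdiff_left, nhdsWithin_Ioc_eq_nhdsGT zero_lt_one]; infer_instance
  refine le_of_tendsto_of_tendsto h1 h2 ?_
  filter_upwards [self_mem_nhdsWithin] with x hx
  have hx0 : 0 < x := lt_of_le_of_ne hx.1.1 fun h => hx.2 h.symm
  rw [slope_def_field, slope_def_field, hB0, sub_zero, sub_zero, abs_div, abs_of_pos hx0]
  exact div_le_div_of_nonneg_right (h x hx.1) hx0.le

theorem abs_deriv_one_le {ψ B : ℝ → ℝ} {d D : ℝ} (hψ : HasDerivWithinAt ψ d (Icc 0 1) 1)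
    (hB : HasDerivAt B D 1) (hB0 : B 1 = 0)
    (h : ∀ x ∈ Icc (0 : ℝ) 1, |ψ x - ψ 1| ≤ B x) : |d| ≤ -D := by
  have hr : HasDerivAt (fun x : ℝ => 1 - x) (-1) 0 := by
    simpa using (hasDerivAt_id (0 : ℝ)).const_sub 1
  have hm : MapsTo (fun x : ℝ => 1 - x) (Icc 0 1) (Icc 0 1) := fun x hx =>
    ⟨by linarith [hx.2], by linarith [hx.1]⟩
  have h1 : HasDerivWithinAt (fun x => ψ (1 - x)) (d * -1) (Icc 0 1) 0 :=
    HasDerivWithinAt.comp (h₂ := ψ) (0 : ℝ) (by simpa using hψ) hr.hasDerivWithinAt hm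
  have h2 : HasDerivAt (fun x => B (1 - x)) (D * -1) 0 :=
    HasDerivAt.comp (h₂ := B) (0 : ℝ) (by simpa using hB) hr
  have := abs_deriv_zero_le h1 h2 (by simpa using hB0) (fun x hx => by simpa using h _ (hm hx))
  simpa using this

/-- By `hC`, `hr` and `hs` the operator multiplies each term of the barrier by at least `κ`. Hence
the multiple `R / κ` absorbs the right-hand side, and the further `R` absorbs the boundary values.
-/
theorem abs_le_layers {ε κ R r s ρ₀ ρ₁ : ℝ} {B C ψ ψ₁ ψ₂ : ℝ → ℝ} (hε : 0 < ε) (hκ : 0 < κ)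
    (hR : 0 ≤ R) (hρ₀ : 0 ≤ ρ₀) (hρ₁ : 0 ≤ ρ₁)
    (hψ : HasDerivs ψ ψ₁ ψ₂) (hC : ∀ x ∈ Icc (0 : ℝ) 1, κ ≤ C x)
    (hr : ∀ x ∈ Icc (0 : ℝ) 1, κ ≤ C x - ε * r ^ 2 - B x * r)
    (hs : ∀ x ∈ Icc (0 : ℝ) 1, κ ≤ C x - ε * s ^ 2 + B x * s)
    (hL : ∀ x ∈ Icc (0 : ℝ) 1, |-ε * ψ₂ x + B x * ψ₁ x + C x * ψ x| ≤
      R * barrier 1 ρ₀ ρ₁ r s x)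
    (h0 : |ψ 0| ≤ R * ρ₀) (h1 : |ψ 1| ≤ R * ρ₁) :
    ∀ x ∈ Icc (0 : ℝ) 1, |ψ x| ≤ (R / κ + R) * barrier 1 ρ₀ ρ₁ r s x := by
  set K := R / κ + R with hK
  have hK0 : 0 ≤ R / κ := div_nonneg hR hκ.le
  have hKR : R ≤ K := by linarith
  have hKκ : R ≤ K * κ := by
    have : R / κ * κ = R := div_mul_cancel₀ R hκ.ne'
    nlinarith
  have hKn : 0 ≤ K := hR.trans hKR
  intro x hx
  have := abs_le_barrier (A := K) (P := K * ρ₀) (Q := K * ρ₁) (r := r) (s := s) (B := B) (C := C)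
    hε hψ (fun x hx => hκ.trans_le (hC x hx)) (fun x hx => ?_) ?_ ?_ x hx
  · refine this.trans (le_of_eq ?_)
    unfold barrier; ring
  · refine (hL x hx).trans ?_
    have e0 := Real.exp_pos (-r * x)
    have e1 := Real.exp_pos (-s * (1 - x))
    have a0 : R ≤ C x * K := by
      have := mul_le_mul_of_nonneg_right (hC x hx) hKn
      linarith
    have a1 : R * (ρ₀ * Real.exp (-r * x)) ≤
        K * ρ₀ * Real.exp (-r * x) * (C x - ε * r ^ 2 - B x * r) := by
      have h1 : K * κ ≤ K * (C x - ε * r ^ 2 - B x * r) :=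
        mul_le_mul_of_nonneg_left (hr x hx) hKn
      have := mul_le_mul_of_nonneg_right (hKκ.trans h1) (mul_nonneg hρ₀ e0.le)
      linarith
    have a2 : R * (ρ₁ * Real.exp (-s * (1 - x))) ≤
        K * ρ₁ * Real.exp (-s * (1 - x)) * (C x - ε * s ^ 2 + B x * s) := by
      have h1 : K * κ ≤ K * (C x - ε * s ^ 2 + B x * s) :=
        mul_le_mul_of_nonneg_left (hs x hx) hKn
      have := mul_le_mul_of_nonneg_right (hKκ.trans h1) (mul_nonneg hρ₁ e1.le)
      linarith
    unfold barrier
    linarith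
  · have : 0 ≤ K * ρ₁ * Real.exp (-s) := by positivity
    have : R * ρ₀ ≤ K * ρ₀ := mul_le_mul_of_nonneg_right hKR hρ₀
    linarith
  · have : 0 ≤ K * ρ₀ * Real.exp (-r) := by positivity
    have : R * ρ₁ ≤ K * ρ₁ := mul_le_mul_of_nonneg_right hKR hρ₁
    linarith

end TwoParam

namespace TwoParam

/-! ### Bounds on the derivatives of the solution -/

/-- Bounds on the data of the problem, together with their first two derivatives. -/
structure DataBounds (lam β M : ℝ) (b b₁ b₂ c c₁ c₂ f f₁ f₂ : ℝ → ℝ) : Prop where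
  lam_pos : 0 < lam
  beta_pos : 0 < β
  one_le : 1 ≤ M
  derivs_b : HasDerivs b b₁ b₂
  derivs_c : HasDerivs c c₁ c₂
  derivs_f : HasDerivs f f₁ f₂
  lam_le : ∀ x ∈ Icc (0 : ℝ) 1, lam ≤ b x
  beta_le : ∀ x ∈ Icc (0 : ℝ) 1, β ≤ c x
  abs_b : ∀ x ∈ Icc (0 : ℝ) 1, |b x| ≤ M
  abs_b₁ : ∀ x ∈ Icc (0 : ℝ) 1, |b₁ x| ≤ M
  abs_b₂ : ∀ x ∈ Icc (0 : ℝ) 1, |b₂ x| ≤ M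
  abs_c : ∀ x ∈ Icc (0 : ℝ) 1, |c x| ≤ M
  abs_c₁ : ∀ x ∈ Icc (0 : ℝ) 1, |c₁ x| ≤ M
  abs_c₂ : ∀ x ∈ Icc (0 : ℝ) 1, |c₂ x| ≤ M
  abs_f : ∀ x ∈ Icc (0 : ℝ) 1, |f x| ≤ M
  abs_f₁ : ∀ x ∈ Icc (0 : ℝ) 1, |f₁ x| ≤ M
  abs_f₂ : ∀ x ∈ Icc (0 : ℝ) 1, |f₂ x| ≤ M

/-- The properties of `μ₀` and `μ₁` which follow from the characteristic equation. -/
structure LayerRates (ε₁ ε₂ lam β M : ℝ) (b c : ℝ → ℝ) (μ₀ μ₁ : ℝ) : Prop where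
  pos₁ : 0 < ε₁
  pos₂ : 0 < ε₂
  mu_pos : 0 < μ₀
  mu_le : μ₀ ≤ μ₁
  left_le : ∀ x ∈ Icc (0 : ℝ) 1, ε₁ * μ₀ ^ 2 + ε₂ * b x * μ₀ ≤ c x
  le_left : β ≤ ε₁ * μ₀ ^ 2 + ε₂ * M * μ₀
  right_le : ∀ x ∈ Icc (0 : ℝ) 1, ε₁ * μ₁ ^ 2 ≤ ε₂ * b x * μ₁ + c x
  le_right : β + ε₂ * lam * μ₁ ≤ ε₁ * μ₁ ^ 2

variable {lam β M ε₁ ε₂ μ₀ μ₁ p : ℝ} {b b₁ b₂ c c₁ c₂ f f₁ f₂ u u₁ : ℝ → ℝ}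

theorem DataBounds.lam_le_M (hd : DataBounds lam β M b b₁ b₂ c c₁ c₂ f f₁ f₂) : lam ≤ M :=
  (hd.lam_le 0 (by simp)).trans ((le_abs_self _).trans (hd.abs_b 0 (by simp)))

theorem DataBounds.beta_le_M (hd : DataBounds lam β M b b₁ b₂ c c₁ c₂ f f₁ f₂) : β ≤ M :=
  (hd.beta_le 0 (by simp)).trans ((le_abs_self _).trans (hd.abs_c 0 (by simp)))

theorem LayerRates.mu₁_pos (hl : LayerRates ε₁ ε₂ lam β M b c μ₀ μ₁) : 0 < μ₁ :=
  hl.mu_pos.trans_le hl.mu_le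

/-- The second derivative of a solution of the differential equation. -/
def eqnDeriv₂ (ε₁ ε₂ : ℝ) (b c f u u₁ : ℝ → ℝ) (x : ℝ) : ℝ :=
  (ε₂ * b x * u₁ x + c x * u x - f x) / ε₁

theorem abs_solution_le (hd : DataBounds lam β M b b₁ b₂ c c₁ c₂ f f₁ f₂) (hε : 0 < ε₁)
    (hu : HasDerivs u u₁ (eqnDeriv₂ ε₁ ε₂ b c f u u₁)) (h0 : u 0 = 0) (h1 : u 1 = 0) :
    ∀ x ∈ Icc (0 : ℝ) 1, |u x| ≤ M / β := by
  intro x hx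
  have hM : 0 ≤ M / β := div_nonneg (zero_le_one.trans hd.one_le) hd.beta_pos.le
  have := abs_le_barrier (A := M / β) (P := 0) (Q := 0) (r := 0) (s := 0)
    (B := fun x => ε₂ * b x) (C := c) hε hu
    (fun x hx => hd.beta_pos.trans_le (hd.beta_le x hx)) (fun x hx => ?_)
    (by simpa [h0] using hM) (by simpa [h1] using hM) x hx
  · simpa [barrier] using this
  · have e : -ε₁ * eqnDeriv₂ ε₁ ε₂ b c f u u₁ x + ε₂ * b x * u₁ x + c x * u x = f x := by
      unfold eqnDeriv₂; field_simp; ring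
    rw [e]
    have h2 := mul_le_mul_of_nonneg_right (hd.beta_le x hx) hM
    rw [mul_div_cancel₀ M hd.beta_pos.ne'] at h2
    have := hd.abs_f x hx
    simp only [zero_mul, add_zero]
    linarith

/-- The operator applied to `1 - e^{-p μ₀ x}` is bounded away from zero. -/
theorem le_left_rate (hd : DataBounds lam β M b b₁ b₂ c c₁ c₂ f f₁ f₂)
    (hl : LayerRates ε₁ ε₂ lam β M b c μ₀ μ₁) (hp₀ : 0 < p) (hp₁ : p < 1) {x : ℝ}
    (hx : x ∈ Icc (0 : ℝ) 1) :
    p ^ 2 * lam * β / M ≤ ε₁ * (p * μ₀) ^ 2 + ε₂ * b x * (p * μ₀) := by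
  have hM : 0 < M := zero_lt_one.trans_le hd.one_le
  have hm := hl.mu_pos
  have h1 := hl.pos₁
  have h2 := hl.pos₂
  have hb := hd.lam_le x hx
  have hlM := hd.lam_le_M
  have hlam := hd.lam_pos
  rw [div_le_iff₀ hM]
  have e1 : p ^ 2 * lam * β ≤ p ^ 2 * lam * (ε₁ * μ₀ ^ 2 + ε₂ * M * μ₀) :=
    mul_le_mul_of_nonneg_left hl.le_left (by positivity)
  have e2 : p ^ 2 * (ε₁ * μ₀ ^ 2) * lam ≤ p ^ 2 * (ε₁ * μ₀ ^ 2) * M :=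
    mul_le_mul_of_nonneg_left hlM (by positivity)
  have e3 : (p * (ε₂ * μ₀ * M)) * (p * lam) ≤ (p * (ε₂ * μ₀ * M)) * b x := by
    refine mul_le_mul_of_nonneg_left ?_ (by positivity)
    nlinarith
  nlinarith

/-- The barrier is `K (1 - e^{-pμ₀x})`, which vanishes at `0` with slope `K p μ₀`. The operator
takes it to at least `Kκ = M`: the coefficient `c` accounts for the part `1 - e^{-pμ₀x}`, and
`le_left_rate` for the part `e^{-pμ₀x}`. -/
theorem abs_deriv_zero_bound (hd : DataBounds lam β M b b₁ b₂ c c₁ c₂ f f₁ f₂)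
    (hl : LayerRates ε₁ ε₂ lam β M b c μ₀ μ₁) (hp₀ : 0 < p) (hp₁ : p < 1)
    (hu : HasDerivs u u₁ (eqnDeriv₂ ε₁ ε₂ b c f u u₁)) (h0 : u 0 = 0) (h1 : u 1 = 0) :
    |u₁ 0| ≤ M / (p ^ 2 * lam * β / M) * p * μ₀ := by
  set κ := p ^ 2 * lam * β / M with hκ
  have hM : 0 < M := zero_lt_one.trans_le hd.one_le
  have hlam := hd.lam_pos
  have hβ := hd.beta_pos
  have hκ0 : 0 < κ := by positivity
  have hκβ : κ ≤ β := by
    rw [hκ, div_le_iff₀ hM]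
    have : p ^ 2 * lam ≤ 1 * M :=
      mul_le_mul (by nlinarith) hd.lam_le_M hlam.le zero_le_one
    nlinarith
  set K := M / κ with hK
  have hK0 : 0 < K := by positivity
  have hKκ : K * κ = M := div_mul_cancel₀ M hκ0.ne'
  have hbar := abs_le_barrier (A := K) (P := -K) (Q := 0) (r := p * μ₀) (s := 0)
    (B := fun x => ε₂ * b x) (C := c) hl.pos₁ hu
    (fun x hx => hβ.trans_le (hd.beta_le x hx)) (fun x hx => ?_) (by simp [h0]) ?_
  · have hder := hasDerivAt_barrier K (-K) 0 (p * μ₀) 0 0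
    refine (abs_deriv_zero_le (hu 0 (by simp)).1 hder (by simp [barrier])
      (fun x hx => by rw [h0, sub_zero]; exact hbar x hx)).trans (le_of_eq ?_)
    simp [barrier]; ring
  · have e : -ε₁ * eqnDeriv₂ ε₁ ε₂ b c f u u₁ x + ε₂ * b x * u₁ x + c x * u x = f x := by
      have := hl.pos₁
      unfold eqnDeriv₂; field_simp; ring
    rw [e]
    have hf := hd.abs_f x hx
    have hc := hd.beta_le x hx
    have hE := Real.exp_pos (-(p * μ₀) * x)
    have hE1 : Real.exp (-(p * μ₀) * x) ≤ 1 := by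
      rw [Real.exp_le_one_iff]
      have := mul_nonneg (mul_pos hp₀ hl.mu_pos).le hx.1
      linarith
    have hr := le_left_rate hd hl hp₀ hp₁ hx
    rw [← hκ] at hr
    have g1 : κ * (1 - Real.exp (-(p * μ₀) * x)) ≤ c x * (1 - Real.exp (-(p * μ₀) * x)) :=
      mul_le_mul_of_nonneg_right (hκβ.trans hc) (by linarith)
    have g2 := mul_le_mul_of_nonneg_right hr hE.le
    have g3 := mul_le_mul_of_nonneg_left (add_le_add g1 g2) hK0.le
    nlinarith
  · rw [h1, abs_zero]
    have : Real.exp (-(p * μ₀)) ≤ 1 := by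
      rw [Real.exp_le_one_iff]
      have := mul_pos hp₀ hl.mu_pos
      linarith
    nlinarith

/-- On `1 - e^{-s(1-x)}` convection contributes with the unfavourable sign, and where `b` exceeds
`lam` the rate `s = μ₁` need not suffice. The larger rate `qμ₁` with `q = M / lam + 1` makes `ε₁s²`
outweigh `ε₂bs` everywhere. Only the slope at `1` matters, so this costs no more than a constant. -/
theorem abs_deriv_one_bound (hd : DataBounds lam β M b b₁ b₂ c c₁ c₂ f f₁ f₂)
    (hl : LayerRates ε₁ ε₂ lam β M b c μ₀ μ₁)
    (hu : HasDerivs u u₁ (eqnDeriv₂ ε₁ ε₂ b c f u u₁)) (h0 : u 0 = 0) (h1 : u 1 = 0) :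
    |u₁ 1| ≤ M / β * (M / lam + 1) * μ₁ := by
  have hM : 0 < M := zero_lt_one.trans_le hd.one_le
  have hlam := hd.lam_pos
  have hβ := hd.beta_pos
  have hm := hl.mu₁_pos
  set q := M / lam + 1 with hq
  have hq0 : 0 < q := by positivity
  set K := M / β with hK
  have hK0 : 0 < K := by positivity
  have hKκ : K * β = M := div_mul_cancel₀ M hβ.ne'
  have hbar := abs_le_barrier (A := K) (P := 0) (Q := -K) (r := 0) (s := q * μ₁)
    (B := fun x => ε₂ * b x) (C := c) hl.pos₁ hu
    (fun x hx => hβ.trans_le (hd.beta_le x hx)) (fun x hx => ?_) ?_ (by simp [h1])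
  · have hder := hasDerivAt_barrier K 0 (-K) 0 (q * μ₁) 1
    refine (abs_deriv_one_le (hu 1 (by simp)).1 hder (by simp [barrier])
      (fun x hx => by rw [h1, sub_zero]; exact hbar x hx)).trans (le_of_eq ?_)
    simp [barrier]; ring
  · have e : -ε₁ * eqnDeriv₂ ε₁ ε₂ b c f u u₁ x + ε₂ * b x * u₁ x + c x * u x = f x := by
      have := hl.pos₁
      unfold eqnDeriv₂; field_simp; ring
    rw [e]
    have hf := hd.abs_f x hx
    have hc := hd.beta_le x hx
    have hE := Real.exp_pos (-(q * μ₁) * (1 - x))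
    have hE1 : Real.exp (-(q * μ₁) * (1 - x)) ≤ 1 := by
      rw [Real.exp_le_one_iff]
      have := mul_nonneg (mul_pos hq0 hm).le (sub_nonneg.2 hx.2)
      linarith
    have hr : β ≤ ε₁ * (q * μ₁) ^ 2 - ε₂ * b x * (q * μ₁) := by
      have hbM : b x ≤ M := (le_abs_self _).trans (hd.abs_b x hx)
      have a1 : ε₂ * lam * μ₁ ≤ ε₁ * μ₁ ^ 2 := by linarith [hl.le_right]
      have a2 : β ≤ ε₁ * μ₁ ^ 2 := by
        have := mul_pos (mul_pos hl.pos₂ hlam) hm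
        linarith [hl.le_right]
      have a3 : ε₂ * b x * μ₁ ≤ M / lam * (ε₁ * μ₁ ^ 2) := by
        have : ε₂ * M * μ₁ = M / lam * (ε₂ * lam * μ₁) := by field_simp
        have h3 : ε₂ * b x * μ₁ ≤ ε₂ * M * μ₁ :=
          mul_le_mul_of_nonneg_right (mul_le_mul_of_nonneg_left hbM hl.pos₂.le) hm.le
        have h4 := mul_le_mul_of_nonneg_left a1 (div_nonneg hM.le hlam.le)
        linarith
      have a4 := mul_le_mul_of_nonneg_left a3 hq0.le
      have a5 : M / lam = q - 1 := by rw [hq]; ring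
      have a6 : 1 ≤ q := by
        have : 0 < M / lam := by positivity
        linarith
      rw [a5] at a4
      nlinarith [mul_le_mul_of_nonneg_right a6 (hβ.le.trans a2)]
    have g1 : β * (1 - Real.exp (-(q * μ₁) * (1 - x))) ≤
        c x * (1 - Real.exp (-(q * μ₁) * (1 - x))) :=
      mul_le_mul_of_nonneg_right hc (by linarith)
    have g2 := mul_le_mul_of_nonneg_right hr hE.le
    have g3 := mul_le_mul_of_nonneg_left (add_le_add g1 g2) hK0.le
    nlinarith
  · rw [h0, abs_zero]
    have : Real.exp (-(q * μ₁)) ≤ 1 := by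
      rw [Real.exp_le_one_iff]
      have := mul_pos hq0 hm
      linarith
    nlinarith

end TwoParam

/-! ### The differentiated equations and the bound for `u'` -/

namespace TwoParam

variable {lam β M ε₁ ε₂ μ₀ μ₁ p : ℝ} {b b₁ b₂ c c₁ c₂ f f₁ f₂ u u₁ : ℝ → ℝ}

/-- The three quantities are the factors produced on the barrier terms by the equation
differentiated `k` times. Shrinking the rates by `p` leaves at least `(1-p) c` of the zero-order
coefficient, and the smallness of `ε₂` lets `kε₂b'` consume at most half of `(1-p) β`. -/
theorem layer_coefficients (hd : DataBounds lam β M b b₁ b₂ c c₁ c₂ f f₁ f₂)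
    (hl : LayerRates ε₁ ε₂ lam β M b c μ₀ μ₁) (hp₀ : 0 < p) (hp₁ : p < 1)
    (hsm : 4 * ε₂ * M ≤ (1 - p) * β) {k : ℝ} (hk₀ : 0 ≤ k) (hk₂ : k ≤ 2) {x : ℝ}
    (hx : x ∈ Icc (0 : ℝ) 1) :
    (1 - p) * β / 2 ≤ c x + k * ε₂ * b₁ x ∧
    (1 - p) * β / 2 ≤ c x + k * ε₂ * b₁ x - ε₁ * (p * μ₀) ^ 2 - ε₂ * b x * (p * μ₀) ∧
    (1 - p) * β / 2 ≤ c x + k * ε₂ * b₁ x - ε₁ * (p * μ₁) ^ 2 + ε₂ * b x * (p * μ₁) := by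
  have hM : 0 < M := zero_lt_one.trans_le hd.one_le
  have hε := hl.pos₂
  have hε₁ := hl.pos₁
  have hc := hd.beta_le x hx
  have hβ := hd.beta_pos
  have hm₀ := hl.mu_pos
  have hm₁ := hl.mu₁_pos
  have hb : 0 < b x := hd.lam_pos.trans_le (hd.lam_le x hx)
  have h1 : -((1 - p) * β / 2) ≤ k * ε₂ * b₁ x := by
    have hb1 := neg_le_of_abs_le (hd.abs_b₁ x hx)
    have e1 : k * ε₂ * (-M) ≤ k * ε₂ * b₁ x := mul_le_mul_of_nonneg_left hb1 (by positivity)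
    have e2 : k * (ε₂ * M) ≤ 2 * (ε₂ * M) := mul_le_mul_of_nonneg_right hk₂ (by positivity)
    linarith
  have h2 : (1 - p) * β ≤ (1 - p) * c x := mul_le_mul_of_nonneg_left hc (by linarith)
  have hpc : 0 ≤ p * c x := by have := hβ.trans_le hc; positivity
  have hpp : 0 ≤ p * (1 - p) := mul_nonneg hp₀.le (by linarith)
  refine ⟨by linarith, ?_, ?_⟩
  · have e1 := mul_le_mul_of_nonneg_left (hl.left_le x hx) hp₀.le
    have e2 : 0 ≤ p * (1 - p) * (ε₁ * μ₀ ^ 2) := by positivity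
    nlinarith
  · have e1 := mul_le_mul_of_nonneg_left (hl.right_le x hx) (sq_nonneg p)
    have e2 : 0 ≤ p * (1 - p) * (ε₂ * b x * μ₁) := by positivity
    have e3 : 0 ≤ p * (1 - p) * c x := mul_nonneg hpp (hβ.trans_le hc).le
    nlinarith

/-- The third derivative of a solution of the differential equation. -/
def eqnDeriv₃ (ε₁ ε₂ : ℝ) (b b₁ c c₁ f f₁ u u₁ : ℝ → ℝ) (x : ℝ) : ℝ :=
  (ε₂ * (b₁ x * u₁ x + b x * eqnDeriv₂ ε₁ ε₂ b c f u u₁ x) + (c₁ x * u x + c x * u₁ x) - f₁ x) / ε₁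

/-- The fourth derivative of a solution of the differential equation. -/
def eqnDeriv₄ (ε₁ ε₂ : ℝ) (b b₁ b₂ c c₁ c₂ f f₁ f₂ u u₁ : ℝ → ℝ) (x : ℝ) : ℝ :=
  (ε₂ * (b₂ x * u₁ x + 2 * b₁ x * eqnDeriv₂ ε₁ ε₂ b c f u u₁ x
      + b x * eqnDeriv₃ ε₁ ε₂ b b₁ c c₁ f f₁ u u₁ x)
    + (c₂ x * u x + 2 * c₁ x * u₁ x + c x * eqnDeriv₂ ε₁ ε₂ b c f u u₁ x) - f₂ x) / ε₁

theorem hasDerivs_deriv (hd : DataBounds lam β M b b₁ b₂ c c₁ c₂ f f₁ f₂)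
    (hu : HasDerivs u u₁ (eqnDeriv₂ ε₁ ε₂ b c f u u₁)) :
    HasDerivs u₁ (eqnDeriv₂ ε₁ ε₂ b c f u u₁) (eqnDeriv₃ ε₁ ε₂ b b₁ c c₁ f f₁ u u₁) := by
  refine fun x hx => ⟨(hu x hx).2, ?_⟩
  have hu1 := (hu x hx).1
  have hu2 := (hu x hx).2
  have hb := (hd.derivs_b x hx).1
  have hc := (hd.derivs_c x hx).1
  have hf := (hd.derivs_f x hx).1
  have := ((((hb.mul hu2).const_mul ε₂).add (hc.mul hu1)).sub hf).div_const ε₁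
  refine (this.congr_of_mem (fun y hy => ?_) hx).congr_deriv ?_
  · simp only [eqnDeriv₂, Pi.add_apply, Pi.sub_apply, Pi.mul_apply]; ring
  · simp only [eqnDeriv₃]

theorem hasDerivs_deriv₂ (hd : DataBounds lam β M b b₁ b₂ c c₁ c₂ f f₁ f₂)
    (hu : HasDerivs u u₁ (eqnDeriv₂ ε₁ ε₂ b c f u u₁)) :
    HasDerivs (eqnDeriv₂ ε₁ ε₂ b c f u u₁) (eqnDeriv₃ ε₁ ε₂ b b₁ c c₁ f f₁ u u₁)
      (eqnDeriv₄ ε₁ ε₂ b b₁ b₂ c c₁ c₂ f f₁ f₂ u u₁) := by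
  refine fun x hx => ⟨(hasDerivs_deriv hd hu x hx).2, ?_⟩
  have hu1 := (hu x hx).1
  have hu2 := (hu x hx).2
  have hu3 := (hasDerivs_deriv hd hu x hx).2
  have hb := (hd.derivs_b x hx).1
  have hb' := (hd.derivs_b x hx).2
  have hc := (hd.derivs_c x hx).1
  have hc' := (hd.derivs_c x hx).2
  have hf := (hd.derivs_f x hx).2
  have := (((((hb'.mul hu2).add (hb.mul hu3)).const_mul ε₂).add
    ((hc'.mul hu1).add (hc.mul hu2))).sub hf).div_const ε₁
  refine (this.congr_of_mem (fun y hy => ?_) hx).congr_deriv ?_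
  · simp only [eqnDeriv₃, Pi.add_apply, Pi.sub_apply, Pi.mul_apply]
  · simp only [eqnDeriv₄]; ring

theorem differentiated_eqn (hε : 0 < ε₁) (x : ℝ) :
    -ε₁ * eqnDeriv₃ ε₁ ε₂ b b₁ c c₁ f f₁ u u₁ x + ε₂ * b x * eqnDeriv₂ ε₁ ε₂ b c f u u₁ x
      + (c x + 1 * ε₂ * b₁ x) * u₁ x = f₁ x - c₁ x * u x := by
  rw [eqnDeriv₃]; field_simp; ring

theorem twice_differentiated_eqn (hε : 0 < ε₁) (x : ℝ) :
    -ε₁ * eqnDeriv₄ ε₁ ε₂ b b₁ b₂ c c₁ c₂ f f₁ f₂ u u₁ x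
      + ε₂ * b x * eqnDeriv₃ ε₁ ε₂ b b₁ c c₁ f f₁ u u₁ x
      + (c x + 2 * ε₂ * b₁ x) * eqnDeriv₂ ε₁ ε₂ b c f u u₁ x
      = f₂ x - c₂ x * u x - 2 * c₁ x * u₁ x - ε₂ * b₂ x * u₁ x := by
  rw [eqnDeriv₄]; field_simp; ring

theorem one_le_barrier {ρ₀ ρ₁ r s : ℝ} (h₀ : 0 ≤ ρ₀) (h₁ : 0 ≤ ρ₁) (x : ℝ) :
    1 ≤ barrier 1 ρ₀ ρ₁ r s x := by
  unfold barrier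
  have := mul_nonneg h₀ (Real.exp_pos (-r * x)).le
  have := mul_nonneg h₁ (Real.exp_pos (-s * (1 - x))).le
  linarith

theorem barrier_mono {ρ₀ ρ₁ ρ₀' ρ₁' r s : ℝ} (h₀ : ρ₀ ≤ ρ₀') (h₁ : ρ₁ ≤ ρ₁') (x : ℝ) :
    barrier 1 ρ₀ ρ₁ r s x ≤ barrier 1 ρ₀' ρ₁' r s x := by
  unfold barrier
  have := mul_le_mul_of_nonneg_right h₀ (Real.exp_pos (-r * x)).le
  have := mul_le_mul_of_nonneg_right h₁ (Real.exp_pos (-s * (1 - x))).le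
  linarith

/-- `u'` solves the once differentiated equation, whose right-hand side `f' - c'u` is bounded. Its
boundary values have the size of the layer amplitudes, so `abs_le_layers` applies with `ρ₀ = μ₀` and
`ρ₁ = μ₁`. -/
theorem exists_first_deriv_bound {lam β M p : ℝ} (hlam : 0 < lam) (hβ : 0 < β) (hM : 1 ≤ M)
    (hp₀ : 0 < p) (hp₁ : p < 1) :
    ∃ K : ℝ, 0 < K ∧ ∀ (ε₁ ε₂ μ₀ μ₁ : ℝ) (b b₁ b₂ c c₁ c₂ f f₁ f₂ u u₁ : ℝ → ℝ),
      DataBounds lam β M b b₁ b₂ c c₁ c₂ f f₁ f₂ → LayerRates ε₁ ε₂ lam β M b c μ₀ μ₁ →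
      4 * ε₂ * M ≤ (1 - p) * β → HasDerivs u u₁ (eqnDeriv₂ ε₁ ε₂ b c f u u₁) →
      u 0 = 0 → u 1 = 0 → |u₁ 0| ≤ K * μ₀ ∧ |u₁ 1| ≤ K * μ₁ ∧
      ∀ x ∈ Icc (0 : ℝ) 1, |u₁ x| ≤ K * barrier 1 μ₀ μ₁ (p * μ₀) (p * μ₁) x := by
  have hM0 : 0 < M := zero_lt_one.trans_le hM
  set K₀ := M / (p ^ 2 * lam * β / M) * p with hK₀
  set K₁ := M / β * (M / lam + 1) with hK₁
  set R := K₀ + K₁ + (M + M * (M / β)) with hR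
  have h0 : 0 < K₀ := by positivity
  have h1 : 0 < K₁ := by positivity
  have h2 : 0 < M + M * (M / β) := by positivity
  have hR0 : 0 < R := by positivity
  set κ := (1 - p) * β / 2 with hκ
  have hκ0 : 0 < κ := by have : 0 < 1 - p := by linarith
                         positivity
  have hRK : R ≤ R / κ + R := by have : 0 < R / κ := by positivity
                                 linarith
  refine ⟨R / κ + R, by positivity, ?_⟩
  intro ε₁ ε₂ μ₀ μ₁ b b₁ b₂ c c₁ c₂ f f₁ f₂ u u₁ hd hl hsm hu hu0 hu1
  have hm₀ := hl.mu_pos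
  have hm₁ := hl.mu₁_pos
  have a0 := abs_deriv_zero_bound hd hl hp₀ hp₁ hu hu0 hu1
  have a1 := abs_deriv_one_bound hd hl hu hu0 hu1
  rw [← hK₀] at a0
  rw [← hK₁] at a1
  have a0' : |u₁ 0| ≤ R * μ₀ := a0.trans (mul_le_mul_of_nonneg_right (by linarith) hm₀.le)
  have a1' : |u₁ 1| ≤ R * μ₁ := a1.trans (mul_le_mul_of_nonneg_right (by linarith) hm₁.le)
  refine ⟨a0'.trans (mul_le_mul_of_nonneg_right hRK hm₀.le),
    a1'.trans (mul_le_mul_of_nonneg_right hRK hm₁.le), ?_⟩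
  have hco := fun x (hx : x ∈ Icc (0 : ℝ) 1) => layer_coefficients hd hl hp₀ hp₁ hsm
    (k := 1) zero_le_one one_le_two hx
  refine abs_le_layers (B := fun x => ε₂ * b x) (C := fun x => c x + 1 * ε₂ * b₁ x)
    hl.pos₁ hκ0 hR0.le hm₀.le hm₁.le (hasDerivs_deriv hd hu)
    (fun x hx => (hco x hx).1) (fun x hx => (hco x hx).2.1) (fun x hx => (hco x hx).2.2)
    (fun x hx => ?_) a0' a1'
  rw [differentiated_eqn hl.pos₁]
  have e1 : |f₁ x - c₁ x * u x| ≤ M + M * (M / β) := by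
    refine (abs_sub _ _).trans (add_le_add (hd.abs_f₁ x hx) ?_)
    rw [abs_mul]
    exact mul_le_mul (hd.abs_c₁ x hx) (abs_solution_le hd hl.pos₁ hu hu0 hu1 x hx)
      (abs_nonneg _) hM0.le
  have e2 := one_le_barrier (r := p * μ₀) (s := p * μ₁) hm₀.le hm₁.le x
  have e3 := mul_le_mul_of_nonneg_left e2 hR0.le
  linarith

end TwoParam

/-! ### The bound for `u''` -/

namespace TwoParam

theorem mul_exp_neg_le {p y : ℝ} (hp : 0 < p) : y * Real.exp (-(p * y)) ≤ 1 / p := by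
  have h := Real.add_one_le_exp (p * y)
  rw [Real.exp_neg, ← div_eq_mul_inv, div_le_div_iff₀ (Real.exp_pos _) hp]
  linarith

theorem sq_mul_exp_neg_le {p y : ℝ} (hp : 0 < p) (hy : 0 ≤ y) :
    y ^ 2 * Real.exp (-(p * y)) ≤ 2 / p ^ 2 := by
  have h := Real.quadratic_le_exp_of_nonneg (mul_nonneg hp.le hy)
  rw [Real.exp_neg, ← div_eq_mul_inv, div_le_div_iff₀ (Real.exp_pos _) (by positivity)]
  nlinarith [mul_nonneg hp.le hy]

/-- Reading `u''(0)` off the equation would only give the order `μ₀μ₁`, because of the term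
`ε₂bu'/ε₁`. Instead `u''(0)` is the slope at `0` of `u' - u'(0)`, which is compared with a barrier
vanishing there. -/
theorem exists_second_deriv_zero_bound {lam β M p : ℝ} (hlam : 0 < lam) (hβ : 0 < β) (hM : 1 ≤ M)
    (hp₀ : 0 < p) (hp₁ : p < 1) :
    ∃ K : ℝ, 0 < K ∧ ∀ (ε₁ ε₂ μ₀ μ₁ : ℝ) (b b₁ b₂ c c₁ c₂ f f₁ f₂ u u₁ : ℝ → ℝ),
      DataBounds lam β M b b₁ b₂ c c₁ c₂ f f₁ f₂ → LayerRates ε₁ ε₂ lam β M b c μ₀ μ₁ → 1 ≤ μ₀ →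
      4 * ε₂ * M ≤ (1 - p) * β → HasDerivs u u₁ (eqnDeriv₂ ε₁ ε₂ b c f u u₁) →
      u 0 = 0 → u 1 = 0 → |eqnDeriv₂ ε₁ ε₂ b c f u u₁ 0| ≤ K * μ₀ ^ 2 := by
  obtain ⟨C, hC, hfirst⟩ := exists_first_deriv_bound hlam hβ hM hp₀ hp₁
  have hM0 : 0 < M := zero_lt_one.trans_le hM
  set κ := (1 - p) * β / 2 with hκ
  have h1p : 0 < 1 - p := by linarith
  have hκ0 : 0 < κ := by positivity
  set κ' := min κ (p ^ 2 * lam * β / M) with hκ'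
  have hκ'0 : 0 < κ' := lt_min hκ0 (by positivity)
  have hk1 : κ' ≤ κ := min_le_left _ _
  have hk2 : κ' ≤ p ^ 2 * lam * β / M := min_le_right _ _
  have hep : Real.exp (-p) < 1 := Real.exp_lt_one_iff.2 (by linarith)
  -- `Q` is chosen so that the right layer of the barrier covers `|u'(1) - u'(0)| ≤ 2Cμ₁`; note `1 -
  -- e^{-pμ₁} ≥ 1 - e^{-p}`.
  set Q := 2 * C / (1 - Real.exp (-p)) with hQ
  have hQ0 : 0 < Q := by
    have : 0 < 1 - Real.exp (-p) := by linarith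
    positivity
  set R := M + M * (M / β) + 2 * M * C with hR
  have hR0 : 0 < R := by positivity
  set P := (R + 2 * M * (Q / p)) / κ' with hP
  have hP0 : 0 < P := by positivity
  have hPκ : P * κ' = R + 2 * M * (Q / p) := div_mul_cancel₀ _ hκ'0.ne'
  refine ⟨P * p + Q * p * (2 / p ^ 2), by positivity, ?_⟩
  intro ε₁ ε₂ μ₀ μ₁ b b₁ b₂ c c₁ c₂ f f₁ f₂ u u₁ hd hl hμ hsm hu hu0 hu1
  obtain ⟨g0, g1, -⟩ := hfirst ε₁ ε₂ μ₀ μ₁ b b₁ b₂ c c₁ c₂ f f₁ f₂ u u₁ hd hl hsm hu hu0 hu1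
  have hm₀ := hl.mu_pos
  have hm₁ := hl.mu₁_pos
  have hμ₁ : 1 ≤ μ₁ := hμ.trans hl.mu_le
  have hco := fun x (hx : x ∈ Icc (0 : ℝ) 1) => layer_coefficients hd hl hp₀ hp₁ hsm
    (k := 1) zero_le_one one_le_two hx
  set r := p * μ₀ with hr
  set s := p * μ₁ with hs
  have hr0 : 0 < r := by positivity
  have hs0 : 0 < s := by positivity
  have hCM : ∀ x ∈ Icc (0 : ℝ) 1, c x + 1 * ε₂ * b₁ x ≤ 2 * M := by
    intro x hx
    have h1 := (le_abs_self _).trans (hd.abs_c x hx)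
    have h2 : ε₂ * b₁ x ≤ ε₂ * M :=
      mul_le_mul_of_nonneg_left ((le_abs_self _).trans (hd.abs_b₁ x hx)) hl.pos₂.le
    have h3 := hd.beta_le_M
    nlinarith [mul_pos hp₀ hβ]
  have hderivs : HasDerivs (fun x => u₁ x - u₁ 0) (eqnDeriv₂ ε₁ ε₂ b c f u u₁)
      (eqnDeriv₃ ε₁ ε₂ b b₁ c c₁ f f₁ u u₁) := fun x hx =>
    ⟨(hasDerivs_deriv hd hu x hx).1.sub_const _, (hasDerivs_deriv hd hu x hx).2⟩
  have hμe : μ₁ * Real.exp (-s) ≤ 1 / p := mul_exp_neg_le hp₀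
  -- The constant term makes the barrier vanish at `0`. Its slope there is `P p μ₀² + Q p μ₁²
  -- e^{-pμ₁}`, whose second summand is bounded and hence `O(μ₀²)`.
  have hbar := abs_le_barrier (A := P * μ₀ - Q * μ₁ * Real.exp (-s)) (P := -(P * μ₀))
    (Q := Q * μ₁) (r := r) (s := s) (B := fun x => ε₂ * b x)
    (C := fun x => c x + 1 * ε₂ * b₁ x) hl.pos₁ hderivs
    (fun x hx => hκ0.trans_le (hco x hx).1) (fun x hx => ?_) ?_ ?_
  · have hder := hasDerivAt_barrier (P * μ₀ - Q * μ₁ * Real.exp (-s)) (-(P * μ₀)) (Q * μ₁) r s 0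
    have h3 := abs_deriv_zero_le (hasDerivs_deriv hd hu 0 (by simp)).1 hder
      (by simp [barrier]; ring) hbar
    refine h3.trans ?_
    have h4 := sq_mul_exp_neg_le hp₀ hm₁.le
    have h5 : Q * p * (μ₁ ^ 2 * Real.exp (-s)) ≤ Q * p * (2 / p ^ 2) :=
      mul_le_mul_of_nonneg_left h4 (by positivity)
    have h6 : Q * p * (2 / p ^ 2) * 1 ≤ Q * p * (2 / p ^ 2) * μ₀ ^ 2 :=
      mul_le_mul_of_nonneg_left (by nlinarith) (by positivity)
    have h7 : barrier 0 (-r * -(P * μ₀)) (s * (Q * μ₁)) r s 0 =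
        P * p * μ₀ ^ 2 + Q * p * (μ₁ ^ 2 * Real.exp (-s)) := by
      simp [barrier, hr, hs]; ring
    rw [h7]
    linarith
  · have e : -ε₁ * eqnDeriv₃ ε₁ ε₂ b b₁ c c₁ f f₁ u u₁ x
        + ε₂ * b x * eqnDeriv₂ ε₁ ε₂ b c f u u₁ x + (c x + 1 * ε₂ * b₁ x) * (u₁ x - u₁ 0)
        = (f₁ x - c₁ x * u x) - (c x + 1 * ε₂ * b₁ x) * u₁ 0 := by
      rw [← differentiated_eqn (f := f) (u₁ := u₁) (ε₂ := ε₂) (b := b) hl.pos₁]; ring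
    rw [e]
    obtain ⟨c1, c2, c3⟩ := hco x hx
    have hCx := hCM x hx
    set D := c x + 1 * ε₂ * b₁ x with hD
    have hDpos : 0 < D := hκ0.trans_le c1
    have e1 : |(f₁ x - c₁ x * u x) - D * u₁ 0| ≤ R * μ₀ := by
      have a1 : |f₁ x - c₁ x * u x| ≤ M + M * (M / β) := by
        refine (abs_sub _ _).trans (add_le_add (hd.abs_f₁ x hx) ?_)
        rw [abs_mul]
        exact mul_le_mul (hd.abs_c₁ x hx) (abs_solution_le hd hl.pos₁ hu hu0 hu1 x hx)
          (abs_nonneg _) hM0.le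
      have a2 : |D * u₁ 0| ≤ 2 * M * (C * μ₀) := by
        rw [abs_mul, abs_of_pos hDpos]
        exact mul_le_mul hCx g0 (abs_nonneg _) (by positivity)
      refine (abs_sub _ _).trans ((add_le_add a1 a2).trans ?_)
      have : (M + M * (M / β)) * 1 ≤ (M + M * (M / β)) * μ₀ :=
        mul_le_mul_of_nonneg_left hμ (by positivity)
      rw [hR]; linarith
    have hE := Real.exp_pos (-r * x)
    have hE1 : Real.exp (-r * x) ≤ 1 := by
      rw [Real.exp_le_one_iff]
      have := mul_nonneg hr0.le hx.1
      linarith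
    have hrate := le_left_rate hd hl hp₀ hp₁ hx
    have b1 : κ' * (1 - Real.exp (-r * x)) ≤ D * (1 - Real.exp (-r * x)) :=
      mul_le_mul_of_nonneg_right (hk1.trans c1) (by linarith)
    have b2 := mul_le_mul_of_nonneg_right (hk2.trans hrate) hE.le
    have b3 := mul_le_mul_of_nonneg_left (add_le_add b1 b2) (mul_pos hP0 hm₀).le
    have b4 : 0 ≤ Q * μ₁ * Real.exp (-s * (1 - x)) * (D - ε₁ * s ^ 2 + ε₂ * b x * s) := by
      have := hκ0.le.trans c3
      positivity
    have b5 : D * (Q * (μ₁ * Real.exp (-s))) ≤ 2 * M * (Q / p) := by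
      have : Q * (μ₁ * Real.exp (-s)) ≤ Q * (1 / p) := mul_le_mul_of_nonneg_left hμe hQ0.le
      rw [mul_one_div] at this
      exact mul_le_mul hCx this (by positivity) (by positivity)
    have b6 : P * μ₀ * κ' = (R + 2 * M * (Q / p)) * μ₀ := by rw [← hPκ]; ring
    have b7 : 2 * M * (Q / p) * 1 ≤ 2 * M * (Q / p) * μ₀ :=
      mul_le_mul_of_nonneg_left hμ (by positivity)
    have b8 : P * μ₀ * (κ' * (1 - Real.exp (-r * x)) + κ' * Real.exp (-r * x)) = P * μ₀ * κ' := by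
      ring
    rw [b8, b6] at b3
    linarith
  · rw [sub_self, abs_zero]; linarith
  · have h1 : |u₁ 1 - u₁ 0| ≤ 2 * C * μ₁ := by
      have : C * μ₀ ≤ C * μ₁ := mul_le_mul_of_nonneg_left hl.mu_le hC.le
      refine (abs_sub _ _).trans ((add_le_add g1 g0).trans ?_)
      linarith
    have h2 : Real.exp (-r) ≤ 1 := by
      rw [Real.exp_le_one_iff]; linarith
    have h3 : Real.exp (-s) ≤ Real.exp (-p) := by
      rw [Real.exp_le_exp]; nlinarith
    have h4 : 2 * C = Q * (1 - Real.exp (-p)) := by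
      rw [hQ, div_mul_cancel₀]; linarith
    have h5 : Q * (1 - Real.exp (-p)) * μ₁ ≤ Q * (1 - Real.exp (-s)) * μ₁ :=
      mul_le_mul_of_nonneg_right (mul_le_mul_of_nonneg_left (by linarith) hQ0.le) hm₁.le
    have h6 : 0 ≤ P * μ₀ * (1 - Real.exp (-r)) := mul_nonneg (by positivity) (by linarith)
    rw [h4] at h1
    linarith

/-- `u''` solves the twice differentiated equation, whose right-hand side is controlled by the bound
on `u'`. At `x = 1` the equation itself gives the boundary value, since `ε₂μ₁` and `1` are both
`O(ε₁μ₁²)`; at `x = 0` the preceding barrier argument is needed. -/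
theorem exists_second_deriv_bound {lam β M p : ℝ} (hlam : 0 < lam) (hβ : 0 < β) (hM : 1 ≤ M)
    (hp₀ : 0 < p) (hp₁ : p < 1) :
    ∃ K : ℝ, 0 < K ∧ ∀ (ε₁ ε₂ μ₀ μ₁ : ℝ) (b b₁ b₂ c c₁ c₂ f f₁ f₂ u u₁ : ℝ → ℝ),
      DataBounds lam β M b b₁ b₂ c c₁ c₂ f f₁ f₂ → LayerRates ε₁ ε₂ lam β M b c μ₀ μ₁ → 1 ≤ μ₀ →
      4 * ε₂ * M ≤ (1 - p) * β → HasDerivs u u₁ (eqnDeriv₂ ε₁ ε₂ b c f u u₁) →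
      u 0 = 0 → u 1 = 0 → ∀ x ∈ Icc (0 : ℝ) 1, |eqnDeriv₂ ε₁ ε₂ b c f u u₁ x| ≤
        K * barrier 1 (μ₀ ^ 2) (μ₁ ^ 2) (p * μ₀) (p * μ₁) x := by
  obtain ⟨C, hC, hfirst⟩ := exists_first_deriv_bound hlam hβ hM hp₀ hp₁
  obtain ⟨C₂, hC₂, hsecond⟩ := exists_second_deriv_zero_bound hlam hβ hM hp₀ hp₁
  have hM0 : 0 < M := zero_lt_one.trans_le hM
  set κ := (1 - p) * β / 2 with hκ
  have h1p : 0 < 1 - p := by linarith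
  have hκ0 : 0 < κ := by positivity
  set C₃ := M * C / lam + M / β with hC₃
  set R := C₂ + C₃ + (M + M * (M / β) + 3 * M * C) with hR
  have hC₃0 : 0 < C₃ := by positivity
  have hR1 : 0 < M + M * (M / β) + 3 * M * C := by positivity
  have hR0 : 0 < R := by positivity
  refine ⟨R / κ + R, by positivity, ?_⟩
  intro ε₁ ε₂ μ₀ μ₁ b b₁ b₂ c c₁ c₂ f f₁ f₂ u u₁ hd hl hμ hsm hu hu0 hu1
  obtain ⟨-, g1, g⟩ := hfirst ε₁ ε₂ μ₀ μ₁ b b₁ b₂ c c₁ c₂ f f₁ f₂ u u₁ hd hl hsm hu hu0 hu1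
  have g2 := hsecond ε₁ ε₂ μ₀ μ₁ b b₁ b₂ c c₁ c₂ f f₁ f₂ u u₁ hd hl hμ hsm hu hu0 hu1
  have hm₀ := hl.mu_pos
  have hm₁ := hl.mu₁_pos
  have hε₁ := hl.pos₁
  have hε₂ := hl.pos₂
  have hμ₁ : 1 ≤ μ₁ := hμ.trans hl.mu_le
  have hco := fun x (hx : x ∈ Icc (0 : ℝ) 1) => layer_coefficients hd hl hp₀ hp₁ hsm
    (k := 2) zero_le_two le_rfl hx
  have hε₂1 : ε₂ ≤ 1 := by
    have h3 := hd.beta_le_M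
    nlinarith [mul_pos hp₀ hβ]
  refine abs_le_layers (B := fun x => ε₂ * b x) (C := fun x => c x + 2 * ε₂ * b₁ x)
    hε₁ hκ0 hR0.le (by positivity) (by positivity) (hasDerivs_deriv₂ hd hu)
    (fun x hx => (hco x hx).1) (fun x hx => (hco x hx).2.1) (fun x hx => (hco x hx).2.2)
    (fun x hx => ?_) (g2.trans (mul_le_mul_of_nonneg_right (by linarith) (by positivity))) ?_
  · rw [twice_differentiated_eqn hε₁]
    have hB1 := one_le_barrier (r := p * μ₀) (s := p * μ₁) (sq_nonneg μ₀) (sq_nonneg μ₁) x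
    have hu₁ : |u₁ x| ≤ C * barrier 1 (μ₀ ^ 2) (μ₁ ^ 2) (p * μ₀) (p * μ₁) x :=
      (g x hx).trans (mul_le_mul_of_nonneg_left (barrier_mono (by nlinarith) (by nlinarith) x)
        hC.le)
    set B := barrier 1 (μ₀ ^ 2) (μ₁ ^ 2) (p * μ₀) (p * μ₁) x
    have a1 : |c₂ x * u x| ≤ M * (M / β) := by
      rw [abs_mul]
      exact mul_le_mul (hd.abs_c₂ x hx) (abs_solution_le hd hε₁ hu hu0 hu1 x hx)
        (abs_nonneg _) hM0.le
    have a2 : |2 * c₁ x * u₁ x| ≤ 2 * M * (C * B) := by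
      rw [abs_mul, abs_mul, abs_two]
      exact mul_le_mul (by linarith [hd.abs_c₁ x hx]) hu₁ (abs_nonneg _) (by positivity)
    have a3 : |ε₂ * b₂ x * u₁ x| ≤ M * (C * B) := by
      rw [abs_mul, abs_mul, abs_of_pos hε₂]
      refine mul_le_mul ?_ hu₁ (abs_nonneg _) hM0.le
      have := mul_le_mul hε₂1 (hd.abs_b₂ x hx) (abs_nonneg _) zero_le_one
      linarith
    have a0 := hd.abs_f₂ x hx
    have t1 := abs_sub (f₂ x - c₂ x * u x - 2 * c₁ x * u₁ x) (ε₂ * b₂ x * u₁ x)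
    have t2 := abs_sub (f₂ x - c₂ x * u x) (2 * c₁ x * u₁ x)
    have t3 := abs_sub (f₂ x) (c₂ x * u x)
    have e1 : (M + M * (M / β)) * 1 ≤ (M + M * (M / β)) * B :=
      mul_le_mul_of_nonneg_left hB1 (by positivity)
    have e2 : (M + M * (M / β) + 3 * M * C) * B ≤ R * B :=
      mul_le_mul_of_nonneg_right (by linarith) (by linarith)
    linarith
  · have e1 : |ε₂ * b 1 * u₁ 1 + c 1 * u 1 - f 1| ≤ ε₂ * M * (C * μ₁) + M := by
      rw [hu1, mul_zero, add_zero]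
      refine (abs_sub _ _).trans (add_le_add ?_ (hd.abs_f 1 (by simp)))
      rw [abs_mul, abs_mul, abs_of_pos hε₂]
      exact mul_le_mul (mul_le_mul_of_nonneg_left (hd.abs_b 1 (by simp)) hε₂.le) g1
        (abs_nonneg _) (by positivity)
    have hr := hl.le_right
    have a1 : M * C / lam * (ε₂ * lam * μ₁) ≤ M * C / lam * (ε₁ * μ₁ ^ 2) :=
      mul_le_mul_of_nonneg_left (by linarith) (by positivity)
    have a2 : M / β * β ≤ M / β * (ε₁ * μ₁ ^ 2) := by
      have : 0 < ε₂ * lam * μ₁ := by positivity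
      exact mul_le_mul_of_nonneg_left (by linarith) (by positivity)
    have a3 : M * C / lam * (ε₂ * lam * μ₁) = ε₂ * M * (C * μ₁) := by field_simp
    have a4 : M / β * β = M := div_mul_cancel₀ _ hβ.ne'
    have a5 : |eqnDeriv₂ ε₁ ε₂ b c f u u₁ 1| ≤ C₃ * μ₁ ^ 2 := by
      rw [eqnDeriv₂, abs_div, abs_of_pos hε₁, div_le_iff₀ hε₁]
      rw [hC₃]; linarith
    exact a5.trans (mul_le_mul_of_nonneg_right (by linarith) (by positivity))

end TwoParam

namespace TwoParam

/-! ### Decomposition into a smooth part and two layers -/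

/-- Integrating from the far end `1` preserves the decay, since `∫ₓ¹ e^{-rt} dt ≤ e^{-rx} / r`. -/
theorem exists_layer_primitive {g : ℝ → ℝ} {K r : ℝ} (hg : Continuous g) (hr : 0 < r)
    (hK : ∀ x ∈ Icc (0 : ℝ) 1, |g x| ≤ K * Real.exp (-r * x)) :
    ∃ G : ℝ → ℝ, (∀ x, HasDerivAt G (g x) x) ∧
      ∀ x ∈ Icc (0 : ℝ) 1, |G x| ≤ K / r * Real.exp (-r * x) := by
  have hK0 : 0 ≤ K := by
    have := (abs_nonneg _).trans (hK 0 (by simp))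
    simpa using this
  refine ⟨fun x => ∫ t in (1 : ℝ)..x, g t, fun x =>
    intervalIntegral.integral_hasDerivAt_right (hg.intervalIntegrable _ _)
      (hg.stronglyMeasurableAtFilter _ _) hg.continuousAt, fun x hx => ?_⟩
  have hc : Continuous fun t => K * Real.exp (-r * t) := by fun_prop
  have h1 : ‖∫ t in x..1, g t‖ ≤ ∫ t in x..1, K * Real.exp (-r * t) := by
    refine intervalIntegral.norm_integral_le_of_norm_le hx.2
      (Filter.Eventually.of_forall fun t ht => ?_) (hc.intervalIntegrable _ _)
    exact hK t ⟨hx.1.trans ht.1.le, ht.2⟩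
  have h2 : ∫ t in x..1, K * Real.exp (-r * t) =
      -(K / r * Real.exp (-r * 1)) - -(K / r * Real.exp (-r * x)) := by
    refine intervalIntegral.integral_eq_sub_of_hasDerivAt
      (f := fun t => -(K / r * Real.exp (-r * t))) (fun t _ => ?_) (hc.intervalIntegrable _ _)
    refine ((hasDerivAt_exp_left r t).const_mul (K / r)).neg.congr_deriv ?_
    field_simp
  beta_reduce
  rw [intervalIntegral.integral_symm, abs_neg, ← Real.norm_eq_abs]
  refine h1.trans ?_
  rw [h2]
  have : 0 ≤ K / r * Real.exp (-r * 1) := by positivity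
  linarith

/-- `F` is a boundary layer function at `0` with rate `μ`. -/
structure IsLayer (F F₁ F₂ : ℝ → ℝ) (K p μ : ℝ) : Prop where
  derivs : HasDerivs F F₁ F₂
  abs_le : ∀ x ∈ Icc (0 : ℝ) 1, |F x| ≤ K * Real.exp (-(p * μ) * x)
  abs_le₁ : ∀ x ∈ Icc (0 : ℝ) 1, |F₁ x| ≤ K * μ * Real.exp (-(p * μ) * x)
  abs_le₂ : ∀ x ∈ Icc (0 : ℝ) 1, |F₂ x| ≤ K * μ ^ 2 * Real.exp (-(p * μ) * x)

/-- Each of the two integrations gains a factor `1/(pμ)`. As `p < 1`, the constant `K / p²` serves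
all three bounds. -/
theorem exists_layer {g : ℝ → ℝ} {K p μ : ℝ} (hg : Continuous g) (hp₀ : 0 < p) (hp₁ : p < 1)
    (hμ : 0 < μ) (hK : ∀ x ∈ Icc (0 : ℝ) 1, |g x| ≤ K * μ ^ 2 * Real.exp (-(p * μ) * x)) :
    ∃ F F₁ : ℝ → ℝ, IsLayer F F₁ g (K / p ^ 2) p μ := by
  have hK0 : 0 ≤ K := by
    have := (abs_nonneg _).trans (hK 0 (by simp))
    simp only [mul_zero, Real.exp_zero, mul_one] at this
    exact nonneg_of_mul_nonneg_left this (by positivity)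
  have hr : 0 < p * μ := by positivity
  obtain ⟨F₁, h1, h1'⟩ := exists_layer_primitive hg hr hK
  have hF₁ : Continuous F₁ := continuous_iff_continuousAt.2 fun x => (h1 x).continuousAt
  obtain ⟨F, h2, h2'⟩ := exists_layer_primitive hF₁ hr h1'
  have hp2 : p ^ 2 ≤ p := by nlinarith
  have hp3 : p ^ 2 ≤ 1 := by nlinarith
  refine ⟨F, F₁, fun x _ => ⟨(h2 x).hasDerivWithinAt, (h1 x).hasDerivWithinAt⟩, ?_, ?_, ?_⟩
  · intro x hx
    refine (h2' x hx).trans (le_of_eq ?_)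
    field_simp
  · intro x hx
    refine (h1' x hx).trans (mul_le_mul_of_nonneg_right ?_ (Real.exp_pos _).le)
    have e : K * μ ^ 2 / (p * μ) = K / p * μ := by field_simp
    rw [e]
    exact mul_le_mul_of_nonneg_right (div_le_div_of_nonneg_left hK0 (by positivity) hp2) hμ.le
  · intro x hx
    refine (hK x hx).trans (mul_le_mul_of_nonneg_right ?_ (Real.exp_pos _).le)
    refine mul_le_mul_of_nonneg_right ?_ (by positivity)
    rw [le_div_iff₀ (by positivity)]
    nlinarith

theorem HasDerivs.reflect {F F₁ F₂ : ℝ → ℝ} (h : HasDerivs F F₁ F₂) :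
    HasDerivs (fun x => F (1 - x)) (fun x => -F₁ (1 - x)) (fun x => F₂ (1 - x)) := by
  have hm : MapsTo (fun x : ℝ => 1 - x) (Icc 0 1) (Icc 0 1) := fun x hx =>
    ⟨by linarith [hx.2], by linarith [hx.1]⟩
  intro x hx
  have hr : HasDerivWithinAt (fun x : ℝ => 1 - x) (-1) (Icc 0 1) x := by
    simpa using ((hasDerivAt_id x).const_sub 1).hasDerivWithinAt
  have h1 := HasDerivWithinAt.comp (h₂ := F) x (h _ (hm hx)).1 hr hm
  have h2 := (HasDerivWithinAt.comp (h₂ := F₁) x (h _ (hm hx)).2 hr hm).neg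
  constructor
  · exact h1.congr_deriv (by ring)
  · exact h2.congr_deriv (by ring)

theorem HasDerivs.sub {F F₁ F₂ G G₁ G₂ : ℝ → ℝ} (hF : HasDerivs F F₁ F₂)
    (hG : HasDerivs G G₁ G₂) :
    HasDerivs (fun x => F x - G x) (fun x => F₁ x - G₁ x) (fun x => F₂ x - G₂ x) :=
  fun x hx => ⟨(hF x hx).1.sub (hG x hx).1, (hF x hx).2.sub (hG x hx).2⟩

/-- Splitting of a function whose second derivative is bounded by layer terms. -/
theorem exists_decomposition {u u₁ u₂ : ℝ → ℝ} {K p μ₀ μ₁ : ℝ} (hp₀ : 0 < p) (hp₁ : p < 1)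
    (hμ₀ : 0 < μ₀) (hμ₁ : 0 < μ₁) (hu : HasDerivs u u₁ u₂) (huc : ContinuousOn u₂ (Icc 0 1))
    (hK : ∀ x ∈ Icc (0 : ℝ) 1,
      |u₂ x| ≤ K * barrier 1 (μ₀ ^ 2) (μ₁ ^ 2) (p * μ₀) (p * μ₁) x) :
    ∃ S S₁ S₂ E E₁ E₂ D D₁ D₂ : ℝ → ℝ, HasDerivs S S₁ S₂ ∧
      (∀ x ∈ Icc (0 : ℝ) 1, |S₂ x| ≤ K) ∧ IsLayer E E₁ E₂ (K / p ^ 2) p μ₀ ∧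
      IsLayer D D₁ D₂ (K / p ^ 2) p μ₁ ∧ (∀ x, u x = S x + E x + D (1 - x)) ∧
      ∀ x, u₁ x = S₁ x + E₁ x - D₁ (1 - x) := by
  set B : ℝ → ℝ := barrier 1 (μ₀ ^ 2) (μ₁ ^ 2) (p * μ₀) (p * μ₁) with hB
  have hB1 : ∀ x, 1 ≤ B x := fun x => one_le_barrier (sq_nonneg _) (sq_nonneg _) x
  have hBc : Continuous B := continuous_iff_continuousAt.2 fun x =>
    (hasDerivAt_barrier _ _ _ _ _ _).continuousAt
  -- `exists_layer` needs continuity on the whole line, whence the extension by endpoint values.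
  set U : ℝ → ℝ := IccExtend zero_le_one ((Icc (0 : ℝ) 1).domRestrict u₂) with hU
  have hUc : Continuous U := (continuousOn_iff_continuous_domRestrict.1 huc).Icc_extend'
  have hUu : ∀ y ∈ Icc (0 : ℝ) 1, U y = u₂ y := fun y hy => by
    rw [hU, IccExtend_of_mem _ _ hy]; rfl
  have hq : ∀ x ∈ Icc (0 : ℝ) 1, |U x / B x| ≤ K := fun x hx => by
    rw [abs_div, abs_of_pos (zero_lt_one.trans_le (hB1 x)),
      div_le_iff₀ (zero_lt_one.trans_le (hB1 x)), hUu x hx]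
    exact hK x hx
  have hqc : Continuous fun x => U x / B x :=
    hUc.div hBc fun x => (zero_lt_one.trans_le (hB1 x)).ne'
  -- `u'' = (U/B) B` is distributed over the three summands of `B`. The quotient is bounded by `K`,
  -- so each share inherits the size of its summand. The right layer is written in the variable `1 -
  -- x`, which makes it a layer at `0`.
  set E₂ : ℝ → ℝ := fun x => U x / B x * (μ₀ ^ 2 * Real.exp (-(p * μ₀) * x)) with hE₂
  set D₂ : ℝ → ℝ := fun x => U (1 - x) / B (1 - x) * (μ₁ ^ 2 * Real.exp (-(p * μ₁) * x)) with hD₂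
  obtain ⟨E, E₁, hE⟩ := exists_layer (g := E₂) (K := K) (p := p) (μ := μ₀)
    (hqc.mul (by fun_prop)) hp₀ hp₁ hμ₀ (fun x hx => by
      rw [hE₂, abs_mul, abs_of_pos (a := μ₀ ^ 2 * _) (by positivity), mul_assoc]
      exact mul_le_mul_of_nonneg_right (hq x hx) (by positivity))
  obtain ⟨D, D₁, hD⟩ := exists_layer (g := D₂) (K := K) (p := p) (μ := μ₁)
    ((hqc.comp (continuous_const.sub continuous_id)).mul (by fun_prop)) hp₀ hp₁ hμ₁
    (fun x hx => by
      rw [hD₂, abs_mul, abs_of_pos (a := μ₁ ^ 2 * _) (by positivity), mul_assoc]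
      exact mul_le_mul_of_nonneg_right (hq _ ⟨by linarith [hx.2], by linarith [hx.1]⟩)
        (by positivity))
  refine ⟨_, _, _, E, E₁, E₂, D, D₁, D₂, (hu.sub hE.derivs).sub hD.derivs.reflect, ?_, hE, hD,
    fun x => by ring, fun x => by ring⟩
  intro x hx
  have hBx : 0 < B x := zero_lt_one.trans_le (hB1 x)
  have e : u₂ x - E₂ x - D₂ (1 - x) = U x / B x := by
    have h1 : u₂ x = U x / B x * B x := by rw [hUu x hx, div_mul_cancel₀ _ hBx.ne']
    have h2 : B x = 1 + μ₀ ^ 2 * Real.exp (-(p * μ₀) * x)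
      + μ₁ ^ 2 * Real.exp (-(p * μ₁) * (1 - x)) := rfl
    simp only [hE₂, hD₂, sub_sub_cancel]
    rw [h1]
    nth_rewrite 2 [h2]
    ring
  rw [e]
  exact hq x hx

/-! ### Interpolation errors on one mesh interval -/

/-- The error of linear interpolation of `F` on `[a,b]`. -/
def chordErr (F : ℝ → ℝ) (a b x : ℝ) : ℝ := F x - (F a + (F b - F a) / (b - a) * (x - a))

theorem abs_chordErr_le_two_mul {F : ℝ → ℝ} {a b B x : ℝ} (hab : a < b)
    (hB : ∀ y ∈ Icc a b, |F y| ≤ B) (hx : x ∈ Icc a b) : |chordErr F a b x| ≤ 2 * B := by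
  have hc : |F a + (F b - F a) / (b - a) * (x - a)| ≤ B := by
    have hba : 0 < b - a := by linarith
    set t := (x - a) / (b - a) with ht
    have e : F a + (F b - F a) / (b - a) * (x - a) = (1 - t) * F a + t * F b := by
      rw [ht]; field_simp; ring
    have t0 : 0 ≤ t := div_nonneg (by linarith [hx.1]) hba.le
    have t1 : t ≤ 1 := by rw [ht, div_le_one hba]; linarith [hx.2]
    have Fa := hB a (left_mem_Icc.2 hab.le)
    have Fb := hB b (right_mem_Icc.2 hab.le)
    rw [e]
    refine (abs_add_le _ _).trans ?_
    rw [abs_mul, abs_mul, abs_of_nonneg t0, abs_of_nonneg (sub_nonneg.2 t1)]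
    nlinarith [mul_le_mul_of_nonneg_left Fa (sub_nonneg.2 t1),
      mul_le_mul_of_nonneg_left Fb t0]
  exact (abs_sub _ _).trans ((add_le_add (hB x hx) hc).trans (le_of_eq (by ring)))

theorem HasDerivs.exists_slope {F F₁ F₂ : ℝ → ℝ} (h : HasDerivs F F₁ F₂) {a b : ℝ} (ha : 0 ≤ a)
    (hab : a < b) (hb : b ≤ 1) : ∃ ξ ∈ Ioo a b, F₁ ξ = (F b - F a) / (b - a) :=
  exists_hasDerivAt_eq_slope F F₁ hab (h.continuousOn.mono (Icc_subset_Icc ha hb))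
    fun _ hx => (h.hasDerivAt ⟨ha.trans_lt hx.1, hx.2.trans_le hb⟩).1

theorem HasDerivs.abs_deriv_sub_slope_le {F F₁ F₂ : ℝ → ℝ} (h : HasDerivs F F₁ F₂) {a b K : ℝ}
    (ha : 0 ≤ a) (hab : a < b) (hb : b ≤ 1) (hK : ∀ x ∈ Icc a b, |F₂ x| ≤ K) {x : ℝ}
    (hx : x ∈ Icc a b) : |F₁ x - (F b - F a) / (b - a)| ≤ K * (b - a) := by
  obtain ⟨ξ, hξ, e⟩ := h.exists_slope ha hab hb
  have hsub : Icc a b ⊆ Icc 0 1 := Icc_subset_Icc ha hb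
  have := (convex_Icc a b).norm_image_sub_le_of_norm_hasDerivWithin_le (f := F₁) (f' := F₂)
    (fun y hy => (h y (hsub hy)).2.mono hsub) (fun y hy => hK y hy) (Ioo_subset_Icc_self hξ) hx
  rw [← e]
  refine this.trans (mul_le_mul_of_nonneg_left ?_ ((abs_nonneg _).trans (hK x hx)))
  rw [Real.norm_eq_abs, abs_le]
  constructor <;> linarith [hx.1, hx.2, hξ.1, hξ.2]

theorem HasDerivs.abs_chordErr_le {F F₁ F₂ : ℝ → ℝ} (h : HasDerivs F F₁ F₂) {a b K : ℝ}
    (ha : 0 ≤ a) (hab : a < b) (hb : b ≤ 1) (hK : ∀ x ∈ Icc a b, |F₂ x| ≤ K) {x : ℝ}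
    (hx : x ∈ Icc a b) : |chordErr F a b x| ≤ K * (b - a) ^ 2 := by
  have hsub : Icc a b ⊆ Icc 0 1 := Icc_subset_Icc ha hb
  have hK0 := (abs_nonneg _).trans (hK x hx)
  have := (convex_Icc a b).norm_image_sub_le_of_norm_hasDerivWithin_le
    (f := chordErr F a b) (f' := fun y => F₁ y - (F b - F a) / (b - a) * 1)
    (fun y hy => ((h y (hsub hy)).1.mono hsub).sub
      ((((hasDerivWithinAt_id y _).sub_const a).const_mul _).const_add _))
    (fun y hy => by
      rw [mul_one]; exact h.abs_deriv_sub_slope_le ha hab hb hK hy)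
    (left_mem_Icc.2 hab.le) hx
  have e : chordErr F a b a = 0 := by simp [chordErr]
  rw [e, sub_zero, Real.norm_eq_abs, Real.norm_eq_abs, abs_of_nonneg (sub_nonneg.2 hx.1)] at this
  refine this.trans ?_
  rw [pow_two, ← mul_assoc]
  exact mul_le_mul_of_nonneg_left (by linarith [hx.2])
    (mul_nonneg hK0 (sub_nonneg.2 hab.le))

theorem HasDerivs.intervalIntegrable_sq {F F₁ F₂ : ℝ → ℝ} (h : HasDerivs F F₁ F₂) {a b : ℝ}
    (ha : 0 ≤ a) (hab : a < b) (hb : b ≤ 1) (s : ℝ) :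
    IntervalIntegrable (fun x => (F₁ x - s) ^ 2) volume a b := by
  refine ContinuousOn.intervalIntegrable ?_
  rw [uIcc_of_le hab.le]
  exact ((h.continuousOn'.mono (Icc_subset_Icc ha hb)).sub continuousOn_const).pow 2

/-- The slope of the chord is the mean of `F₁`, and a variance is at most the second moment. -/
theorem HasDerivs.integral_deriv_sub_slope_sq_le {F F₁ F₂ : ℝ → ℝ} (h : HasDerivs F F₁ F₂)
    {a b : ℝ} (ha : 0 ≤ a) (hab : a < b) (hb : b ≤ 1) :
    ∫ x in a..b, (F₁ x - (F b - F a) / (b - a)) ^ 2 ≤ ∫ x in a..b, F₁ x ^ 2 := by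
  set s := (F b - F a) / (b - a) with hs
  have hsub := Icc_subset_Icc ha hb
  have hi : IntervalIntegrable F₁ volume a b := by
    refine ContinuousOn.intervalIntegrable ?_
    rw [uIcc_of_le hab.le]
    exact h.continuousOn'.mono hsub
  have hi2 : IntervalIntegrable (fun x => F₁ x ^ 2) volume a b := by
    simpa using h.intervalIntegrable_sq ha hab hb 0
  have hftc : ∫ x in a..b, F₁ x = F b - F a :=
    intervalIntegral.integral_eq_sub_of_hasDerivAt_of_le hab.le (h.continuousOn.mono hsub)
      (fun x hx => (h.hasDerivAt ⟨ha.trans_lt hx.1, hx.2.trans_le hb⟩).1) hi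
  have hsb : s * (b - a) = F b - F a := div_mul_cancel₀ _ (by linarith)
  have e : ∫ x in a..b, (F₁ x - s) ^ 2 = (∫ x in a..b, F₁ x ^ 2) - s ^ 2 * (b - a) := by
    have e1 : (fun x => (F₁ x - s) ^ 2) = fun x => (F₁ x ^ 2 - 2 * s * F₁ x) + s ^ 2 := by
      funext x; ring
    rw [e1, intervalIntegral.integral_add (hi2.sub (hi.const_mul _))
      (intervalIntegrable_const), intervalIntegral.integral_sub hi2 (hi.const_mul _),
      intervalIntegral.integral_const_mul, hftc, intervalIntegral.integral_const, ← hsb,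
      smul_eq_mul]
    ring
  rw [e]
  have : 0 ≤ s ^ 2 * (b - a) := mul_nonneg (sq_nonneg _) (by linarith)
  linarith

/-- The mesh interval `[a,b]` is fine enough for the layer `e^{-pμx}`, or it lies where this layer
is negligible. -/
def LayerAdapted (p μ D n a b : ℝ) : Prop :=
  ((b - a) * μ * Real.exp (-(p * μ) * a / 2) ≤ D / n ∧ Real.exp (p * μ * (b - a)) ≤ D) ∨
    Real.exp (-(p * μ) * a) ≤ D / n ^ 2

theorem exp_half_sq (y : ℝ) : Real.exp (y / 2) ^ 2 = Real.exp y := by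
  rw [← Real.exp_nat_mul]; congr 1; push_cast; ring

/-- On a fine interval `|F₂| (b-a)²` is at most `K` times the square of `(b-a) μ e^{-pμa/2}`, hence
the half in the exponent of `LayerAdapted`. Otherwise `F` itself is `O(n⁻²)`. -/
theorem IsLayer.abs_chordErr_le {F F₁ F₂ : ℝ → ℝ} {K p μ D n a b : ℝ} (h : IsLayer F F₁ F₂ K p μ)
    (hK : 0 ≤ K) (hp : 0 < p) (hμ : 0 < μ) (hD : 1 ≤ D) (hn : 0 < n) (ha : 0 ≤ a) (hab : a < b)
    (hb : b ≤ 1) (had : LayerAdapted p μ D n a b) {x : ℝ} (hx : x ∈ Icc a b) :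
    |chordErr F a b x| ≤ 2 * K * D ^ 2 / n ^ 2 := by
  have hsub := Icc_subset_Icc ha hb
  have hexp : ∀ y ∈ Icc a b, Real.exp (-(p * μ) * y) ≤ Real.exp (-(p * μ) * a) := fun y hy => by
    rw [Real.exp_le_exp]
    nlinarith [mul_nonneg (mul_pos hp hμ).le (sub_nonneg.2 hy.1)]
  rcases had with ⟨h1, -⟩ | h1
  · have := h.derivs.abs_chordErr_le ha hab hb (K := K * μ ^ 2 * Real.exp (-(p * μ) * a))
      (fun y hy => (h.abs_le₂ y (hsub hy)).trans
        (mul_le_mul_of_nonneg_left (hexp y hy) (by positivity))) hx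
    refine this.trans ?_
    have h0 : 0 ≤ (b - a) * μ * Real.exp (-(p * μ) * a / 2) := by
      have : 0 ≤ b - a := by linarith
      positivity
    have h2 := pow_le_pow_left₀ h0 h1 2
    rw [mul_pow, exp_half_sq, div_pow] at h2
    have h3 := mul_le_mul_of_nonneg_left h2 hK
    have h4 : K * (D ^ 2 / n ^ 2) ≤ 2 * K * D ^ 2 / n ^ 2 := by
      have : 0 ≤ K * (D ^ 2 / n ^ 2) := by positivity
      have e : 2 * K * D ^ 2 / n ^ 2 = 2 * (K * (D ^ 2 / n ^ 2)) := by ring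
      linarith
    refine le_trans (le_of_eq ?_) (h3.trans h4)
    ring
  · have hF : ∀ y ∈ Icc a b, |F y| ≤ K * (D / n ^ 2) := fun y hy =>
      (h.abs_le y (hsub hy)).trans (mul_le_mul_of_nonneg_left ((hexp y hy).trans h1) hK)
    refine (abs_chordErr_le_two_mul hab hF hx).trans ?_
    have h5 : K * (D / n ^ 2) ≤ K * (D ^ 2 / n ^ 2) := by
      refine mul_le_mul_of_nonneg_left (div_le_div_of_nonneg_right ?_ (by positivity)) hK
      nlinarith
    have e : 2 * K * D ^ 2 / n ^ 2 = 2 * (K * (D ^ 2 / n ^ 2)) := by ring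
    linarith

/-- Keeping the exponential under the integral is the point: summed over the mesh it contributes
`1/(pμ)` and removes one power of `μ`. On a fine interval `e^{pμ(b-a)} ≤ D` allows `e^{-pμa}` to be
replaced by `e^{-pμx}`. On the others `F₁²` carries `e^{-2pμx}`, one factor of which is `O(n⁻²)`. -/
theorem IsLayer.integral_deriv_sub_slope_sq_le {F F₁ F₂ : ℝ → ℝ} {K p μ D n a b : ℝ}
    (h : IsLayer F F₁ F₂ K p μ)
    (hK : 0 ≤ K) (hp : 0 < p) (hμ : 0 < μ) (hD : 1 ≤ D) (hn : 0 < n) (ha : 0 ≤ a) (hab : a < b)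
    (hb : b ≤ 1) (had : LayerAdapted p μ D n a b) :
    ∫ x in a..b, (F₁ x - (F b - F a) / (b - a)) ^ 2 ≤
      K ^ 2 * D ^ 3 / n ^ 2 * μ ^ 2 * ∫ x in a..b, Real.exp (-(p * μ) * x) := by
  have hsub := Icc_subset_Icc ha hb
  have hpm := mul_pos hp hμ
  have hexp : ∀ y ∈ Icc a b, Real.exp (-(p * μ) * y) ≤ Real.exp (-(p * μ) * a) := fun y hy => by
    rw [Real.exp_le_exp]
    nlinarith [mul_nonneg hpm.le (sub_nonneg.2 hy.1)]
  have hci : IntervalIntegrable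
      (fun x => K ^ 2 * D ^ 3 / n ^ 2 * μ ^ 2 * Real.exp (-(p * μ) * x)) volume a b :=
    Continuous.intervalIntegrable (by fun_prop) _ _
  rw [← intervalIntegral.integral_const_mul]
  rcases had with ⟨h1, h2⟩ | h1
  · refine intervalIntegral.integral_mono_on hab.le
      (h.derivs.intervalIntegrable_sq ha hab hb _) hci fun x hx => ?_
    have h3 := h.derivs.abs_deriv_sub_slope_le ha hab hb
      (K := K * μ ^ 2 * Real.exp (-(p * μ) * a)) (fun y hy => (h.abs_le₂ y (hsub hy)).trans
        (mul_le_mul_of_nonneg_left (hexp y hy) (by positivity))) hx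
    have hba : 0 ≤ b - a := by linarith
    have h4 : K * μ ^ 2 * Real.exp (-(p * μ) * a) * (b - a) ≤
        K * μ * Real.exp (-(p * μ) * a / 2) * (D / n) := by
      have := mul_le_mul_of_nonneg_left h1
        (show 0 ≤ K * μ * Real.exp (-(p * μ) * a / 2) by positivity)
      refine le_trans (le_of_eq ?_) this
      rw [← exp_half_sq]; ring
    have h5 := pow_le_pow_left₀ (abs_nonneg _) (h3.trans h4) 2
    rw [sq_abs] at h5
    refine h5.trans ?_
    rw [mul_pow, mul_pow, exp_half_sq]
    have h6 : Real.exp (-(p * μ) * a) ≤ D * Real.exp (-(p * μ) * x) := by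
      have : Real.exp (-(p * μ) * a) = Real.exp (p * μ * (x - a)) * Real.exp (-(p * μ) * x) := by
        rw [← Real.exp_add]; congr 1; ring
      rw [this]
      refine mul_le_mul_of_nonneg_right (le_trans ?_ h2) (Real.exp_pos _).le
      rw [Real.exp_le_exp]
      exact mul_le_mul_of_nonneg_left (by linarith [hx.2]) hpm.le
    have h7 := mul_le_mul_of_nonneg_left h6 (show 0 ≤ (K * μ) ^ 2 * (D / n) ^ 2 by positivity)
    refine le_trans (le_of_eq ?_) (h7.trans (le_of_eq ?_))
    · ring
    · field_simp
  · refine (h.derivs.integral_deriv_sub_slope_sq_le ha hab hb).trans ?_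
    have hi2 : IntervalIntegrable (fun x => F₁ x ^ 2) volume a b := by
      simpa using h.derivs.intervalIntegrable_sq ha hab hb 0
    refine intervalIntegral.integral_mono_on hab.le hi2 hci fun x hx => ?_
    have h2 := pow_le_pow_left₀ (abs_nonneg _) (h.abs_le₁ x (hsub hx)) 2
    rw [sq_abs] at h2
    refine h2.trans ?_
    have h3 : Real.exp (-(p * μ) * x) ≤ D ^ 3 / n ^ 2 := by
      refine (hexp x hx).trans (h1.trans (div_le_div_of_nonneg_right ?_ (by positivity)))
      nlinarith [sq_nonneg D, mul_nonneg (zero_le_one.trans hD) (sub_nonneg.2 hD)]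
    have h4 := mul_le_mul_of_nonneg_left h3
      (show 0 ≤ (K * μ) ^ 2 * Real.exp (-(p * μ) * x) by positivity)
    refine le_trans (le_of_eq ?_) (h4.trans (le_of_eq ?_))
    · ring
    · ring

end TwoParam

namespace TwoParam

/-! ### The mesh -/

variable {τ p μ₀ μ₁ μ : ℝ} {m i j N : ℕ}

/-- The argument of the logarithm in the mesh generating function, for `N = 4 m`. -/
def meshArg (μ : ℝ) (m i : ℕ) : ℝ := 1 - (1 - μ⁻¹) * (i / m)

theorem meshPt_left (hm : 0 < m) (hi : i ≤ m) :
    meshPt τ p μ₀ μ₁ (4 * m) i = τ / (p * μ₀) * -Real.log (meshArg μ₀ m i) := by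
  have hm' : (0 : ℝ) < m := by exact_mod_cast hm
  unfold meshPt phi₀ meshArg
  rw [if_pos (by omega)]
  congr 4
  push_cast
  field_simp

/-- The symmetry `x ↦ 1 - x` exchanges the rates and reduces the right layer to the left one. The
indices `m` and `3m` are treated separately, because reflection moves them to a different branch of
`meshPt`; the branches agree there as `-log μ⁻¹ = log μ`. -/
theorem meshPt_reflect (hm : 0 < m) (hi : i ≤ 4 * m) :
    meshPt τ p μ₁ μ₀ (4 * m) (4 * m - i) = 1 - meshPt τ p μ₀ μ₁ (4 * m) i := by
  have hm' : (0 : ℝ) < m := by exact_mod_cast hm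
  have hq : 1 - 4 * (1 - μ₁⁻¹) * (1 / 4) = μ₁⁻¹ := by ring
  have hq0 : 1 - 4 * (1 - μ₀⁻¹) * (1 / 4) = μ₀⁻¹ := by ring
  have hl : (((m : ℕ) : ℝ) / ((4 * m : ℕ) : ℝ)) = 1 / 4 := by push_cast; field_simp
  have hc : ((4 * m - i : ℕ) : ℝ) / ((4 * m : ℕ) : ℝ) = 1 - (i : ℝ) / ((4 * m : ℕ) : ℝ) := by
    rw [Nat.cast_sub hi]; push_cast; field_simp
  unfold meshPt
  rcases lt_trichotomy i m with h | h | h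
  · rw [if_neg (by omega), if_neg (by omega), if_pos (by omega), hc, phi₁, phi₀, sub_sub_cancel]
  · subst h
    rw [if_neg (by omega), if_pos (by omega), if_pos (by omega), hc, hl, phi₀, hq0, sigma, sigma,
      Real.log_inv]
    ring
  · rw [if_neg (c := 4 * i ≤ 4 * m) (by omega)]
    rcases lt_trichotomy i (3 * m) with h3 | h3 | h3
    · rw [if_neg (by omega), if_pos (by omega), if_pos (by omega), hc]
      ring
    · subst h3
      have e : (4 * m - 3 * m : ℕ) = m := by omega
      have hl3 : ((3 * m : ℕ) : ℝ) / ((4 * m : ℕ) : ℝ) = 3 / 4 := by push_cast; field_simp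
      rw [if_pos (by omega), if_pos (by omega), e, hl, hl3, phi₀, hq, sigma, sigma,
        Real.log_inv]
      ring
    · rw [if_pos (by omega), if_neg (by omega), hc, phi₁, phi₀, sub_sub_cancel]

theorem meshArg_succ :
    meshArg μ m i - meshArg μ m (i + 1) = (1 - μ⁻¹) / m := by
  unfold meshArg; push_cast; ring

theorem meshArg_ge (hμ : 1 ≤ μ) (hm : 0 < m) (hi : i ≤ m) : μ⁻¹ ≤ meshArg μ m i := by
  have hm' : (0 : ℝ) < m := by exact_mod_cast hm
  have h1 : μ⁻¹ ≤ 1 := inv_le_one_of_one_le₀ hμ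
  have h2 : (i : ℝ) / m ≤ 1 := by
    rw [div_le_one hm']; exact_mod_cast hi
  unfold meshArg
  nlinarith [mul_nonneg (sub_nonneg.2 h1) (sub_nonneg.2 h2)]

theorem meshArg_le_one (hμ : 1 ≤ μ) : meshArg μ m i ≤ 1 := by
  have h1 : μ⁻¹ ≤ 1 := inv_le_one_of_one_le₀ hμ
  have h2 : (0 : ℝ) ≤ (i : ℝ) / m := by positivity
  unfold meshArg
  nlinarith [mul_nonneg (sub_nonneg.2 h1) h2]

theorem meshArg_pred (hm : 0 < m) :
    meshArg μ m (m - 1) = μ⁻¹ + (1 - μ⁻¹) / m := by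
  have hm' : (0 : ℝ) < m := by exact_mod_cast hm
  unfold meshArg
  rw [Nat.cast_sub (by omega)]
  push_cast
  field_simp
  ring

theorem meshArg_anti (hμ : 1 ≤ μ) (hij : i ≤ j) : meshArg μ m j ≤ meshArg μ m i := by
  have h1 : μ⁻¹ ≤ 1 := inv_le_one_of_one_le₀ hμ
  have : (i : ℝ) / m ≤ (j : ℝ) / m :=
    div_le_div_of_nonneg_right (by exact_mod_cast hij) (by positivity)
  unfold meshArg
  nlinarith [mul_nonneg (sub_nonneg.2 h1) (sub_nonneg.2 this)]

/-- The assumptions on the mesh parameters. -/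
structure MeshParams (τ p μ₀ μ₁ : ℝ) (m : ℕ) : Prop where
  pos : 0 < m
  p_pos : 0 < p
  p_lt : p < 1
  two_le : 2 ≤ τ
  four_le : 5 ≤ 4 * m
  le₀ : (4 * m : ℝ) ≤ μ₀
  le₁ : (4 * m : ℝ) ≤ μ₁
  sigma₀ : sigma τ p μ₀ ≤ 1 / 4
  sigma₁ : sigma τ p μ₁ ≤ 1 / 4

namespace MeshParams

theorem symm (h : MeshParams τ p μ₀ μ₁ m) : MeshParams τ p μ₁ μ₀ m :=
  ⟨h.pos, h.p_pos, h.p_lt, h.two_le, h.four_le, h.le₁, h.le₀, h.sigma₁, h.sigma₀⟩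

theorem m_pos (h : MeshParams τ p μ₀ μ₁ m) : (0 : ℝ) < m := by exact_mod_cast h.pos

theorem one_lt (h : MeshParams τ p μ₀ μ₁ m) : 1 < μ₀ := by
  have : (5 : ℝ) ≤ 4 * m := by exact_mod_cast h.four_le
  linarith [h.le₀]

theorem meshArg_pos (h : MeshParams τ p μ₀ μ₁ m) (hi : i ≤ m) : 0 < meshArg μ₀ m i :=
  (inv_pos.2 (zero_lt_one.trans h.one_lt)).trans_le (meshArg_ge h.one_lt.le h.pos hi)

theorem width_left (h : MeshParams τ p μ₀ μ₁ m) (hi : i < m) :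
    meshPt τ p μ₀ μ₁ (4 * m) (i + 1) - meshPt τ p μ₀ μ₁ (4 * m) i =
      τ / (p * μ₀) * Real.log (meshArg μ₀ m i / meshArg μ₀ m (i + 1)) := by
  rw [meshPt_left h.pos hi.le, meshPt_left h.pos hi,
    Real.log_div (h.meshArg_pos hi.le).ne' (h.meshArg_pos hi).ne']
  ring

theorem log_ratio_le (h : MeshParams τ p μ₀ μ₁ m) (hi : i < m) :
    Real.log (meshArg μ₀ m i / meshArg μ₀ m (i + 1)) ≤ 1 / (m * meshArg μ₀ m (i + 1)) := by
  have hq := h.meshArg_pos hi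
  have hm := h.m_pos
  refine (Real.log_le_sub_one_of_pos (div_pos (h.meshArg_pos hi.le) hq)).trans ?_
  rw [div_sub_one hq.ne', meshArg_succ, div_div]
  refine div_le_div_of_nonneg_right ?_ (by positivity)
  have : 0 < μ₀⁻¹ := inv_pos.2 (zero_lt_one.trans h.one_lt)
  linarith

theorem lt_succ_left (h : MeshParams τ p μ₀ μ₁ m) (hi : i < m) :
    meshPt τ p μ₀ μ₁ (4 * m) i < meshPt τ p μ₀ μ₁ (4 * m) (i + 1) := by
  have hq := h.meshArg_pos hi
  have hμ := zero_lt_one.trans h.one_lt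
  have hp := h.p_pos
  have hτ : 0 < τ := zero_lt_two.trans_le h.two_le
  have hm := h.m_pos
  rw [← sub_pos, h.width_left hi]
  refine mul_pos (by positivity) (Real.log_pos ?_)
  rw [one_lt_div hq, ← sub_pos, meshArg_succ]
  have : μ₀⁻¹ < 1 := inv_lt_one_of_one_lt₀ h.one_lt
  exact div_pos (by linarith) hm

/-- The crude bound `meshArg ≥ μ₀⁻¹` just cancels the factor `1/μ₀` in the width, even on the last
layer interval. -/
theorem width_left_le (h : MeshParams τ p μ₀ μ₁ m) (hi : i < m) :
    meshPt τ p μ₀ μ₁ (4 * m) (i + 1) - meshPt τ p μ₀ μ₁ (4 * m) i ≤ 4 * τ / p / (4 * m) := by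
  have hq := meshArg_ge h.one_lt.le h.pos hi
  have hμ := zero_lt_one.trans h.one_lt
  have hp := h.p_pos
  have hτ : 0 < τ := zero_lt_two.trans_le h.two_le
  have hm := h.m_pos
  rw [h.width_left hi]
  have h1 : 1 / (m * meshArg μ₀ m (i + 1)) ≤ 1 / (m * μ₀⁻¹) :=
    one_div_le_one_div_of_le (by positivity) (mul_le_mul_of_nonneg_left hq hm.le)
  refine (mul_le_mul_of_nonneg_left ((h.log_ratio_le hi).trans h1) (by positivity)).trans
    (le_of_eq ?_)
  field_simp

theorem sigma_pos (h : MeshParams τ p μ₀ μ₁ m) : 0 < sigma τ p μ₀ := by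
  have hμ := zero_lt_one.trans h.one_lt
  have hp := h.p_pos
  have hτ : 0 < τ := zero_lt_two.trans_le h.two_le
  exact mul_pos (by positivity) (Real.log_pos h.one_lt)

theorem meshPt_mid (h : MeshParams τ p μ₀ μ₁ m) (h1 : m ≤ i) (h2 : i ≤ 3 * m) :
    meshPt τ p μ₀ μ₁ (4 * m) i = sigma τ p μ₀ +
      2 * ((i : ℝ) / (4 * m) - 1 / 4) * (1 - sigma τ p μ₀ - sigma τ p μ₁) := by
  have hm := h.m_pos
  rcases h1.eq_or_lt with rfl | h1
  · rw [meshPt_left h.pos le_rfl]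
    have e : meshArg μ₀ m m = μ₀⁻¹ := by unfold meshArg; field_simp; ring
    have e2 : (m : ℝ) / (4 * m) = 1 / 4 := by field_simp
    rw [e, e2, sigma, Real.log_inv]; ring
  · unfold meshPt
    rw [if_neg (by omega), if_pos (by omega)]
    push_cast; ring

theorem width_mid (h : MeshParams τ p μ₀ μ₁ m) (h1 : m ≤ i) (h2 : i < 3 * m) :
    meshPt τ p μ₀ μ₁ (4 * m) (i + 1) - meshPt τ p μ₀ μ₁ (4 * m) i =
      2 * (1 - sigma τ p μ₀ - sigma τ p μ₁) / (4 * m) := by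
  have hm := h.m_pos
  rw [h.meshPt_mid h1 h2.le, h.meshPt_mid (i := i + 1) (by omega) h2]
  push_cast; field_simp; ring

theorem reflect_step (h : MeshParams τ p μ₀ μ₁ m) (hi : i < 4 * m) :
    meshPt τ p μ₀ μ₁ (4 * m) i = 1 - meshPt τ p μ₁ μ₀ (4 * m) (4 * m - 1 - i + 1) ∧
    meshPt τ p μ₀ μ₁ (4 * m) (i + 1) = 1 - meshPt τ p μ₁ μ₀ (4 * m) (4 * m - 1 - i) := by
  have e1 := meshPt_reflect (τ := τ) (p := p) (μ₀ := μ₀) (μ₁ := μ₁) h.pos hi.le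
  have e2 := meshPt_reflect (τ := τ) (p := p) (μ₀ := μ₀) (μ₁ := μ₁) (i := i + 1) h.pos hi
  have e3 : 4 * m - 1 - i + 1 = 4 * m - i := by omega
  have e4 : 4 * m - 1 - i = 4 * m - (i + 1) := by omega
  rw [e3, e4, e1, e2]
  constructor <;> ring

theorem lt_succ (h : MeshParams τ p μ₀ μ₁ m) (hi : i < 4 * m) :
    meshPt τ p μ₀ μ₁ (4 * m) i < meshPt τ p μ₀ μ₁ (4 * m) (i + 1) := by
  rcases lt_or_ge i m with h1 | h1
  · exact h.lt_succ_left h1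
  rcases lt_or_ge i (3 * m) with h2 | h2
  · rw [← sub_pos, h.width_mid h1 h2]
    have := h.m_pos
    have := h.sigma₀
    have := h.sigma₁
    exact div_pos (by linarith) (by linarith)
  · obtain ⟨e1, e2⟩ := h.reflect_step hi
    rw [e1, e2]
    have := h.symm.lt_succ_left (i := 4 * m - 1 - i) (by omega)
    linarith

theorem width_le (h : MeshParams τ p μ₀ μ₁ m) (hi : i < 4 * m) :
    meshPt τ p μ₀ μ₁ (4 * m) (i + 1) - meshPt τ p μ₀ μ₁ (4 * m) i ≤ 4 * τ / p / (4 * m) := by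
  rcases lt_or_ge i m with h1 | h1
  · exact h.width_left_le h1
  rcases lt_or_ge i (3 * m) with h2 | h2
  · rw [h.width_mid h1 h2]
    have := h.m_pos
    have := h.sigma_pos
    have := h.symm.sigma_pos
    refine div_le_div_of_nonneg_right ?_ (by linarith)
    rw [le_div_iff₀ h.p_pos]
    nlinarith [h.p_pos, h.p_lt, h.two_le]
  · obtain ⟨e1, e2⟩ := h.reflect_step hi
    rw [e1, e2]
    have := h.symm.width_left_le (i := 4 * m - 1 - i) (by omega)
    linarith

theorem meshPt_zero (h : MeshParams τ p μ₀ μ₁ m) : meshPt τ p μ₀ μ₁ (4 * m) 0 = 0 := by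
  rw [meshPt_left h.pos (Nat.zero_le _)]
  simp [meshArg]

theorem meshPt_last (h : MeshParams τ p μ₀ μ₁ m) : meshPt τ p μ₀ μ₁ (4 * m) (4 * m) = 1 := by
  have := meshPt_reflect (τ := τ) (p := p) (μ₀ := μ₀) (μ₁ := μ₁) h.pos (le_refl (4 * m))
  rw [Nat.sub_self, h.symm.meshPt_zero] at this
  linarith

theorem monotone (h : MeshParams τ p μ₀ μ₁ m) (hij : i ≤ j) (hj : j ≤ 4 * m) :
    meshPt τ p μ₀ μ₁ (4 * m) i ≤ meshPt τ p μ₀ μ₁ (4 * m) j := by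
  induction j, hij using Nat.le_induction with
  | base => exact le_rfl
  | succ k hk ih => exact (ih (by omega)).trans (h.lt_succ (by omega)).le

/-- The mesh inverts the layer: `e^{-pμ₀xᵢ}` is the `τ`-th power of `meshArg`. The uses are `s =
1/2` and `s = 1`. -/
theorem exp_meshPt (h : MeshParams τ p μ₀ μ₁ m) (hi : i ≤ m) (s : ℝ) :
    Real.exp (-(p * μ₀) * meshPt τ p μ₀ μ₁ (4 * m) i * s) =
      Real.exp (τ * s * Real.log (meshArg μ₀ m i)) := by
  have hμ := zero_lt_one.trans h.one_lt
  have hp := h.p_pos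
  rw [meshPt_left h.pos hi]
  congr 1
  field_simp

/-- The constant in the mesh conditions. -/
def const (τ p : ℝ) : ℝ := 8 * τ / p + Real.exp (τ * Real.log 2) + 25

/-- For `i + 1 < m` consecutive values of `meshArg` have ratio at most `2`. Thus the width times
`μ₀` is `O(1 / (m meshArg))`, and `e^{-pμ₀xᵢ/2} = meshArg^{τ/2} ≤ meshArg` compensates because `τ ≥
2`. On the last layer interval the ratio is no longer controlled, so from `i = m - 1` on the
intervals count as lying outside the layer: there `meshArg ≤ 5/N`, using `μ₀ ≥ N`, and the
exponential is at most `25/N²`. -/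
theorem adapted (h : MeshParams τ p μ₀ μ₁ m) (hi : i < 4 * m) :
    LayerAdapted p μ₀ (const τ p) (4 * m) (meshPt τ p μ₀ μ₁ (4 * m) i)
      (meshPt τ p μ₀ μ₁ (4 * m) (i + 1)) := by
  have hμ := zero_lt_one.trans h.one_lt
  have hp := h.p_pos
  have hm := h.m_pos
  have hτ : 0 < τ := zero_lt_two.trans_le h.two_le
  have hμi : μ₀⁻¹ ≤ 1 := inv_le_one_of_one_le₀ h.one_lt.le
  have hμi0 : 0 < μ₀⁻¹ := inv_pos.2 hμ
  have c1 : 0 < 8 * τ / p := by positivity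
  have c2 := Real.exp_pos (τ * Real.log 2)
  rcases Nat.lt_or_ge (i + 1) m with h1 | h1
  · left
    have hi1 : i < m := by omega
    have hq := h.meshArg_pos hi1.le
    have hq1 := h.meshArg_pos h1.le
    have hle := meshArg_le_one (m := m) (i := i) h.one_lt.le
    have hlog : Real.log (meshArg μ₀ m i) ≤ 0 := Real.log_nonpos hq.le hle
    have hge : (1 - μ₀⁻¹) / m ≤ meshArg μ₀ m (i + 1) := by
      have := meshArg_anti (m := m) h.one_lt.le (show i + 1 ≤ m - 1 by omega)
      rw [meshArg_pred h.pos] at this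
      linarith
    have hdouble : meshArg μ₀ m i ≤ 2 * meshArg μ₀ m (i + 1) := by
      have := meshArg_succ (μ := μ₀) (m := m) (i := i)
      linarith
    constructor
    · have e1 : Real.exp (-(p * μ₀) * meshPt τ p μ₀ μ₁ (4 * m) i / 2) ≤ meshArg μ₀ m i := by
        rw [div_eq_mul_inv, h.exp_meshPt hi1.le, ← Real.le_log_iff_exp_le hq]
        nlinarith [h.two_le]
      have e2 : (meshPt τ p μ₀ μ₁ (4 * m) (i + 1) - meshPt τ p μ₀ μ₁ (4 * m) i) * μ₀ ≤
          τ / p * (1 / (m * meshArg μ₀ m (i + 1))) := by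
        rw [h.width_left hi1]
        have := mul_le_mul_of_nonneg_left (h.log_ratio_le hi1) (div_pos hτ hp).le
        refine le_trans (le_of_eq ?_) this
        field_simp
      have e3 := mul_le_mul e2 e1 (Real.exp_pos _).le (by positivity)
      refine e3.trans ?_
      have e4 : τ / p * (1 / (m * meshArg μ₀ m (i + 1))) * meshArg μ₀ m i ≤
          8 * τ / p / (4 * m) := by
        have : τ / p * (1 / (m * meshArg μ₀ m (i + 1))) * meshArg μ₀ m i =
          τ / p / m * (meshArg μ₀ m i / meshArg μ₀ m (i + 1)) := by field_simp
        have h2 : meshArg μ₀ m i / meshArg μ₀ m (i + 1) ≤ 2 := by rwa [div_le_iff₀ hq1]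
        rw [this]
        refine (mul_le_mul_of_nonneg_left h2 (by positivity)).trans (le_of_eq ?_)
        field_simp; ring
      refine e4.trans (div_le_div_of_nonneg_right ?_ (by positivity))
      unfold const; linarith
    · have e : p * μ₀ * (meshPt τ p μ₀ μ₁ (4 * m) (i + 1) - meshPt τ p μ₀ μ₁ (4 * m) i) =
          τ * Real.log (meshArg μ₀ m i / meshArg μ₀ m (i + 1)) := by
        rw [h.width_left hi1]; field_simp
      have : Real.exp (τ * Real.log (meshArg μ₀ m i / meshArg μ₀ m (i + 1))) ≤
          Real.exp (τ * Real.log 2) := by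
        rw [Real.exp_le_exp]
        refine mul_le_mul_of_nonneg_left (Real.log_le_log (div_pos hq hq1) ?_) hτ.le
        rwa [div_le_iff₀ hq1]
      rw [e]
      unfold const; linarith
  · right
    have hpos := h.pos
    have hq := h.meshArg_pos (i := m - 1) (by omega)
    have hle := meshArg_le_one (m := m) (i := m - 1) h.one_lt.le
    have hlog : Real.log (meshArg μ₀ m (m - 1)) ≤ 0 := Real.log_nonpos hq.le hle
    have h2 := h.monotone (i := m - 1) (j := i) (by omega) hi.le
    have h3 : Real.exp (-(p * μ₀) * meshPt τ p μ₀ μ₁ (4 * m) i) ≤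
        Real.exp (-(p * μ₀) * meshPt τ p μ₀ μ₁ (4 * m) (m - 1) * 1) := by
      rw [Real.exp_le_exp]
      nlinarith [mul_pos hp hμ]
    rw [h.exp_meshPt (by omega)] at h3
    have h4 : Real.exp (τ * 1 * Real.log (meshArg μ₀ m (m - 1))) ≤ meshArg μ₀ m (m - 1) ^ 2 := by
      rw [← Real.le_log_iff_exp_le (by positivity), Real.log_pow]
      push_cast
      nlinarith [h.two_le]
    have h5 : meshArg μ₀ m (m - 1) ≤ 5 / (4 * m) := by
      rw [meshArg_pred h.pos]
      have a1 : μ₀⁻¹ ≤ 1 / (4 * m) := by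
        rw [inv_eq_one_div]
        exact one_div_le_one_div_of_le (by positivity) h.le₀
      have a2 : (1 - μ₀⁻¹) / m ≤ 1 / m := div_le_div_of_nonneg_right (by linarith) hm.le
      refine (add_le_add a1 a2).trans (le_of_eq ?_)
      field_simp; norm_num
    refine h3.trans (h4.trans ((pow_le_pow_left₀ hq.le h5 2).trans ?_))
    rw [div_pow]
    refine div_le_div_of_nonneg_right ?_ (by positivity)
    unfold const; linarith

theorem adapted_reflect (h : MeshParams τ p μ₀ μ₁ m) (hi : i < 4 * m) :
    LayerAdapted p μ₁ (const τ p) (4 * m) (1 - meshPt τ p μ₀ μ₁ (4 * m) (i + 1))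
      (1 - meshPt τ p μ₀ μ₁ (4 * m) i) := by
  obtain ⟨e1, e2⟩ := h.reflect_step hi
  rw [e1, e2, sub_sub_cancel, sub_sub_cancel]
  exact h.symm.adapted (by omega)

theorem one_le_const (h : MeshParams τ p μ₀ μ₁ m) : 1 ≤ const τ p := by
  have hp := h.p_pos
  have hτ : 0 < τ := zero_lt_two.trans_le h.two_le
  have := Real.exp_pos (τ * Real.log 2)
  have : 0 < 8 * τ / p := by positivity
  unfold const; linarith

end MeshParams

end TwoParam

namespace TwoParam

/-! ### Piecewise linear interpolation -/

/-- `X 0 < X 1 < ⋯ < X N` is a mesh on `[0,1]`. -/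
structure IsMesh (X : ℕ → ℝ) (N : ℕ) : Prop where
  zero : X 0 = 0
  last : X N = 1
  lt_succ : ∀ i < N, X i < X (i + 1)

variable {X : ℕ → ℝ} {N i j k : ℕ}

theorem IsMesh.mono (h : IsMesh X N) (hij : i ≤ j) (hj : j ≤ N) : X i ≤ X j := by
  induction j, hij using Nat.le_induction with
  | base => exact le_rfl
  | succ k hk ih => exact (ih (by omega)).trans (h.lt_succ k (by omega)).le

theorem IsMesh.nonneg (h : IsMesh X N) (hi : i ≤ N) : 0 ≤ X i := by
  rw [← h.zero]; exact h.mono (Nat.zero_le _) hi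

theorem IsMesh.le_one (h : IsMesh X N) (hi : i ≤ N) : X i ≤ 1 := by
  rw [← h.last]; exact h.mono hi le_rfl

theorem IsMesh.exists_mem (h : IsMesh X N) {x : ℝ} (hx : x ∈ Icc (0 : ℝ) 1) :
    ∃ j < N, x ∈ Icc (X j) (X (j + 1)) := by
  have key : ∀ k ≤ N, x ≤ X k → 0 < k → ∃ j < N, x ∈ Icc (X j) (X (j + 1)) := by
    intro k
    induction k with
    | zero => intro _ _ h0; omega
    | succ k ih =>
      intro hk hxk _
      rcases le_or_gt (X k) x with h1 | h1
      · exact ⟨k, by omega, h1, hxk⟩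
      · rcases Nat.eq_zero_or_pos k with rfl | hk0
        · rw [h.zero] at h1; exact absurd hx.1 (not_le.2 h1)
        · exact ih (by omega) h1.le hk0
  refine key N le_rfl (by rw [h.last]; exact hx.2) ?_
  rcases Nat.eq_zero_or_pos N with h0 | h0
  · have h1 := h.last
    rw [h0, h.zero] at h1
    exact absurd h1 zero_ne_one
  · exact h0

theorem IsMesh.lagrange_eq (h : IsMesh X N) (v : ℝ → ℝ) (hj : j < N) {x : ℝ}
    (hx : x ∈ Icc (X j) (X (j + 1))) :
    lagrange X N v x = v (X j) + (v (X (j + 1)) - v (X j)) / (X (j + 1) - X j) * (x - X j) := by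
  have hlt := h.lt_succ j hj
  have hne : X (j + 1) - X j ≠ 0 := by linarith
  have h1 : hat X N (j + 1) x = (x - X j) / (X (j + 1) - X j) := by
    unfold hat
    rw [if_pos ⟨by omega, by simpa using hx.1, hx.2⟩, Nat.add_sub_cancel]
  have h0 : hat X N j x = (X (j + 1) - x) / (X (j + 1) - X j) := by
    unfold hat
    split_ifs with c1 c2
    -- At the node itself the first branch of `hat` takes precedence; both branches give `1`.
    · have hxe : x = X j := le_antisymm c1.2.2 hx.1
      have hlt' := h.lt_succ (j - 1) (by omega)
      rw [Nat.sub_add_cancel c1.1] at hlt'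
      rw [hxe, div_self hne, div_self (by linarith)]
    · rfl
    · exact absurd ⟨hj, hx.1, hx.2⟩ c2
  have hz : ∀ i ∈ Finset.range (N + 1), i ≠ j ∧ i ≠ j + 1 → v (X i) * hat X N i x = 0 := by
    intro i hi hij
    have hiN : i ≤ N := Nat.lt_succ_iff.1 (Finset.mem_range.1 hi)
    have : hat X N i x = 0 := by
      unfold hat
      split_ifs with c1 c2
      · rcases lt_or_ge i j with hlt2 | hge
        · have a1 := h.mono (i := i + 1) (j := j) hlt2 hj.le
          have a2 := h.lt_succ i (by omega)
          linarith [c1.2.2, hx.1]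
        · have a1 := h.mono (i := j + 1) (j := i - 1) (by omega) (by omega)
          have : x = X (i - 1) := le_antisymm (hx.2.trans a1) c1.2.1
          rw [← this, sub_self, zero_div]
      · rcases lt_or_ge i j with hlt2 | hge
        · have a1 := h.mono (i := i + 1) (j := j) hlt2 hj.le
          have : x = X (i + 1) := le_antisymm c2.2.2 (a1.trans hx.1)
          rw [← this, sub_self, zero_div]
        · have a1 := h.mono (i := j + 2) (j := i) (by omega) (by omega)
          have a2 := h.lt_succ (j + 1) (by omega)
          linarith [c2.2.1, hx.2]
      · rfl
    rw [this, mul_zero]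
  unfold lagrange
  rw [Finset.sum_eq_add j (j + 1) (by omega) hz
    (fun hn => absurd (Finset.mem_range.2 (by omega)) hn)
    (fun hn => absurd (Finset.mem_range.2 (by omega)) hn), h0, h1]
  field_simp
  ring

theorem IsMesh.err_eq (h : IsMesh X N) (v : ℝ → ℝ) (hj : j < N) {x : ℝ}
    (hx : x ∈ Icc (X j) (X (j + 1))) :
    (v - lagrange X N v) x = chordErr v (X j) (X (j + 1)) x := by
  rw [Pi.sub_apply, h.lagrange_eq v hj hx, chordErr]

theorem IsMesh.continuousOn_err (h : IsMesh X N) {v : ℝ → ℝ} (hv : ContinuousOn v (Icc 0 1)) :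
    ContinuousOn (v - lagrange X N v) (Icc 0 1) := by
  have key : ∀ k ≤ N, ContinuousOn (v - lagrange X N v) (Icc 0 (X k)) := by
    intro k
    induction k with
    | zero => intro _; rw [h.zero, Icc_self]; exact continuousOn_singleton _ _
    | succ k ih =>
      intro hk
      rw [← Icc_union_Icc_eq_Icc (h.nonneg (i := k) (by omega)) (h.lt_succ k hk).le]
      refine (ih (by omega)).union_of_isClosed ?_ isClosed_Icc isClosed_Icc
      have : ContinuousOn (chordErr v (X k) (X (k + 1))) (Icc (X k) (X (k + 1))) := by
        refine (hv.mono (Icc_subset_Icc (h.nonneg (by omega)) (h.le_one hk))).sub ?_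
        fun_prop
      exact this.congr fun x hx => h.err_eq v hk hx
  have := key N le_rfl
  rwa [h.last] at this

variable {u u₁ u₂ : ℝ → ℝ}

theorem IsMesh.deriv_err (h : IsMesh X N) (hu : HasDerivs u u₁ u₂) (hj : j < N) {x : ℝ}
    (hx : x ∈ Ioo (X j) (X (j + 1))) : HasDerivAt (u - lagrange X N u)
      (u₁ x - (u (X (j + 1)) - u (X j)) / (X (j + 1) - X j)) x := by
  have h1 := (hu.hasDerivAt ⟨(h.nonneg (i := j) hj.le).trans_lt hx.1,
    hx.2.trans_le (h.le_one (i := j + 1) hj)⟩).1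
  have h2 : HasDerivAt (chordErr u (X j) (X (j + 1)))
      (u₁ x - (u (X (j + 1)) - u (X j)) / (X (j + 1) - X j) * 1) x :=
    h1.sub ((((hasDerivAt_id x).sub_const (X j)).const_mul _).const_add _)
  rw [mul_one] at h2
  refine h2.congr_of_eventuallyEq ?_
  filter_upwards [Icc_mem_nhds hx.1 hx.2] with y hy using h.err_eq u hj hy

theorem intervalIntegrable_congr_Ioo {g g' : ℝ → ℝ} {a b : ℝ} (hab : a ≤ b)
    (he : ∀ x ∈ Ioo a b, g x = g' x) (hg : IntervalIntegrable g volume a b) :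
    IntervalIntegrable g' volume a b := by
  rw [intervalIntegrable_iff_integrableOn_Ioo_of_le hab] at hg ⊢
  exact hg.congr_fun he measurableSet_Ioo

theorem integral_congr_Ioo {g g' : ℝ → ℝ} {a b : ℝ} (hab : a ≤ b)
    (he : ∀ x ∈ Ioo a b, g x = g' x) : ∫ x in a..b, g x = ∫ x in a..b, g' x := by
  rw [intervalIntegral.integral_of_le hab, intervalIntegral.integral_of_le hab,
    integral_Ioc_eq_integral_Ioo, integral_Ioc_eq_integral_Ioo]
  exact setIntegral_congr_fun measurableSet_Ioo he

theorem IsMesh.exists_mem_Ioo (h : IsMesh X N) {x : ℝ} (hx : x ∈ Icc (0 : ℝ) 1)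
    (hn : x ∉ range X) : ∃ j < N, x ∈ Ioo (X j) (X (j + 1)) := by
  obtain ⟨j, hj, hx1, hx2⟩ := h.exists_mem hx
  exact ⟨j, hj, lt_of_le_of_ne hx1 fun e => hn ⟨j, e⟩,
    lt_of_le_of_ne hx2 fun e => hn ⟨j + 1, e.symm⟩⟩

/-- The interpolation error belongs to `H¹(0,1)`, with a piecewise weak derivative. -/
theorem IsMesh.err_memH1 (h : IsMesh X N) (hu : HasDerivs u u₁ u₂) :
    MemH1 (u - lagrange X N u) ∧ ∫ x, weakDeriv (u - lagrange X N u) x ^ 2 ∂vol =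
      ∑ j ∈ Finset.range N, ∫ x in X j..X (j + 1),
        (u₁ x - (u (X (j + 1)) - u (X j)) / (X (j + 1) - X j)) ^ 2 := by
  set e := u - lagrange X N u with he
  set w := deriv e with hw
  have hec : ContinuousOn e (Icc 0 1) := h.continuousOn_err hu.continuousOn
  have hwe : ∀ j < N, ∀ x ∈ Ioo (X j) (X (j + 1)),
      w x = u₁ x - (u (X (j + 1)) - u (X j)) / (X (j + 1) - X j) := fun j hj x hx =>
    (h.deriv_err hu hj hx).deriv
  have hu1 : ∀ j < N, ContinuousOn u₁ (uIcc (X j) (X (j + 1))) := fun j hj => by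
    rw [uIcc_of_le (h.lt_succ j hj).le]
    exact hu.continuousOn'.mono (Icc_subset_Icc (h.nonneg hj.le) (h.le_one hj))
  have hwi : IntervalIntegrable w volume 0 1 := by
    have := IntervalIntegrable.trans_iterate (f := w) (μ := volume) (a := X) (n := N)
      fun j hj => intervalIntegrable_congr_Ioo (h.lt_succ j hj).le
        (fun x hx => (hwe j hj x hx).symm)
        (((hu1 j hj).sub continuousOn_const).intervalIntegrable)
    rwa [h.zero, h.last] at this
  have hw2 : ∀ j < N, IntervalIntegrable (fun x => w x ^ 2) volume (X j) (X (j + 1)) :=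
    fun j hj => intervalIntegrable_congr_Ioo (h.lt_succ j hj).le
        (fun x hx => by rw [hwe j hj x hx])
        (hu.intervalIntegrable_sq (h.nonneg hj.le) (h.lt_succ j hj) (h.le_one hj)
          ((u (X (j + 1)) - u (X j)) / (X (j + 1) - X j)))
  have hw2i : IntervalIntegrable (fun x => w x ^ 2) volume 0 1 := by
    have := IntervalIntegrable.trans_iterate hw2
    rwa [h.zero, h.last] at this
  -- The error is continuous and differentiable off the mesh points, and the fundamental theorem
  -- tolerates a countable exceptional set. The value of `deriv` at the nodes is irrelevant.
  have hwd : HasWeakDeriv e w := by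
    refine hasWeakDeriv_primitive (k := e 0) (integrable_vol_iff.2 hwi) fun x hx => ?_
    rw [integral_eq_of_hasDerivAt_off_countable_of_le e w hx.1.le (countable_range X)
      (hec.mono (Icc_subset_Icc le_rfl hx.2.le)) (fun y hy => ?_)
      (hwi.mono_set (by
        rw [uIcc_of_le hx.1.le, uIcc_of_le zero_le_one]
        exact Icc_subset_Icc le_rfl hx.2.le))]
    · ring
    · obtain ⟨j, hj, hyj⟩ := h.exists_mem_Ioo ⟨hy.1.1.le, hy.1.2.le.trans hx.2.le⟩ hy.2
      exact (h.deriv_err hu hj hyj).differentiableAt.hasDerivAt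
  refine ⟨⟨memLp_two_of_continuousOn hec, w, ?_, hwd⟩, ?_⟩
  · rw [memLp_two_iff_integrable_sq (integrable_vol_iff.2 hwi).aestronglyMeasurable]
    exact integrable_vol_iff.2 hw2i
  · have e1 : ∫ x, weakDeriv e x ^ 2 ∂vol = ∫ x in (0 : ℝ)..1, w x ^ 2 := by
      rw [← integral_vol]
      exact integral_congr_ae ((weakDeriv_ae_eq hwd).mono fun x hx => by simp only [hx])
    have e2 := intervalIntegral.sum_integral_adjacent_intervals hw2
    rw [h.zero, h.last] at e2
    rw [e1, ← e2]
    refine Finset.sum_congr rfl fun j hj => integral_congr_Ioo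
      (h.lt_succ j (Finset.mem_range.1 hj)).le fun x hx => ?_
    rw [hwe j (Finset.mem_range.1 hj) x hx]

theorem energyNorm_le {ε A B : ℝ} {v : ℝ → ℝ} (hε : 0 ≤ ε) (hB : 0 ≤ B)
    (hA : ε * ∫ x, weakDeriv v x ^ 2 ∂vol ≤ A) (hv : ∀ x ∈ Icc (0 : ℝ) 1, |v x| ≤ B) :
    energyNorm ε v ≤ √A + B := by
  have hA0 : 0 ≤ A := le_trans (mul_nonneg hε (integral_nonneg fun x => sq_nonneg _)) hA
  have h2 : ∫ x, v x ^ 2 ∂vol ≤ B ^ 2 := by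
    have h3 : ‖∫ x in (0 : ℝ)..1, v x ^ 2‖ ≤ B ^ 2 * |(1 : ℝ) - 0| := by
      refine intervalIntegral.norm_integral_le_of_norm_le_const fun x hx => ?_
      rw [uIoc_of_le zero_le_one] at hx
      rw [norm_pow, Real.norm_eq_abs]
      exact pow_le_pow_left₀ (abs_nonneg _) (hv x ⟨hx.1.le, hx.2⟩) 2
    rw [integral_vol]
    refine (le_abs_self _).trans (h3.trans (by simp))
  unfold energyNorm
  rw [Real.sqrt_le_left (by positivity)]
  have hs := Real.sq_sqrt hA0
  have h0 := Real.sqrt_nonneg A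
  nlinarith [mul_nonneg h0 hB]

end TwoParam

namespace TwoParam

/-! ### The layer rates -/

theorem exists_bounds_of_contDiffOn {g : ℝ → ℝ} (hg : ContDiffOn ℝ 2 g (Icc 0 1)) :
    ∃ (g₂ : ℝ → ℝ) (M : ℝ), HasDerivs g (derivWithin g (Icc 0 1)) g₂ ∧
      ∀ x ∈ Icc (0 : ℝ) 1, |g x| ≤ M ∧ |derivWithin g (Icc 0 1) x| ≤ M ∧ |g₂ x| ≤ M := by
  have hU : UniqueDiffOn ℝ (Icc (0 : ℝ) 1) := uniqueDiffOn_Icc zero_lt_one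
  set g₁ := derivWithin g (Icc 0 1) with hg₁
  have h1 : ContDiffOn ℝ 1 g₁ (Icc 0 1) := hg.derivWithin hU (by norm_num)
  set g₂ := derivWithin g₁ (Icc 0 1) with hg₂
  have h2 : ContDiffOn ℝ 0 g₂ (Icc 0 1) := h1.derivWithin hU (by norm_num)
  obtain ⟨A, hA⟩ := isCompact_Icc.exists_bound_of_continuousOn hg.continuousOn
  obtain ⟨B, hB⟩ := isCompact_Icc.exists_bound_of_continuousOn h1.continuousOn
  obtain ⟨C, hC⟩ := isCompact_Icc.exists_bound_of_continuousOn h2.continuousOn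
  refine ⟨g₂, max A (max B C), fun x hx => ⟨?_, ?_⟩, fun x hx => ⟨?_, ?_, ?_⟩⟩
  · exact (hg.differentiableOn (by norm_num) x hx).hasDerivWithinAt
  · exact (h1.differentiableOn (by norm_num) x hx).hasDerivWithinAt
  · exact (hA x hx).trans (le_max_left _ _)
  · exact (hB x hx).trans ((le_max_left _ _).trans (le_max_right _ _))
  · exact (hC x hx).trans ((le_max_right _ _).trans (le_max_right _ _))

theorem g₀_eqn {ε₁ ε₂ : ℝ} {b c : ℝ → ℝ} {x : ℝ} (hε : 0 < ε₁) (hc : 0 < c x) :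
    ε₁ * g₀ ε₁ ε₂ b c x ^ 2 - ε₂ * b x * g₀ ε₁ ε₂ b c x = c x ∧ g₀ ε₁ ε₂ b c x < 0 := by
  have h0 : 0 ≤ (ε₂ * b x) ^ 2 + 4 * ε₁ * c x := by positivity
  have hs := Real.sq_sqrt h0
  constructor
  · unfold g₀
    generalize √((ε₂ * b x) ^ 2 + 4 * ε₁ * c x) = s at hs ⊢
    field_simp
    linarith
  · unfold g₀
    refine div_neg_of_neg_of_pos ?_ (by linarith)
    rw [sub_neg]
    refine Real.lt_sqrt_of_sq_lt ?_
    have : 0 < 4 * ε₁ * c x := by positivity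
    linarith

theorem g₁_eqn {ε₁ ε₂ : ℝ} {b c : ℝ → ℝ} {x : ℝ} (hε : 0 < ε₁) (hε₂ : 0 < ε₂) (hb : 0 < b x)
    (hc : 0 < c x) :
    ε₁ * g₁ ε₁ ε₂ b c x ^ 2 - ε₂ * b x * g₁ ε₁ ε₂ b c x = c x ∧ 0 < g₁ ε₁ ε₂ b c x := by
  have h0 : 0 ≤ (ε₂ * b x) ^ 2 + 4 * ε₁ * c x := by positivity
  have hs := Real.sq_sqrt h0
  constructor
  · unfold g₁
    generalize √((ε₂ * b x) ^ 2 + 4 * ε₁ * c x) = s at hs ⊢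
    field_simp
    linarith
  · unfold g₁
    have := Real.sqrt_nonneg ((ε₂ * b x) ^ 2 + 4 * ε₁ * c x)
    positivity

/-- The extrema are attained, so `-μ₀` and `μ₁` solve the characteristic equation at some points `y`
and `z`. The inequalities at other points follow from monotonicity of the quadratic, and evaluating
the one for `μ₀` at `z` gives `ε₁μ₀² ≤ c z ≤ ε₁μ₁²`. -/
theorem layerRates {lam β M ε₁ ε₂ : ℝ} {b c : ℝ → ℝ} (hlam : 0 < lam) (hβ : 0 < β)
    (hε₁ : 0 < ε₁) (hε₂ : 0 < ε₂)
    (hb : ContinuousOn b (Icc 0 1)) (hc : ContinuousOn c (Icc 0 1))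
    (hbl : ∀ x ∈ Icc (0 : ℝ) 1, lam ≤ b x) (hcβ : ∀ x ∈ Icc (0 : ℝ) 1, β ≤ c x)
    (hbM : ∀ x ∈ Icc (0 : ℝ) 1, |b x| ≤ M) :
    LayerRates ε₁ ε₂ lam β M b c (mu₀ ε₁ ε₂ b c) (mu₁ ε₁ ε₂ b c) := by
  have hne : (Icc (0 : ℝ) 1).Nonempty := nonempty_Icc.2 zero_le_one
  have hg₀ : ContinuousOn (g₀ ε₁ ε₂ b c) (Icc 0 1) := by
    unfold g₀
    exact ((continuousOn_const.mul hb).sub (((continuousOn_const.mul hb).pow 2).add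
      (continuousOn_const.mul hc)).sqrt).div_const _
  have hg₁ : ContinuousOn (g₁ ε₁ ε₂ b c) (Icc 0 1) := by
    unfold g₁
    exact ((continuousOn_const.mul hb).add (((continuousOn_const.mul hb).pow 2).add
      (continuousOn_const.mul hc)).sqrt).div_const _
  obtain ⟨y, hy, hys, hymax⟩ := isCompact_Icc.exists_sSup_image_eq_and_ge hne hg₀
  obtain ⟨z, hz, hzs, hzmin⟩ := isCompact_Icc.exists_sInf_image_eq_and_le hne hg₁
  have e0 : mu₀ ε₁ ε₂ b c = -g₀ ε₁ ε₂ b c y := by rw [mu₀, hys]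
  have e1 : mu₁ ε₁ ε₂ b c = g₁ ε₁ ε₂ b c z := by rw [mu₁, hzs]
  have hbp : ∀ x ∈ Icc (0 : ℝ) 1, 0 < b x := fun x hx => hlam.trans_le (hbl x hx)
  have hcp : ∀ x ∈ Icc (0 : ℝ) 1, 0 < c x := fun x hx => hβ.trans_le (hcβ x hx)
  rw [e0, e1]
  obtain ⟨q0, n0⟩ := g₀_eqn (ε₂ := ε₂) (b := b) hε₁ (hcp y hy)
  obtain ⟨q1, n1⟩ := g₁_eqn hε₁ hε₂ (hbp z hz) (hcp z hz)
  set s := g₀ ε₁ ε₂ b c y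
  set t := g₁ ε₁ ε₂ b c z
  have hleft : ∀ x ∈ Icc (0 : ℝ) 1, ε₁ * (-s) ^ 2 + ε₂ * b x * (-s) ≤ c x := by
    intro x hx
    obtain ⟨q, n⟩ := g₀_eqn (ε₂ := ε₂) (b := b) hε₁ (hcp x hx)
    have hle : g₀ ε₁ ε₂ b c x ≤ s := hymax x hx
    have h2 : s ^ 2 ≤ g₀ ε₁ ε₂ b c x ^ 2 := by nlinarith
    have h3 := mul_le_mul_of_nonneg_left h2 hε₁.le
    have h4 := mul_le_mul_of_nonneg_left hle (mul_pos hε₂ (hbp x hx)).le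
    linarith
  refine ⟨hε₁, hε₂, neg_pos.2 n0, ?_, hleft, ?_, ?_, ?_⟩
  · have h1 := hleft z hz
    have h2 : 0 < ε₂ * b z * (-s) := mul_pos (mul_pos hε₂ (hbp z hz)) (neg_pos.2 n0)
    have h3 : 0 < ε₂ * b z * t := mul_pos (mul_pos hε₂ (hbp z hz)) n1
    have h4 : (-s) ^ 2 ≤ t ^ 2 := le_of_mul_le_mul_left (by linarith) hε₁
    exact le_of_sq_le_sq h4 n1.le
  · have h1 : ε₂ * b y * (-s) ≤ ε₂ * M * (-s) :=
      mul_le_mul_of_nonneg_right (mul_le_mul_of_nonneg_left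
        ((le_abs_self _).trans (hbM y hy)) hε₂.le) (neg_pos.2 n0).le
    have := hcβ y hy
    linarith
  · intro x hx
    obtain ⟨q, n⟩ := g₁_eqn hε₁ hε₂ (hbp x hx) (hcp x hx)
    have hle : t ≤ g₁ ε₁ ε₂ b c x := hzmin x hx
    -- The product `t (ε₁t - ε₂b)` can be compared with its value at the larger root when the second
    -- factor is positive; otherwise it is nonpositive, hence below `c`.
    rcases le_or_gt (ε₁ * t - ε₂ * b x) 0 with h | h
    · have := hcp x hx
      nlinarith
    · have h5 : ε₁ * t - ε₂ * b x ≤ ε₁ * g₁ ε₁ ε₂ b c x - ε₂ * b x := by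
        have := mul_le_mul_of_nonneg_left hle hε₁.le
        linarith
      have := mul_le_mul hle h5 h.le n.le
      linarith
  · have h1 : ε₂ * lam * t ≤ ε₂ * b z * t :=
      mul_le_mul_of_nonneg_right (mul_le_mul_of_nonneg_left (hbl z hz) hε₂.le) n1.le
    have := hcβ z hz
    linarith

variable {lam β M ε₁ ε₂ μ₀ μ₁ p τ : ℝ} {b b₁ b₂ c c₁ c₂ f f₁ f₂ u u₁ u₂ : ℝ → ℝ}

/-- The number `y = ε₁μ₁` satisfies `y² ≤ ε₂My + Mε₁`, which fails for `y > M (ε₂ + √ε₁)` since `M ≥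
1`. -/
theorem LayerRates.eps_mul_mu_le (hd : DataBounds lam β M b b₁ b₂ c c₁ c₂ f f₁ f₂)
    (hl : LayerRates ε₁ ε₂ lam β M b c μ₀ μ₁) : ε₁ * μ₁ ≤ M * (ε₂ + √ε₁) := by
  have hε₁ := hl.pos₁
  have hε₂ := hl.pos₂
  have hμ := hl.mu₁_pos
  have hs := Real.sqrt_pos.2 hε₁
  have hss := Real.sq_sqrt hε₁.le
  have hM := hd.one_le
  have hr := hl.right_le 0 (by simp)
  have hb := (le_abs_self _).trans (hd.abs_b 0 (by simp))
  have hc := (le_abs_self _).trans (hd.abs_c 0 (by simp))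
  set s := √ε₁
  have h1 : ε₁ * μ₁ ^ 2 ≤ ε₂ * M * μ₁ + M := by
    have := mul_le_mul_of_nonneg_right (mul_le_mul_of_nonneg_left hb hε₂.le) hμ.le
    linarith
  by_contra hcon
  push Not at hcon
  have h2 := mul_le_mul_of_nonneg_left h1 hε₁.le
  have h4 : 0 < ε₁ * μ₁ := mul_pos hε₁ hμ
  have h5 := mul_lt_mul_of_pos_left hcon h4
  have h6 : M * ε₁ ≤ ε₁ * μ₁ * (M * s) := by
    have h7 : s ≤ ε₁ * μ₁ := by nlinarith
    have h8 := mul_le_mul_of_nonneg_right h7 (show 0 ≤ M * s by nlinarith)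
    nlinarith
  nlinarith

/-! ### A bound without layer information -/

/-- This is the equation tested with `u`: the integral of `(ε₂bu²/2 - ε₁uu')'` vanishes by the
boundary conditions, and the coercivity condition drops the term in `u²`. -/
theorem energy_estimate (hd : DataBounds lam β M b b₁ b₂ c c₁ c₂ f f₁ f₂) (hε : 0 < ε₁)
    (hu : HasDerivs u u₁ (eqnDeriv₂ ε₁ ε₂ b c f u u₁)) (h0 : u 0 = 0) (h1 : u 1 = 0)
    (hco : ∀ x ∈ Icc (0 : ℝ) 1, 0 ≤ c x - 1 / 2 * ε₂ * b₁ x) :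
    ε₁ * ∫ x in (0 : ℝ)..1, u₁ x ^ 2 ≤ M ^ 2 / β := by
  set G : ℝ → ℝ := fun x => u x * f x - (c x - 1 / 2 * ε₂ * b₁ x) * u x ^ 2 with hG
  have hGc : ContinuousOn G (Icc 0 1) :=
    (hu.continuousOn.mul hd.derivs_f.continuousOn).sub
      ((hd.derivs_c.continuousOn.sub (continuousOn_const.mul hd.derivs_b.continuousOn')).mul
        (hu.continuousOn.pow 2))
  have i1 : IntervalIntegrable (fun x => u₁ x ^ 2) volume 0 1 := by
    simpa using hu.intervalIntegrable_sq le_rfl zero_lt_one le_rfl 0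
  have i2 : IntervalIntegrable G volume 0 1 :=
    ContinuousOn.intervalIntegrable (by rwa [uIcc_of_le zero_le_one])
  have hftc : ∫ x in (0 : ℝ)..1, (G x - ε₁ * u₁ x ^ 2) = 0 := by
    have hcF : ContinuousOn (fun x => ε₂ / 2 * (b x * u x ^ 2) - ε₁ * (u x * u₁ x)) (Icc 0 1) :=
      (continuousOn_const.mul (hd.derivs_b.continuousOn.mul (hu.continuousOn.pow 2))).sub
        (continuousOn_const.mul (hu.continuousOn.mul hu.continuousOn'))
    rw [intervalIntegral.integral_eq_sub_of_hasDerivAt_of_le zero_le_one hcF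
      (fun x hx => ?_) (i2.sub (i1.const_mul _)), h0, h1]
    · ring
    · obtain ⟨d1, d2⟩ := hu.hasDerivAt hx
      have d3 := (hd.derivs_b.hasDerivAt hx).1
      refine (((d3.mul (d1.pow 2)).const_mul (ε₂ / 2)).sub
        ((d1.mul d2).const_mul ε₁)).congr_deriv ?_
      simp only [hG, eqnDeriv₂, Pi.pow_apply]
      field_simp
      ring
  rw [intervalIntegral.integral_sub i2 (i1.const_mul _), intervalIntegral.integral_const_mul] at hftc
  have hbd : ∫ x in (0 : ℝ)..1, G x ≤ ∫ _ in (0 : ℝ)..1, M ^ 2 / β := by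
    refine intervalIntegral.integral_mono_on zero_le_one i2 intervalIntegrable_const fun x hx => ?_
    have a1 := mul_nonneg (hco x hx) (sq_nonneg (u x))
    have a2 : u x * f x ≤ M / β * M := by
      refine (le_abs_self _).trans ?_
      rw [abs_mul]
      exact mul_le_mul (abs_solution_le hd hε hu h0 h1 x hx) (hd.abs_f x hx) (abs_nonneg _)
        (div_nonneg (zero_le_one.trans hd.one_le) hd.beta_pos.le)
    have a3 : M / β * M = M ^ 2 / β := by ring
    simp only [hG]
    linarith
  simp only [intervalIntegral.integral_const, sub_zero, one_smul] at hbd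
  linarith

/-- Linear interpolation is stable: it does not enlarge the integral of `u'²`, and the error is at
most twice the maximum of `|u|`. No property of the mesh enters. -/
theorem energyNorm_err_le (hd : DataBounds lam β M b b₁ b₂ c c₁ c₂ f f₁ f₂) (hε : 0 < ε₁)
    (hu : HasDerivs u u₁ (eqnDeriv₂ ε₁ ε₂ b c f u u₁)) (h0 : u 0 = 0) (h1 : u 1 = 0)
    (hco : ∀ x ∈ Icc (0 : ℝ) 1, 0 ≤ c x - 1 / 2 * ε₂ * b₁ x) {X : ℕ → ℝ} {N : ℕ}
    (hX : IsMesh X N) :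
    energyNorm ε₁ (u - lagrange X N u) ≤ √(M ^ 2 / β) + 2 * (M / β) := by
  have hB : 0 ≤ M / β := div_nonneg (zero_le_one.trans hd.one_le) hd.beta_pos.le
  refine energyNorm_le hε.le (by positivity) ?_ fun x hx => ?_
  · rw [(hX.err_memH1 hu).2]
    refine (mul_le_mul_of_nonneg_left ?_ hε.le).trans (energy_estimate hd hε hu h0 h1 hco)
    have hi : ∀ j < N, IntervalIntegrable (fun x => u₁ x ^ 2) volume (X j) (X (j + 1)) :=
      fun j hj => by
        simpa using hu.intervalIntegrable_sq (hX.nonneg hj.le) (hX.lt_succ j hj) (hX.le_one hj) 0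
    have e := intervalIntegral.sum_integral_adjacent_intervals hi
    rw [hX.zero, hX.last] at e
    rw [← e]
    refine Finset.sum_le_sum fun j hj => ?_
    have hj' := Finset.mem_range.1 hj
    exact hu.integral_deriv_sub_slope_sq_le (hX.nonneg hj'.le) (hX.lt_succ j hj') (hX.le_one hj')
  · obtain ⟨j, hj, hxj⟩ := hX.exists_mem hx
    rw [hX.err_eq u hj hxj]
    exact abs_chordErr_le_two_mul (hX.lt_succ j hj) (fun y hy => abs_solution_le hd hε hu h0 h1 y
      (Icc_subset_Icc (hX.nonneg hj.le) (hX.le_one hj) hy)) hxj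

end TwoParam

namespace TwoParam

/-! ### The interpolation error on the Bakhvalov-type mesh -/

theorem integral_exp_left_le {r : ℝ} (hr : 0 < r) :
    ∫ x in (0 : ℝ)..1, Real.exp (-r * x) ≤ 1 / r := by
  have h2 : ∫ t in (0 : ℝ)..1, Real.exp (-r * t) =
      -(1 / r * Real.exp (-r * 1)) - -(1 / r * Real.exp (-r * 0)) := by
    refine intervalIntegral.integral_eq_sub_of_hasDerivAt
      (f := fun t => -(1 / r * Real.exp (-r * t))) (fun t _ => ?_)
      (Continuous.intervalIntegrable (by fun_prop) _ _)
    refine ((hasDerivAt_exp_left r t).const_mul (1 / r)).neg.congr_deriv ?_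
    field_simp
  rw [h2, mul_zero, Real.exp_zero]
  have : 0 ≤ 1 / r * Real.exp (-r * 1) := by positivity
  linarith

theorem integral_exp_right_le {r : ℝ} (hr : 0 < r) :
    ∫ x in (0 : ℝ)..1, Real.exp (-r * (1 - x)) ≤ 1 / r := by
  have := intervalIntegral.integral_comp_sub_left (a := 0) (b := 1)
    (fun x => Real.exp (-r * x)) 1
  rw [this, sub_self, sub_zero]
  exact integral_exp_left_le hr

theorem IsLayer.integral_reflect_le {F F₁ F₂ : ℝ → ℝ} {K p μ D n a b : ℝ}
    (h : IsLayer F F₁ F₂ K p μ)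
    (hK : 0 ≤ K) (hp : 0 < p) (hμ : 0 < μ) (hD : 1 ≤ D) (hn : 0 < n) (ha : 0 ≤ a) (hab : a < b)
    (hb : b ≤ 1) (had : LayerAdapted p μ D n (1 - b) (1 - a)) :
    ∫ x in a..b, (F₁ (1 - x) - (F (1 - a) - F (1 - b)) / (b - a)) ^ 2 ≤
      K ^ 2 * D ^ 3 / n ^ 2 * μ ^ 2 * ∫ x in a..b, Real.exp (-(p * μ) * (1 - x)) := by
  have := h.integral_deriv_sub_slope_sq_le hK hp hμ hD hn (a := 1 - b) (b := 1 - a)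
    (by linarith) (by linarith) (by linarith) had
  rw [sub_sub_sub_cancel_left] at this
  rw [intervalIntegral.integral_comp_sub_left
    (fun x => (F₁ x - (F (1 - a) - F (1 - b)) / (b - a)) ^ 2),
    intervalIntegral.integral_comp_sub_left (fun x => Real.exp (-(p * μ) * x))]
  exact this

variable {lam β M ε₁ ε₂ μ₀ μ₁ p τ : ℝ} {b b₁ b₂ c c₁ c₂ f f₁ f₂ u u₁ u₂ : ℝ → ℝ} {m : ℕ}

theorem MeshParams.isMesh (h : MeshParams τ p μ₀ μ₁ m) :
    IsMesh (meshPt τ p μ₀ μ₁ (4 * m)) (4 * m) :=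
  ⟨h.meshPt_zero, h.meshPt_last, fun _ hi => h.lt_succ hi⟩

/-- Error bounds on a mesh which is adapted to two layers. -/
theorem IsMesh.error_bounds {X : ℕ → ℝ} {N : ℕ} {K W Dc n : ℝ} (hX : IsMesh X N)
    (hp₀ : 0 < p) (hp₁ : p < 1) (hμ₀ : 1 ≤ μ₀) (hμ : μ₀ ≤ μ₁) (hDc : 1 ≤ Dc) (hn : 0 < n)
    (hW : ∀ j < N, X (j + 1) - X j ≤ W / n)
    (hA₀ : ∀ j < N, LayerAdapted p μ₀ Dc n (X j) (X (j + 1)))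
    (hA₁ : ∀ j < N, LayerAdapted p μ₁ Dc n (1 - X (j + 1)) (1 - X j))
    (hu : HasDerivs u u₁ u₂) (huc : ContinuousOn u₂ (Icc 0 1))
    (hK : ∀ x ∈ Icc (0 : ℝ) 1,
      |u₂ x| ≤ K * barrier 1 (μ₀ ^ 2) (μ₁ ^ 2) (p * μ₀) (p * μ₁) x) :
    (∫ x, weakDeriv (u - lagrange X N u) x ^ 2 ∂vol ≤
      3 * (K ^ 2 * W ^ 2 + 2 * ((K / p ^ 2) ^ 2 * Dc ^ 3 / p)) / n ^ 2 * μ₁) ∧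
    ∀ x ∈ Icc (0 : ℝ) 1, |(u - lagrange X N u) x| ≤
      (K * W ^ 2 + 4 * (K / p ^ 2) * Dc ^ 2) / n ^ 2 := by
  have hμ₀' : 0 < μ₀ := by linarith
  have hμ₁' : 0 < μ₁ := by linarith
  obtain ⟨S, S₁, S₂, E, E₁, E₂, D, D₁, D₂, hS, hS₂, hE, hD, hsum, hsum₁⟩ :=
    exists_decomposition hp₀ hp₁ hμ₀' hμ₁' hu huc hK
  have hK0 : 0 ≤ K := (abs_nonneg _).trans (hS₂ 0 (by simp))
  set K' := K / p ^ 2 with hK'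
  have hK'0 : 0 ≤ K' := by positivity
  have hW2 : ∀ j < N, (X (j + 1) - X j) ^ 2 ≤ W ^ 2 / n ^ 2 := fun j hj => by
    rw [← div_pow]
    exact pow_le_pow_left₀ (sub_nonneg.2 (hX.lt_succ j hj).le) (hW j hj) 2
  constructor
  · rw [(hX.err_memH1 hu).2]
    set A := K' ^ 2 * Dc ^ 3 / n ^ 2 with hA
    have hA0 : 0 ≤ A := by positivity
    have hstep : ∀ j ∈ Finset.range N, ∫ x in X j..X (j + 1),
        (u₁ x - (u (X (j + 1)) - u (X j)) / (X (j + 1) - X j)) ^ 2 ≤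
        3 * (K ^ 2 * (W ^ 2 / n ^ 2) * (X (j + 1) - X j)
          + A * μ₀ ^ 2 * (∫ x in X j..X (j + 1), Real.exp (-(p * μ₀) * x))
          + A * μ₁ ^ 2 * ∫ x in X j..X (j + 1), Real.exp (-(p * μ₁) * (1 - x))) := by
      intro j hj
      replace hj := Finset.mem_range.1 hj
      have ha := hX.nonneg hj.le
      have hab := hX.lt_succ j hj
      have hb := hX.le_one (i := j + 1) hj
      have w2 := hW2 j hj
      have t2 := hE.integral_deriv_sub_slope_sq_le hK'0 hp₀ hμ₀' hDc hn ha hab hb (hA₀ j hj)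
      have t3 := hD.integral_reflect_le hK'0 hp₀ hμ₁' hDc hn ha hab hb (hA₁ j hj)
      set x₀ := X j
      set x₁ := X (j + 1)
      set s₁ := (S x₁ - S x₀) / (x₁ - x₀) with hs₁
      set s₂ := (E x₁ - E x₀) / (x₁ - x₀) with hs₂
      set s₃ := (D (1 - x₀) - D (1 - x₁)) / (x₁ - x₀) with hs₃
      have hs : (u x₁ - u x₀) / (x₁ - x₀) = s₁ + s₂ - s₃ := by
        rw [hsum, hsum, hs₁, hs₂, hs₃]; ring
      have i0 := hu.intervalIntegrable_sq ha hab hb (s₁ + s₂ - s₃)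
      have i1 := hS.intervalIntegrable_sq ha hab hb s₁
      have i2 := hE.derivs.intervalIntegrable_sq ha hab hb s₂
      have i3 : IntervalIntegrable (fun x => (D₁ (1 - x) - s₃) ^ 2) volume x₀ x₁ := by
        have := hD.derivs.reflect.intervalIntegrable_sq ha hab hb (-s₃)
        refine this.congr (fun x _ => ?_)
        ring
      have t1 : ∫ x in x₀..x₁, (S₁ x - s₁) ^ 2 ≤ K ^ 2 * (W ^ 2 / n ^ 2) * (x₁ - x₀) := by
        have : ∫ x in x₀..x₁, (S₁ x - s₁) ^ 2 ≤ ∫ _ in x₀..x₁, K ^ 2 * (W ^ 2 / n ^ 2) := by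
          refine intervalIntegral.integral_mono_on hab.le i1 intervalIntegrable_const
            fun x hx => ?_
          have := pow_le_pow_left₀ (abs_nonneg _) (hS.abs_deriv_sub_slope_le ha hab hb
            (fun y hy => hS₂ y (Icc_subset_Icc ha hb hy)) hx) 2
          rw [sq_abs, mul_pow] at this
          exact this.trans (mul_le_mul_of_nonneg_left w2 (sq_nonneg _))
        refine this.trans (le_of_eq ?_)
        rw [intervalIntegral.integral_const, smul_eq_mul]; ring
      have hle : ∫ x in x₀..x₁, (u₁ x - (s₁ + s₂ - s₃)) ^ 2 ≤ ∫ x in x₀..x₁,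
          3 * ((S₁ x - s₁) ^ 2 + (E₁ x - s₂) ^ 2 + (D₁ (1 - x) - s₃) ^ 2) := by
        refine intervalIntegral.integral_mono_on hab.le i0
          (((i1.add i2).add i3).const_mul 3) fun x _ => ?_
        rw [hsum₁]
        nlinarith [sq_nonneg ((S₁ x - s₁) - (E₁ x - s₂)),
          sq_nonneg ((S₁ x - s₁) + (D₁ (1 - x) - s₃)),
          sq_nonneg ((E₁ x - s₂) + (D₁ (1 - x) - s₃))]
      rw [intervalIntegral.integral_const_mul, intervalIntegral.integral_add (i1.add i2) i3,
        intervalIntegral.integral_add i1 i2] at hle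
      rw [hs]
      linarith
    refine (Finset.sum_le_sum hstep).trans ?_
    -- The mesh widths telescope to `1`, and the exponential integrals add up to integrals over
    -- `[0,1]`, each at most `1/(pμ)`. All three contributions are then dominated by `μ₁`, as `1 ≤
    -- μ₀ ≤ μ₁`.
    rw [← Finset.mul_sum, Finset.sum_add_distrib, Finset.sum_add_distrib, ← Finset.mul_sum,
      ← Finset.mul_sum, ← Finset.mul_sum, Finset.sum_range_sub,
      intervalIntegral.sum_integral_adjacent_intervals
        (fun j _ => Continuous.intervalIntegrable (by fun_prop) _ _),
      intervalIntegral.sum_integral_adjacent_intervals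
        (fun j _ => Continuous.intervalIntegrable (by fun_prop) _ _), hX.zero, hX.last]
    have a1 := mul_le_mul_of_nonneg_left (integral_exp_left_le (mul_pos hp₀ hμ₀'))
      (show 0 ≤ A * μ₀ ^ 2 by positivity)
    have a2 := mul_le_mul_of_nonneg_left (integral_exp_right_le (mul_pos hp₀ hμ₁'))
      (show 0 ≤ A * μ₁ ^ 2 by positivity)
    have e1 : A * μ₀ ^ 2 * (1 / (p * μ₀)) = A / p * μ₀ := by field_simp
    have e2 : A * μ₁ ^ 2 * (1 / (p * μ₁)) = A / p * μ₁ := by field_simp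
    rw [e1] at a1
    rw [e2] at a2
    have a3 : A / p * μ₀ ≤ A / p * μ₁ := mul_le_mul_of_nonneg_left hμ (by positivity)
    have a4 : K ^ 2 * (W ^ 2 / n ^ 2) * 1 ≤ K ^ 2 * (W ^ 2 / n ^ 2) * μ₁ :=
      mul_le_mul_of_nonneg_left (by linarith) (by positivity)
    have e3 : 3 * (K ^ 2 * W ^ 2 + 2 * (K' ^ 2 * Dc ^ 3 / p)) / n ^ 2 * μ₁ =
        3 * (K ^ 2 * (W ^ 2 / n ^ 2) * μ₁ + A / p * μ₁ + A / p * μ₁) := by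
      rw [hA]; field_simp; ring
    rw [e3, sub_zero]
    linarith
  · intro x hx
    obtain ⟨j, hj, hxj⟩ := hX.exists_mem hx
    have ha := hX.nonneg hj.le
    have hab := hX.lt_succ j hj
    have hb := hX.le_one (i := j + 1) hj
    have w2 := hW2 j hj
    have t1 := hS.abs_chordErr_le ha hab hb (fun y hy => hS₂ y (Icc_subset_Icc ha hb hy)) hxj
    have t2 := hE.abs_chordErr_le hK'0 hp₀ hμ₀' hDc hn ha hab hb (hA₀ j hj) hxj
    have t3 := hD.abs_chordErr_le hK'0 hp₀ hμ₁' hDc hn (a := 1 - X (j + 1)) (b := 1 - X j)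
      (by linarith) (by linarith) (by linarith) (hA₁ j hj) (x := 1 - x)
      ⟨by linarith [hxj.2], by linarith [hxj.1]⟩
    have e : chordErr u (X j) (X (j + 1)) x = chordErr S (X j) (X (j + 1)) x
        + chordErr E (X j) (X (j + 1)) x + chordErr D (1 - X (j + 1)) (1 - X j) (1 - x) := by
      have hne : X (j + 1) - X j ≠ 0 := by linarith
      unfold chordErr
      rw [hsum, hsum, hsum, sub_sub_sub_cancel_left, sub_sub_sub_cancel_left]
      field_simp
      ring
    rw [hX.err_eq u hj hxj, e]
    refine (abs_add_three _ _ _).trans ((add_le_add (add_le_add t1 t2) t3).trans ?_)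
    have := mul_le_mul_of_nonneg_left w2 hK0
    refine (add_le_add (add_le_add this le_rfl) le_rfl).trans (le_of_eq ?_)
    field_simp
    ring

/-- `ε₁` times the derivative bound of `IsMesh.error_bounds` is controlled through
`LayerRates.eps_mul_mu_le`, which produces `√(GM)`; the pointwise bound produces `H`. -/
theorem exists_error_bound_of_small {lam β M p τ : ℝ} (hlam : 0 < lam) (hβ : 0 < β) (hM : 1 ≤ M)
    (hp₀ : 0 < p) (hp₁ : p < 1) :
    ∃ C : ℝ, 0 < C ∧ ∀ (ε₁ ε₂ μ₀ μ₁ : ℝ) (b b₁ b₂ c c₁ c₂ f f₁ f₂ u u₁ : ℝ → ℝ) (m : ℕ),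
      DataBounds lam β M b b₁ b₂ c c₁ c₂ f f₁ f₂ → LayerRates ε₁ ε₂ lam β M b c μ₀ μ₁ →
      4 * ε₂ * M ≤ (1 - p) * β → HasDerivs u u₁ (eqnDeriv₂ ε₁ ε₂ b c f u u₁) →
      u 0 = 0 → u 1 = 0 → MeshParams τ p μ₀ μ₁ m →
      energyNorm ε₁ (u - lagrange (meshPt τ p μ₀ μ₁ (4 * m)) (4 * m) u) ≤
        C * √(ε₂ + √ε₁) * (4 * m : ℝ)⁻¹ + C * ((4 * m : ℝ) ^ 2)⁻¹ := by
  obtain ⟨K, hK, hbound⟩ := exists_second_deriv_bound hlam hβ hM hp₀ hp₁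
  set Dc := MeshParams.const τ p with hDc
  set W := 4 * τ / p with hW
  set G := 3 * (K ^ 2 * W ^ 2 + 2 * ((K / p ^ 2) ^ 2 * Dc ^ 3 / p)) with hG
  set H := K * W ^ 2 + 4 * (K / p ^ 2) * Dc ^ 2 with hH
  have hH0 : 0 ≤ H := by positivity
  refine ⟨√(G * M) + H + 1, by positivity, ?_⟩
  intro ε₁ ε₂ μ₀ μ₁ b b₁ b₂ c c₁ c₂ f f₁ f₂ u u₁ m hd hl hsm hu hu0 hu1 hmesh
  have hn : (0 : ℝ) < 4 * m := by have := hmesh.m_pos; linarith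
  have hε₁ := hl.pos₁
  have hDc1 : 1 ≤ Dc := hmesh.one_le_const
  have hG0 : 0 ≤ G := by
    have : 0 ≤ Dc := by linarith
    positivity
  have hX := hmesh.isMesh
  obtain ⟨h1, h2⟩ := hX.error_bounds (n := 4 * m) hp₀ hp₁ hmesh.one_lt.le hl.mu_le hDc1 hn
    (fun j hj => hmesh.width_le hj) (fun j hj => hmesh.adapted hj)
    (fun j hj => hmesh.adapted_reflect hj) hu (hasDerivs_deriv hd hu).continuousOn'
    (hbound ε₁ ε₂ μ₀ μ₁ b b₁ b₂ c c₁ c₂ f f₁ f₂ u u₁ hd hl hmesh.one_lt.le hsm hu hu0 hu1)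
  set n : ℝ := 4 * m with hnm
  set q := ε₂ + √ε₁ with hq
  have hq0 : 0 ≤ q := add_nonneg hl.pos₂.le (Real.sqrt_nonneg _)
  have h3 : ε₁ * ∫ x, weakDeriv (u - lagrange (meshPt τ p μ₀ μ₁ (4 * m)) (4 * m) u) x ^ 2 ∂vol ≤
      (G * M) * q / n ^ 2 := by
    refine (mul_le_mul_of_nonneg_left h1 hε₁.le).trans ?_
    have := mul_le_mul_of_nonneg_left (hl.eps_mul_mu_le hd) (show 0 ≤ G / n ^ 2 by positivity)
    refine le_trans (le_of_eq ?_) (this.trans (le_of_eq ?_)) <;> ring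
  refine (energyNorm_le hε₁.le (by positivity) h3 h2).trans ?_
  have hM0 : 0 ≤ M := zero_le_one.trans hM
  rw [Real.sqrt_div (by positivity), Real.sqrt_mul (by positivity), Real.sqrt_sq hn.le,
    div_eq_mul_inv, div_eq_mul_inv]
  refine add_le_add ?_ ?_
  · refine mul_le_mul_of_nonneg_right (mul_le_mul_of_nonneg_right ?_ (Real.sqrt_nonneg _))
      (by positivity)
    linarith
  · refine mul_le_mul_of_nonneg_right ?_ (by positivity)
    have := Real.sqrt_nonneg (G * M)
    linarith

end TwoParam

end

/-! ### The theorem: small and large `ε₂` -/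

theorem mainTheorem3
    (b c f : ℝ → ℝ)
    (hb : ContDiffOn ℝ 2 b (Set.Icc 0 1)) (hc : ContDiffOn ℝ 2 c (Set.Icc 0 1))
    (hf : ContDiffOn ℝ 2 f (Set.Icc 0 1))
    (lam β γ : ℝ) (hlam : 0 < lam) (hβ : 0 < β) (hγ : 0 < γ)
    (hblam : ∀ x ∈ Set.Icc (0 : ℝ) 1, lam ≤ b x)
    (hcβ : ∀ x ∈ Set.Icc (0 : ℝ) 1, β ≤ c x)
    (p τ : ℝ) (hp₀ : 0 < p) (hp₁ : p < 1) (hτ : 5 / 2 ≤ τ) :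
    ∃ C : ℝ, 0 < C ∧
      ∀ ε₁ ε₂ : ℝ, 0 < ε₁ → 0 < ε₂ →
      (∀ x ∈ Set.Icc (0 : ℝ) 1,
        γ ≤ c x - 1 / 2 * ε₂ * derivWithin b (Set.Icc 0 1) x) →
      ∀ μ₀ μ₁ : ℝ, μ₀ = TwoParam.mu₀ ε₁ ε₂ b c → μ₁ = TwoParam.mu₁ ε₁ ε₂ b c →
      ∀ N : ℕ, 16 ≤ N → 4 ∣ N →
      TwoParam.sigma τ p μ₀ ≤ 1 / 4 → TwoParam.sigma τ p μ₁ ≤ 1 / 4 →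
      μ₀⁻¹ ≤ (N : ℝ)⁻¹ →
      ∀ u : ℝ → ℝ, TwoParam.IsSolution ε₁ ε₂ b c f u →
      ∀ uI : ℝ → ℝ, uI = TwoParam.lagrange (TwoParam.meshPt τ p μ₀ μ₁ N) N u →
        TwoParam.MemH1 (u - uI) ∧
        TwoParam.energyNorm ε₁ (u - uI) ≤
          C * (ε₂ + ε₁ ^ (1 / 2 : ℝ)) ^ (1 / 2 : ℝ) * (N : ℝ)⁻¹ + C * ((N : ℝ) ^ 2)⁻¹ := by
  open TwoParam in
  obtain ⟨b₂, Mb, hdb, hMb⟩ := exists_bounds_of_contDiffOn hb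
  obtain ⟨c₂, Mc, hdc, hMc⟩ := exists_bounds_of_contDiffOn hc
  obtain ⟨f₂, Mf, hdf, hMf⟩ := exists_bounds_of_contDiffOn hf
  set M := max 1 (max Mb (max Mc Mf)) with hMdef
  have hM1 : 1 ≤ M := le_max_left _ _
  have hM0 : 0 < M := zero_lt_one.trans_le hM1
  have hbM : Mb ≤ M := (le_max_left _ _).trans (le_max_right _ _)
  have hcM : Mc ≤ M := (le_max_left _ _).trans ((le_max_right _ _).trans (le_max_right _ _))
  have hfM : Mf ≤ M := (le_max_right _ _).trans ((le_max_right _ _).trans (le_max_right _ _))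
  have hd : DataBounds lam β M b _ b₂ c _ c₂ f _ f₂ :=
    { lam_pos := hlam
      beta_pos := hβ
      one_le := hM1
      derivs_b := hdb
      derivs_c := hdc
      derivs_f := hdf
      lam_le := hblam
      beta_le := hcβ
      abs_b := fun x hx => (hMb x hx).1.trans hbM
      abs_b₁ := fun x hx => (hMb x hx).2.1.trans hbM
      abs_b₂ := fun x hx => (hMb x hx).2.2.trans hbM
      abs_c := fun x hx => (hMc x hx).1.trans hcM
      abs_c₁ := fun x hx => (hMc x hx).2.1.trans hcM
      abs_c₂ := fun x hx => (hMc x hx).2.2.trans hcM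
      abs_f := fun x hx => (hMf x hx).1.trans hfM
      abs_f₁ := fun x hx => (hMf x hx).2.1.trans hfM
      abs_f₂ := fun x hx => (hMf x hx).2.2.trans hfM }
  obtain ⟨C₁, hC₁, hsmall⟩ := exists_error_bound_of_small (τ := τ) hlam hβ hM1 hp₀ hp₁
  -- An upper bound for `N` when `4ε₂M > (1-p)β`. The factor `L²` in `C₂` lets `C₂ N⁻²` dominate the
  -- uniform bound in that case.
  set L := 4 * M ^ 2 / ((1 - p) * β * lam) with hL
  have h1p : 0 < 1 - p := by linarith
  set C₂ := (√(M ^ 2 / β) + 2 * (M / β)) * L ^ 2 with hC₂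
  have hC₂0 : 0 < C₂ := by positivity
  refine ⟨C₁ + C₂, by positivity, ?_⟩
  intro ε₁ ε₂ hε₁ hε₂ hγc μ₀ μ₁ hμ₀ hμ₁ N hN hN4 hσ₀ hσ₁ hμN u hu uI huI
  subst huI
  obtain ⟨m, rfl⟩ := hN4
  have hl : LayerRates ε₁ ε₂ lam β M b c μ₀ μ₁ := by
    rw [hμ₀, hμ₁]
    exact layerRates hlam hβ hε₁ hε₂ hb.continuousOn hc.continuousOn hblam hcβ hd.abs_b
  have hn : (0 : ℝ) < (4 * m : ℕ) := by exact_mod_cast (show 0 < 4 * m by omega)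
  have hle : ((4 * m : ℕ) : ℝ) ≤ μ₀ := (inv_le_inv₀ hl.mu_pos hn).1 hμN
  have hmesh : MeshParams τ p μ₀ μ₁ m :=
    { pos := by omega
      p_pos := hp₀
      p_lt := hp₁
      two_le := by linarith
      four_le := by omega
      le₀ := by exact_mod_cast hle
      le₁ := by
        have := hle.trans hl.mu_le
        exact_mod_cast this
      sigma₀ := hσ₀
      sigma₁ := hσ₁ }
  obtain ⟨u₁, hu₁⟩ := hu.regular hε₁ hb.continuousOn hc.continuousOn hf.continuousOn
  have hder : HasDerivs u u₁ (eqnDeriv₂ ε₁ ε₂ b c f u u₁) := hu₁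
  have hu0 := hu.1.2.2.1
  have hu1 := hu.1.2.2.2
  refine ⟨(hmesh.isMesh.err_memH1 hder).1, ?_⟩
  rw [← Real.sqrt_eq_rpow, ← Real.sqrt_eq_rpow]
  set n : ℝ := ((4 * m : ℕ) : ℝ) with hnm
  have hn4 : (4 * m : ℝ) = n := by rw [hnm]; push_cast; ring
  have hq : 0 ≤ √(ε₂ + √ε₁) * n⁻¹ := by positivity
  have hn2 : 0 ≤ (n ^ 2)⁻¹ := by positivity
  rcases le_or_gt (4 * ε₂ * M) ((1 - p) * β) with hs | hs
  · have := hsmall ε₁ ε₂ μ₀ μ₁ b _ b₂ c _ c₂ f _ f₂ u u₁ m hd hl hs hder hu0 hu1 hmesh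
    rw [hn4] at this
    have e1 := mul_nonneg hC₂0.le hq
    have e2 := mul_nonneg hC₂0.le hn2
    linarith
  · have hE := energyNorm_err_le hd hε₁ hder hu0 hu1 (fun x hx => hγ.le.trans (hγc x hx))
      hmesh.isMesh
    -- The left characteristic inequality gives `ε₂ lam μ₀ ≤ M`, so an `ε₂` bounded below bounds
    -- `μ₀`, and with it `N ≤ μ₀`.
    have hnL : n ≤ L := by
      have h1 := hl.left_le 0 (by simp)
      have h2 : ε₂ * lam * μ₀ ≤ M := by
        have a1 : ε₂ * lam * μ₀ ≤ ε₂ * b 0 * μ₀ := mul_le_mul_of_nonneg_right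
          (mul_le_mul_of_nonneg_left (hblam 0 (by simp)) hε₂.le) hl.mu_pos.le
        have a2 : 0 ≤ ε₁ * μ₀ ^ 2 := by positivity
        have a3 := (le_abs_self _).trans (hd.abs_c 0 (by simp))
        linarith
      refine hle.trans ?_
      rw [hL, le_div_iff₀ (by positivity)]
      have hlm : 0 < lam * μ₀ := mul_pos hlam hl.mu_pos
      have a4 := mul_le_mul_of_nonneg_right hs.le hlm.le
      have a5 := mul_le_mul_of_nonneg_left h2 (show 0 ≤ 4 * M by positivity)
      linarith
    have h4 : (√(M ^ 2 / β) + 2 * (M / β)) ≤ C₂ * (n ^ 2)⁻¹ := by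
      rw [← div_eq_mul_inv, le_div_iff₀ (by positivity), hC₂]
      exact mul_le_mul_of_nonneg_left (pow_le_pow_left₀ hn.le hnL 2) (by positivity)
    have e1 := mul_nonneg hC₂0.le hq
    have e2 := mul_nonneg hC₁.le hq
    have e3 := mul_nonneg hC₁.le hn2
    linarith
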